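/- Let $R$ be a principal ideal domain. A connected, coaugmented chain coalgebra $C$ over $R$ is a non-negatively graded differential graded coalgebra $(C,d,\Delta,\varepsilon)$, free over $R$ in each degree, with a coaugmentation $R\to C$, $1\mapsto 1$, onto $C_0$. Let $\overline C=C_{>0}$, and let $\Omega C=\big(T(s^{-1}\overline C),d_\Omega\big)$ be its cobar construction, augmented by $\epsilon(s^{-1}c)=0$, where $d_\Omega$ is the graded derivation with $$d_\Omega (s^{-1}c)=-s^{-1}(dc)+\sum(-1)^{|c_i|}s^{-1}c_i\,|\,s^{-1}c^i,\qquad \Delta c=\sum c_i\otimes c^i,$$ and $s^{-1}$ is set to zero on $C_0$. The coHochschild complex $\widehat{\mathscr H}(C)$ is $C\otimes\Omega C$ with the differential $$d(c\otimes w)=dc\otimes w+(-1)^{|c|}c\otimes d_\Omega w-\sum(-1)^{|c_i|}c_i\otimes (s^{-1}c^i)\,w+\sum(-1)^{(|c_i|-1)(|c^i|+|w|)}c^i\otimes w\,(s^{-1}c_i).$$ A Hirsch coalgebra $(C,\psi)$ is such a $C$ together with a morphism of chain algebras $\psi:\Omega C\to\Omega C\otimes\Omega C$ that is coassociative, with counit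 the augmentation $\epsilon$; it is balanced if $\psi$ is graded cocommutative. A morphism $(C,\psi)\to(C',\psi')$ of Hirsch coalgebras is a morphism $f:C\to C'$ of coaugmented chain coalgebras with $(\Omega f\otimes\Omega f)\psi=\psi'\,\Omega f$. The $r$-th power map $\lambda_r:\Omega C\to\Omega C$ is the $r$-fold iterated comultiplication $\Omega C\to(\Omega C)^{\otimes r}$ given by $\psi$, followed by the iterated multiplication $(\Omega C)^{\otimes r}\to\Omega C$. Then for every integer $r\ge 1$ there is a family of chain maps $$\widetilde\lambda_r:\widehat{\mathscr H}(C)\to\widehat{\mathscr H}(C),$$ one for each balanced Hirsch coalgebra $(C,\psi)$ over $R$, such that the diagram $$\begin{array}{ccccc}\Omega C&\to&\widehat{\mathscr H}(C)&\to&C\\ {\scriptstyle\lambda_r}\downarrow&&{\scriptstyle\widetilde\lambda_r}\downarrow&&\parallel\\ \Omega C&\to&\widehat{\mathscr H}(C)&\to&C\end{array}$$ commutes, where the horizontal maps are $w\mapsto 1\otimes w$ and $c\otimes w\mapsto\epsilon(w)\,c$. The family is natural: $(f\otimes\Omega f)\,\widetilde\lambda_r=\widetilde\lambda_r\,(f\otimes\Omega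 f)$ for every morphism $f$ of balanced Hirsch coalgebras. -/

import Mathlib

open scoped TensorProduct DirectSum

set_option linter.unusedSimpArgs false

universe u v w w'

namespace CoHochschild

section Tensor

variable {R : Type u} [CommRing R]
  {M : Type v} [AddCommGroup M] [Module R M] (𝓜 : ℕ → Submodule R M)
  {N : Type w} [AddCommGroup N] [Module R N] (𝓝 : ℕ → Submodule R N)

/-- The total grading of a tensor product of graded modules. -/
def tensorGrading (n : ℕ) : Submodule R (M ⊗[R] N) :=
  ⨆ p : {p : ℕ × ℕ // p.1 + p.2 = n},
    Submodule.map₂ (TensorProduct.mk R M N) (𝓜 p.1.1) (𝓝 p.1.2)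

variable {𝓜 𝓝}

theorem tmul_mem_tensorGrading {p q n : ℕ} (h : p + q = n) {x : M} (hx : x ∈ 𝓜 p) {y : N}
    (hy : y ∈ 𝓝 q) : x ⊗ₜ[R] y ∈ tensorGrading 𝓜 𝓝 n :=
  Submodule.mem_iSup_of_mem (⟨(p, q), h⟩ : {p : ℕ × ℕ // p.1 + p.2 = n})
    (Submodule.apply_mem_map₂ _ hx hy)

theorem tensorGrading_le {n : ℕ} {S : Submodule R (M ⊗[R] N)}
    (h : ∀ p q, p + q = n → ∀ x ∈ 𝓜 p, ∀ y ∈ 𝓝 q, x ⊗ₜ[R] y ∈ S) :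
    tensorGrading 𝓜 𝓝 n ≤ S :=
  iSup_le fun p => Submodule.map₂_le.2 fun x hx y hy => h _ _ p.2 x hx y hy

/-- The degree `n - 1` part of an `ℕ`-graded module, which is zero for `n = 0`. -/
def lower (𝓜 : ℕ → Submodule R M) : ℕ → Submodule R M
  | 0 => ⊥
  | n + 1 => 𝓜 n

theorem tmul_mem_lower {p q n : ℕ} (h : p + q = n) {x : M} (hx : x ∈ lower 𝓜 p) {y : N}
    (hy : y ∈ 𝓝 q) : x ⊗ₜ[R] y ∈ lower (tensorGrading 𝓜 𝓝) n := by
  cases p with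
  | zero => have h0 : x = 0 := hx
            rw [h0, TensorProduct.zero_tmul]; exact Submodule.zero_mem _
  | succ p => have h1 : n = p + q + 1 := by omega
              subst h1; exact tmul_mem_tensorGrading (𝓜 := 𝓜) (𝓝 := 𝓝) (p := p) rfl hx hy

theorem tmul_mem_lower' {p q n : ℕ} (h : p + q = n) {x : M} (hx : x ∈ 𝓜 p) {y : N}
    (hy : y ∈ lower 𝓝 q) : x ⊗ₜ[R] y ∈ lower (tensorGrading 𝓜 𝓝) n := by
  cases q with
  | zero => have h0 : y = 0 := hy
            rw [h0, TensorProduct.tmul_zero]; exact Submodule.zero_mem _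
  | succ q => have h1 : n = p + q + 1 := by omega
              subst h1; exact tmul_mem_tensorGrading (𝓜 := 𝓜) (𝓝 := 𝓝) (q := q) rfl hx hy

end Tensor

section Graded

variable {R : Type u} [CommRing R]
  {M : Type v} [AddCommGroup M] [Module R M] (𝓜 : ℕ → Submodule R M)
  [DirectSum.Decomposition 𝓜]
  {N : Type w} [AddCommGroup N] [Module R N] (𝓝 : ℕ → Submodule R N)
  [DirectSum.Decomposition 𝓝]

/-- The sign involution `x ↦ (-1) ^ |x| x` of a graded module. -/
noncomputable def sign : M →ₗ[R] M :=
  DirectSum.toModule R ℕ M (fun n => (-1 : R) ^ n • (𝓜 n).subtype) ∘ₗ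
    (DirectSum.decomposeLinearEquiv 𝓜).toLinearMap

/-- The symmetry isomorphism of graded modules, with the Koszul sign:
`x ⊗ y ↦ (-1) ^ (|x| |y|) y ⊗ x`. -/
noncomputable def koszulSwap : M ⊗[R] N →ₗ[R] N ⊗[R] M :=
  (TensorProduct.congr (DirectSum.decomposeLinearEquiv 𝓝).symm
      (DirectSum.decomposeLinearEquiv 𝓜).symm).toLinearMap ∘ₗ
    (TensorProduct.gradedComm R (fun n => 𝓜 n) (fun n => 𝓝 n)).toLinearMap ∘ₗ
    (TensorProduct.congr (DirectSum.decomposeLinearEquiv 𝓜)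
      (DirectSum.decomposeLinearEquiv 𝓝)).toLinearMap

variable {𝓜 𝓝}

theorem sign_of_mem {n : ℕ} {x : M} (hx : x ∈ 𝓜 n) : sign 𝓜 x = (-1 : R) ^ n • x := by
  lift x to 𝓜 n using hx
  simp [sign]

theorem koszulSwap_tmul {p q : ℕ} {x : M} (hx : x ∈ 𝓜 p) {y : N} (hy : y ∈ 𝓝 q) :
    koszulSwap 𝓜 𝓝 (x ⊗ₜ y) = (-1 : R) ^ (p * q) • (y ⊗ₜ[R] x) := by
  lift x to 𝓜 p using hx
  lift y to 𝓝 q using hy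
  have h : ((-1 : ℤˣ) ^ (q * p)) • (y : N) ⊗ₜ[R] (x : M) = (-1 : R) ^ (p * q) • (y : N) ⊗ₜ[R] (x : M) := by
    rw [mul_comm q p]
    rcases Nat.even_or_odd (p * q) with h | h <;> simp [h.neg_one_pow]
  simp only [koszulSwap, LinearMap.comp_apply, LinearEquiv.coe_coe, TensorProduct.congr_tmul,
    DirectSum.decomposeLinearEquiv_apply_coe, TensorProduct.gradedComm_of_tmul_of, Units.smul_def,
    map_zsmul, DirectSum.decomposeLinearEquiv_symm_lof]
  rw [← Units.smul_def]
  exact h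

variable (𝓜 𝓝)

/-- Auxiliary: splitting a tensor into its components of the various total degrees. -/
noncomputable def tensorDecomposeMap : M ⊗[R] N →ₗ[R] ⨁ n, tensorGrading 𝓜 𝓝 n :=
  TensorProduct.lift
    ((DirectSum.toModule R ℕ _ fun p =>
      LinearMap.flip ((DirectSum.toModule R ℕ _ fun q =>
        LinearMap.mk₂ R (fun (y : 𝓝 q) (x : 𝓜 p) =>
          DirectSum.lof R ℕ (fun n => tensorGrading 𝓜 𝓝 n) (p + q)
            ⟨(x : M) ⊗ₜ[R] (y : N), tmul_mem_tensorGrading rfl x.2 y.2⟩)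
          (by intros; rw [← map_add]; congr 1; ext; simp [TensorProduct.tmul_add])
          (by intros; rw [← map_smul]; congr 1; ext; simp)
          (by intros; rw [← map_add]; congr 1; ext; simp [TensorProduct.add_tmul])
          (by intros; rw [← map_smul]; congr 1)) ∘ₗ
      (DirectSum.decomposeLinearEquiv 𝓝).toLinearMap)) ∘ₗ
    (DirectSum.decomposeLinearEquiv 𝓜).toLinearMap)

theorem tensorDecomposeMap_tmul {p q n : ℕ} (h : p + q = n) {x : M} (hx : x ∈ 𝓜 p) {y : N}
    (hy : y ∈ 𝓝 q) (hxy) : tensorDecomposeMap 𝓜 𝓝 (x ⊗ₜ y) =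
      DirectSum.lof R ℕ (fun n => tensorGrading 𝓜 𝓝 n) n ⟨x ⊗ₜ y, hxy⟩ := by
  subst h
  lift x to 𝓜 p using hx
  lift y to 𝓝 q using hy
  simp [tensorDecomposeMap]

theorem tensor_hom_ext {P : Type*} [AddCommGroup P] [Module R P] {f g : M ⊗[R] N →ₗ[R] P}
    (h : ∀ p q, ∀ x ∈ 𝓜 p, ∀ y ∈ 𝓝 q, f (x ⊗ₜ y) = g (x ⊗ₜ y)) : f = g := by
  refine TensorProduct.ext (DirectSum.decompose_lhom_ext 𝓜 fun p => LinearMap.ext fun x =>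
    DirectSum.decompose_lhom_ext 𝓝 fun q => LinearMap.ext fun y => ?_)
  exact h p q x x.2 y y.2

noncomputable instance tensorDecomposition : DirectSum.Decomposition (tensorGrading 𝓜 𝓝) :=
  DirectSum.Decomposition.ofLinearMap _ (tensorDecomposeMap 𝓜 𝓝)
    (tensor_hom_ext 𝓜 𝓝 fun p q x hx y hy => by
      simp [tensorDecomposeMap_tmul 𝓜 𝓝 rfl hx hy (tmul_mem_tensorGrading rfl hx hy)])
    (DirectSum.linearMap_ext _ fun n => LinearMap.ext fun ⟨z, hz⟩ => by
      have key : tensorGrading 𝓜 𝓝 n ≤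
          { carrier := {z | ∃ hz, tensorDecomposeMap 𝓜 𝓝 z =
              DirectSum.lof R ℕ (fun n => tensorGrading 𝓜 𝓝 n) n ⟨z, hz⟩}
            add_mem' := fun {a b} ⟨ha, ha'⟩ ⟨hb, hb'⟩ => ⟨add_mem ha hb, by
              rw [map_add, ha', hb', ← map_add]; rfl⟩
            zero_mem' := ⟨zero_mem _, by
              rw [map_zero]; exact (map_zero _).symm⟩
            smul_mem' := fun r a ⟨ha, ha'⟩ => ⟨Submodule.smul_mem _ r ha, by
              rw [map_smul, ha', ← map_smul]; rfl⟩ } :=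
        tensorGrading_le fun p q h x hx y hy =>
          ⟨tmul_mem_tensorGrading h hx hy, tensorDecomposeMap_tmul 𝓜 𝓝 h hx hy _⟩
      obtain ⟨_, h⟩ := key hz
      simpa using h)

end Graded

section Complexes

/-- A non-negatively graded chain complex of `R`-modules, as a module with an internal grading and a
differential of degree `-1`. -/
structure ChainCx (R : Type u) [CommRing R] where
  carrier : Type v
  [addCommGroup : AddCommGroup carrier]
  [module : Module R carrier]
  grading : ℕ → Submodule R carrier
  [decomposition : DirectSum.Decomposition grading]
  d : carrier →ₗ[R] carrier
  d_mem : ∀ n, ∀ x ∈ grading n, d x ∈ lower grading n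
  d_d : ∀ x, d (d x) = 0

attribute [instance] ChainCx.addCommGroup ChainCx.module ChainCx.decomposition

variable {R : Type u} [CommRing R]

/-- Chain maps of degree zero. -/
@[ext]
structure ChainMap (X : ChainCx.{u, v} R) (Y : ChainCx.{u, w} R) where
  toLin : X.carrier →ₗ[R] Y.carrier
  map_mem : ∀ n, ∀ x ∈ X.grading n, toLin x ∈ Y.grading n
  map_d : ∀ x, toLin (X.d x) = Y.d (toLin x)

/-- The identity chain map. -/
def ChainMap.id (X : ChainCx.{u, v} R) : ChainMap X X :=
  ⟨LinearMap.id, fun _ _ h => h, fun _ => rfl⟩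

/-- Composition of chain maps. -/
def ChainMap.comp {X : ChainCx.{u, v} R} {Y : ChainCx.{u, w} R} {Z : ChainCx.{u, w'} R}
    (g : ChainMap Y Z) (f : ChainMap X Y) : ChainMap X Z :=
  ⟨g.toLin ∘ₗ f.toLin, fun n x h => g.map_mem n _ (f.map_mem n x h), fun x => by
    simp [f.map_d, g.map_d]⟩

/-- The differential `x ⊗ y ↦ d x ⊗ y + (-1) ^ |x| x ⊗ d y` of a tensor product of chain complexes. -/
noncomputable def tensorD (X : ChainCx.{u, v} R) (Y : ChainCx.{u, w} R) :
    X.carrier ⊗[R] Y.carrier →ₗ[R] X.carrier ⊗[R] Y.carrier :=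
  TensorProduct.map X.d LinearMap.id + TensorProduct.map (sign X.grading) Y.d

/-- A connected, coaugmented chain coalgebra, free over `R` in each degree. The coaugmentation
`R → C` is given by the grouplike element `unit`, the image of `1`, and connectedness says that it
maps onto degree zero. -/
structure ChainCoalgebra (R : Type u) [CommRing R] extends ChainCx.{u, v} R where
  free : ∀ n, Module.Free R (grading n)
  [coalgebra : Coalgebra R carrier]
  comul_mem : ∀ n, ∀ x ∈ grading n, Coalgebra.comul (R := R) x ∈ tensorGrading grading grading n
  comul_d : ∀ x, Coalgebra.comul (R := R) (d x) = tensorD toChainCx toChainCx (Coalgebra.comul x)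
  counit_of_pos : ∀ n, ∀ x ∈ grading (n + 1), Coalgebra.counit (R := R) x = 0
  counit_d : ∀ x, Coalgebra.counit (R := R) (d x) = 0
  unit : carrier
  unit_mem : unit ∈ grading 0
  unit_isGroupLike : IsGroupLikeElem R unit
  connected : grading 0 = Submodule.span R {unit}

attribute [instance] ChainCoalgebra.coalgebra

end Complexes

section Cobar

variable {R : Type u} [CommRing R] (C : ChainCoalgebra.{u, v} R)

/-- The desuspension `s⁻¹ C̄` of the coaugmentation coideal. As `C` is connected, `C̄` is the part of `C`
of positive degree; its component of degree `n + 1` is put in degree `n`. -/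
abbrev Desusp : Type v := ⨁ n : ℕ, C.grading (n + 1)

/-- The map `c ↦ s⁻¹ c`, which is zero on elements of degree zero. -/
noncomputable def desusp : C.carrier →ₗ[R] Desusp C :=
  DirectSum.toModule R ℕ (Desusp C)
      (fun n => match n with
        | 0 => 0
        | n + 1 => DirectSum.lof R ℕ (fun n => C.grading (n + 1)) n) ∘ₗ
    (DirectSum.decomposeLinearEquiv C.grading).toLinearMap

/-- The map `s⁻¹ c ↦ c`. -/
noncomputable def resusp : Desusp C →ₗ[R] C.carrier :=
  DirectSum.toModule R ℕ C.carrier (fun n => (C.grading (n + 1)).subtype)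

/-- The algebra underlying the cobar construction `Ω C`: the tensor algebra on `s⁻¹ C̄`. -/
abbrev Cobar : Type (max u v) := TensorAlgebra R (Desusp C)

/-- The universal twisting cochain `t : C → Ω C`, `t c = s⁻¹ c`. -/
noncomputable def univTwist : C.carrier →ₗ[R] Cobar C := TensorAlgebra.ι R ∘ₗ desusp C

/-- The grading of `Ω C`: the degree `n` part is spanned by the words `s⁻¹ c₁ | ⋯ | s⁻¹ c_k` in
homogeneous elements with `∑ (|c_i| - 1) = n`. -/
def cobarGrading (n : ℕ) : Submodule R (Cobar C) :=
  Submodule.span R {x | ∃ l : List (Σ n : ℕ, C.grading (n + 1)),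
    (l.map Sigma.fst).sum = n ∧
    (l.map fun p => univTwist C p.2).prod = x}

variable {C}

theorem desusp_of_mem {n : ℕ} {x : C.carrier} (hx : x ∈ C.grading (n + 1)) :
    desusp C x = DirectSum.lof R ℕ (fun n => C.grading (n + 1)) n ⟨x, hx⟩ := by
  lift x to C.grading (n + 1) using hx
  simp [desusp]

theorem desusp_of_zero {x : C.carrier} (hx : x ∈ C.grading 0) : desusp C x = 0 := by
  lift x to C.grading 0 using hx
  simp [desusp]

theorem univTwist_of_zero {x : C.carrier} (hx : x ∈ C.grading 0) : univTwist C x = 0 := by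
  simp [univTwist, desusp_of_zero hx]

theorem univTwist_coe {n : ℕ} (x : C.grading (n + 1)) : univTwist C x =
    TensorAlgebra.ι R (DirectSum.lof R ℕ (fun n => C.grading (n + 1)) n x) := by
  simp [univTwist, desusp_of_mem x.2]

theorem prod_mem_cobarGrading (l : List (Σ n : ℕ, C.grading (n + 1))) :
    (l.map fun p => univTwist C p.2).prod ∈ cobarGrading C (l.map Sigma.fst).sum :=
  Submodule.subset_span ⟨l, rfl, rfl⟩

theorem univTwist_mem {n : ℕ} {x : C.carrier} (hx : x ∈ C.grading (n + 1)) :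
    univTwist C x ∈ cobarGrading C n := by
  simpa using prod_mem_cobarGrading [⟨n, x, hx⟩]

instance cobarGradedMonoid : SetLike.GradedMonoid (cobarGrading C) where
  one_mem := by simpa using prod_mem_cobarGrading (C := C) []
  mul_mem i j a b ha hb := by
    refine Submodule.span_induction₂ (p := fun a b _ _ => a * b ∈ cobarGrading C (i + j))
      ?_ ?_ ?_ ?_ ?_ ?_ ?_ ha hb
    · rintro _ _ ⟨l, rfl, rfl⟩ ⟨l', rfl, rfl⟩
      simpa using prod_mem_cobarGrading (l ++ l')
    · intros; simp
    · intros; simp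
    · intros; rw [add_mul]; exact add_mem ‹_› ‹_›
    · intros; rw [mul_add]; exact add_mem ‹_› ‹_›
    · intros; rw [smul_mul_assoc]; exact Submodule.smul_mem _ _ ‹_›
    · intros; rw [mul_smul_comm]; exact Submodule.smul_mem _ _ ‹_›

variable (C) in
/-- Auxiliary: splitting an element of `Ω C` into its homogeneous components. -/
noncomputable def cobarDecompose : Cobar C →ₐ[R] ⨁ n, cobarGrading C n :=
  TensorAlgebra.lift R (DirectSum.toModule R ℕ _ fun n =>
    DirectSum.lof R ℕ (fun n => cobarGrading C n) n ∘ₗ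
      LinearMap.codRestrict (cobarGrading C n) (univTwist C ∘ₗ (C.grading (n + 1)).subtype)
        fun x => univTwist_mem x.2)

theorem cobarDecompose_univTwist {n : ℕ} (x : C.grading (n + 1)) :
    cobarDecompose C (univTwist C x) =
      DirectSum.of (fun n => cobarGrading C n) n ⟨univTwist C x, univTwist_mem x.2⟩ := by
  refine (congrArg _ (univTwist_coe x)).trans ?_
  rw [cobarDecompose, TensorAlgebra.lift_ι_apply, DirectSum.toModule_lof]
  rfl

theorem cobarDecompose_prod (l : List (Σ n : ℕ, C.grading (n + 1))) :
    cobarDecompose C (l.map fun p => univTwist C p.2).prod =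
      DirectSum.of (fun n => cobarGrading C n) (l.map Sigma.fst).sum
        ⟨_, prod_mem_cobarGrading l⟩ := by
  induction l with
  | nil => simp; rfl
  | cons p l ih =>
    simp only [List.map_cons, List.prod_cons, map_mul, ih, cobarDecompose_univTwist,
      DirectSum.of_mul_of]
    rfl

noncomputable instance cobarGradedAlgebra : GradedAlgebra (cobarGrading C) :=
  GradedAlgebra.ofAlgHom _ (cobarDecompose C)
    (by
      refine TensorAlgebra.hom_ext (DirectSum.linearMap_ext _ fun n => LinearMap.ext fun x => ?_)
      have := cobarDecompose_univTwist x
      simp [← univTwist_coe, this])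
    (fun n ⟨z, hz⟩ => by
      have key : ∃ hz, cobarDecompose C z =
          DirectSum.of (fun n => cobarGrading C n) n ⟨z, hz⟩ := by
        induction hz using Submodule.span_induction with
        | mem x h =>
          obtain ⟨l, rfl, rfl⟩ := h
          exact ⟨_, cobarDecompose_prod l⟩
        | zero => exact ⟨zero_mem _, by rw [map_zero]; exact (map_zero _).symm⟩
        | add x y _ _ hx hy =>
          obtain ⟨hx, hx'⟩ := hx
          obtain ⟨hy, hy'⟩ := hy
          exact ⟨add_mem hx hy, by rw [map_add, hx', hy', ← map_add]; rfl⟩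
        | smul r x _ hx =>
          obtain ⟨hx, hx'⟩ := hx
          exact ⟨Submodule.smul_mem _ r hx, by
            rw [map_smul, hx', ← DirectSum.lof_eq_of R, ← map_smul]; rfl⟩
      exact key.2)

end Cobar

section
variable {R : Type u} [CommRing R]
  {M : Type v} [AddCommGroup M] [Module R M] {𝓜 : ℕ → Submodule R M}
  [DirectSum.Decomposition 𝓜]
  {N : Type w} [AddCommGroup N] [Module R N] {𝓝 : ℕ → Submodule R N}
  [DirectSum.Decomposition 𝓝]

theorem sign_sign (x : M) : sign 𝓜 (sign 𝓜 x) = x := by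
  have : sign 𝓜 ∘ₗ sign 𝓜 = LinearMap.id :=
    DirectSum.decompose_lhom_ext 𝓜 fun n => LinearMap.ext fun x => by
      simp [sign_of_mem x.2, smul_smul, ← mul_pow]
  exact LinearMap.congr_fun this x

theorem sign_mem {n : ℕ} {x : M} (hx : x ∈ 𝓜 n) : sign 𝓜 x ∈ 𝓜 n := by
  rw [sign_of_mem hx]; exact Submodule.smul_mem _ _ hx

theorem sign_tmul (z : M ⊗[R] N) :
    sign (tensorGrading 𝓜 𝓝) z = TensorProduct.map (sign 𝓜) (sign 𝓝) z := by
  refine LinearMap.congr_fun (tensor_hom_ext 𝓜 𝓝 fun p q x hx y hy => ?_) z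
  rw [sign_of_mem (tmul_mem_tensorGrading rfl hx hy), TensorProduct.map_tmul, sign_of_mem hx,
    sign_of_mem hy, TensorProduct.smul_tmul_smul, pow_add]

theorem sign_mul {A : Type v} [Ring A] [Algebra R A] (𝓐 : ℕ → Submodule R A) [GradedAlgebra 𝓐]
    (a b : A) : sign 𝓐 (a * b) = sign 𝓐 a * sign 𝓐 b := by
  have := tensor_hom_ext 𝓐 𝓐 (f := sign 𝓐 ∘ₗ LinearMap.mul' R A)
    (g := LinearMap.mul' R A ∘ₗ TensorProduct.map (sign 𝓐) (sign 𝓐)) fun p q x hx y hy => by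
      simp [sign_of_mem hx, sign_of_mem hy, sign_of_mem (SetLike.mul_mem_graded hx hy),
        pow_add, smul_smul, mul_comm]
  simpa using LinearMap.congr_fun this (a ⊗ₜ b)

theorem sign_anti {D : M →ₗ[R] M} (hD : ∀ n, ∀ x ∈ 𝓜 n, D x ∈ lower 𝓜 n) (x : M) :
    sign 𝓜 (D x) = - D (sign 𝓜 x) := by
  have : sign 𝓜 ∘ₗ D = - D ∘ₗ sign 𝓜 :=
    DirectSum.decompose_lhom_ext 𝓜 fun n => LinearMap.ext fun x => by
      cases n with
      | zero =>
        have h : D x = 0 := hD 0 x x.2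
        simp [sign_of_mem x.2, h]
      | succ n =>
        have h : D x ∈ 𝓜 n := hD (n + 1) x x.2
        simp [sign_of_mem x.2, sign_of_mem h, pow_succ]
  exact LinearMap.congr_fun this x

theorem sign_d (X : ChainCx.{u, v} R) (x : X.carrier) :
    sign X.grading (X.d x) = - X.d (sign X.grading x) := sign_anti X.d_mem x

end

section Cobar
variable {R : Type u} [CommRing R] {C : ChainCoalgebra.{u, v} R}

theorem sign_comul (x : C.carrier) :
    TensorProduct.map (sign C.grading) (sign C.grading) (Coalgebra.comul (R := R) x) =
      Coalgebra.comul (R := R) (sign C.grading x) := by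
  have : TensorProduct.map (sign C.grading) (sign C.grading) ∘ₗ Coalgebra.comul (R := R) =
      Coalgebra.comul (R := R) ∘ₗ sign C.grading :=
    DirectSum.decompose_lhom_ext C.grading fun n => LinearMap.ext fun x => by
      simp [sign_of_mem x.2, ← sign_tmul, sign_of_mem (C.comul_mem n x x.2)]
  exact LinearMap.congr_fun this x

theorem sign_univTwist (x : C.carrier) :
    sign (cobarGrading C) (univTwist C x) = - univTwist C (sign C.grading x) := by
  have : sign (cobarGrading C) ∘ₗ univTwist C = - univTwist C ∘ₗ sign C.grading :=
    DirectSum.decompose_lhom_ext C.grading fun n => LinearMap.ext fun x => by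
      cases n with
      | zero => simp [sign_of_mem x.2, univTwist_of_zero x.2]
      | succ n => simp [sign_of_mem x.2, sign_of_mem (univTwist_mem x.2), pow_succ]
  exact LinearMap.congr_fun this x

variable (C)

/-- The map `μ (t ⊗ t) Δ`, `c ↦ ∑ (-1) ^ |c_i| t (c_i) t (c^i)` for `Δ c = ∑ c_i ⊗ c^i` (the Koszul sign
comes from moving `t`, of degree `-1`, past `c_i`). Since `t` vanishes in degree zero, one may as well
use the reduced comultiplication. -/
noncomputable def twistSq : C.carrier →ₗ[R] Cobar C :=
  LinearMap.mul' R (Cobar C) ∘ₗ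
    TensorProduct.map (univTwist C ∘ₗ sign C.grading) (univTwist C) ∘ₗ Coalgebra.comul (R := R)

/-- The cobar differential on generators:
`s⁻¹ c ↦ - s⁻¹ (d c) + ∑ (-1) ^ |c_i| s⁻¹ c_i | s⁻¹ c^i`. -/
noncomputable def cobarDGen : Desusp C →ₗ[R] Cobar C :=
  (twistSq C - univTwist C ∘ₗ C.d) ∘ₗ resusp C

/-- Auxiliary: the algebra map `x ↦ [[(-1) ^ |x| x, d x], [0, x]]`, whose multiplicativity encodes that `d`
is a derivation. -/
noncomputable def cobarDAux : Cobar C →ₐ[R] Matrix (Fin 2) (Fin 2) (Cobar C) :=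
  TensorAlgebra.lift R
    (Matrix.singleLinearMap R 0 0 ∘ₗ sign (cobarGrading C) ∘ₗ TensorAlgebra.ι R +
      Matrix.singleLinearMap R 0 1 ∘ₗ cobarDGen C +
      Matrix.singleLinearMap R 1 1 ∘ₗ TensorAlgebra.ι R)

/-- The differential of the cobar construction: the derivation, in the graded sense, that extends
`cobarDGen`. See `cobarD_univTwist` and `cobarD_mul` for its defining properties. -/
noncomputable def cobarD : Cobar C →ₗ[R] Cobar C :=
  Matrix.entryLinearMap R (Cobar C) 0 1 ∘ₗ (cobarDAux C).toLinearMap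

variable {C}

theorem cobarDAux_apply (x : Cobar C) :
    cobarDAux C x = !![sign (cobarGrading C) x, cobarD C x; 0, x] := by
  have h : cobarDAux C x 0 0 = sign (cobarGrading C) x ∧ cobarDAux C x 1 0 = 0 ∧
      cobarDAux C x 1 1 = x := by
    induction x using TensorAlgebra.induction with
    | algebraMap r =>
      have : sign (cobarGrading C) (algebraMap R _ r) = algebraMap R _ r := by
        rw [sign_of_mem (SetLike.algebraMap_mem_graded _ r)]; simp
      simp [Matrix.algebraMap_matrix_apply, this]
    | ι x => simp [cobarDAux]
    | mul a b ha hb =>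
      obtain ⟨a1, a2, a3⟩ := ha
      obtain ⟨b1, b2, b3⟩ := hb
      simp [Matrix.mul_apply, Fin.sum_univ_two, *, sign_mul]
    | add a b ha hb =>
      obtain ⟨a1, a2, a3⟩ := ha
      obtain ⟨b1, b2, b3⟩ := hb
      simp [*]
  ext i j
  fin_cases i <;> fin_cases j
  · exact h.1
  · rfl
  · exact h.2.1
  · exact h.2.2

theorem cobarD_mul (a b : Cobar C) :
    cobarD C (a * b) = cobarD C a * b + sign (cobarGrading C) a * cobarD C b := by
  change cobarDAux C (a * b) 0 1 = _
  rw [map_mul, cobarDAux_apply a, cobarDAux_apply b]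
  simp [Matrix.mul_apply, Fin.sum_univ_two, add_comm]

theorem cobarD_algebraMap (r : R) : cobarD C (algebraMap R _ r) = 0 := by
  change cobarDAux C (algebraMap R _ r) 0 1 = _
  simp [Matrix.algebraMap_matrix_apply]

theorem resusp_desusp {n : ℕ} {x : C.carrier} (hx : x ∈ C.grading (n + 1)) :
    resusp C (desusp C x) = x := by
  simp [desusp_of_mem hx, resusp]

theorem comul_of_zero {x : C.carrier} (hx : x ∈ C.grading 0) :
    ∃ r : R, Coalgebra.comul (R := R) x = r • (C.unit ⊗ₜ[R] C.unit) := by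
  rw [C.connected] at hx
  obtain ⟨r, rfl⟩ := Submodule.mem_span_singleton.1 hx
  exact ⟨r, by rw [map_smul, C.unit_isGroupLike.comul_eq_tmul_self]⟩

theorem twistSq_of_zero {x : C.carrier} (hx : x ∈ C.grading 0) : twistSq C x = 0 := by
  obtain ⟨r, h⟩ := comul_of_zero hx
  simp [twistSq, h, univTwist_of_zero C.unit_mem]

theorem cobarD_univTwist (x : C.carrier) :
    cobarD C (univTwist C x) = twistSq C x - univTwist C (C.d x) := by
  have : cobarD C ∘ₗ univTwist C = twistSq C - univTwist C ∘ₗ C.d :=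
    DirectSum.decompose_lhom_ext C.grading fun n => LinearMap.ext fun x => by
      cases n with
      | zero =>
        have h : C.d x = 0 := C.d_mem 0 x x.2
        simp [univTwist_of_zero x.2, twistSq_of_zero x.2, h]
      | succ n =>
        simp only [LinearMap.comp_apply, Submodule.subtype_apply]
        change cobarDAux C (univTwist C x) 0 1 = _
        simp [univTwist, cobarDAux, cobarDGen, resusp_desusp x.2]
  exact LinearMap.congr_fun this x

theorem mul_mem_lower {p q n : ℕ} (h : p + q = n) {x y : Cobar C} (hx : x ∈ lower (cobarGrading C) p)
    (hy : y ∈ cobarGrading C q) : x * y ∈ lower (cobarGrading C) n := by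
  cases p with
  | zero => have h0 : x = 0 := hx
            rw [h0, zero_mul]; exact Submodule.zero_mem _
  | succ p => have h1 : n = p + q + 1 := by omega
              subst h1; exact SetLike.mul_mem_graded (A := cobarGrading C) (i := p) hx hy

theorem mul_mem_lower' {p q n : ℕ} (h : p + q = n) {x y : Cobar C} (hx : x ∈ cobarGrading C p)
    (hy : y ∈ lower (cobarGrading C) q) : x * y ∈ lower (cobarGrading C) n := by
  cases q with
  | zero => have h0 : y = 0 := hy
            rw [h0, mul_zero]; exact Submodule.zero_mem _
  | succ q => have h1 : n = p + q + 1 := by omega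
              subst h1; exact SetLike.mul_mem_graded (A := cobarGrading C) (j := q) hx hy

theorem univTwist_mem_lower {n : ℕ} {x : C.carrier} (hx : x ∈ C.grading n) :
    univTwist C x ∈ lower (cobarGrading C) n := by
  cases n with
  | zero => exact univTwist_of_zero hx
  | succ n => exact univTwist_mem hx

theorem twistSq_mem {n : ℕ} {x : C.carrier} (hx : x ∈ C.grading (n + 1)) :
    twistSq C x ∈ lower (cobarGrading C) n := by
  have : tensorGrading C.grading C.grading (n + 1) ≤ (lower (cobarGrading C) n).comap
      (LinearMap.mul' R (Cobar C) ∘ₗ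
        TensorProduct.map (univTwist C ∘ₗ sign C.grading) (univTwist C)) :=
    tensorGrading_le fun p q h x hx y hy => by
      change univTwist C (sign C.grading x) * univTwist C y ∈ lower (cobarGrading C) n
      have h1 := univTwist_mem_lower (sign_mem hx)
      cases q with
      | zero => rw [univTwist_of_zero hy]; simp
      | succ q => exact mul_mem_lower (by omega) h1 (univTwist_mem hy)
  exact this (C.comul_mem _ x hx)

theorem cobarD_mem (n : ℕ) (x : Cobar C) (hx : x ∈ cobarGrading C n) :
    cobarD C x ∈ lower (cobarGrading C) n := by
  induction hx using Submodule.span_induction with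
  | mem x h =>
    obtain ⟨l, rfl, rfl⟩ := h
    induction l with
    | nil =>
      have h : cobarD C 1 = 0 := by simpa using cobarD_algebraMap (C := C) 1
      simp [h]
    | cons p l ih =>
      simp only [List.map_cons, List.prod_cons, List.sum_cons]
      rw [cobarD_mul]
      refine add_mem (mul_mem_lower rfl ?_ (prod_mem_cobarGrading l))
        (mul_mem_lower' rfl (sign_mem (univTwist_mem p.2.2)) ih)
      rw [cobarD_univTwist]
      exact sub_mem (twistSq_mem p.2.2) (univTwist_mem_lower (C.d_mem _ _ p.2.2))
  | zero => simp
  | add x y _ _ hx hy => rw [map_add]; exact add_mem hx hy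
  | smul r x _ hx => rw [map_smul]; exact Submodule.smul_mem _ r hx

theorem sign_cobarD (x : Cobar C) :
    sign (cobarGrading C) (cobarD C x) = - cobarD C (sign (cobarGrading C) x) :=
  sign_anti cobarD_mem x

variable (C) in
/-- The map `μ (t ⊗ t)`, with its Koszul sign. -/
noncomputable def twistMul : C.carrier ⊗[R] C.carrier →ₗ[R] Cobar C :=
  LinearMap.mul' R (Cobar C) ∘ₗ TensorProduct.map (univTwist C ∘ₗ sign C.grading) (univTwist C)

theorem twistSq_eq (x : C.carrier) : twistSq C x = twistMul C (Coalgebra.comul (R := R) x) := rfl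

theorem cobarD_twistSq (x : C.carrier) : cobarD C (twistSq C x) = twistSq C (C.d x) := by
  let t := univTwist C
  let s := sign C.grading
  let tri : (C.carrier ⊗[R] C.carrier) ⊗[R] C.carrier →ₗ[R] Cobar C :=
    LinearMap.mul' R (Cobar C) ∘ₗ TensorProduct.map
      (LinearMap.mul' R (Cobar C) ∘ₗ TensorProduct.map t (t ∘ₗ s)) t
  have h : cobarD C ∘ₗ twistMul C = twistMul C ∘ₗ tensorD C.toChainCx C.toChainCx +
      (tri ∘ₗ LinearMap.rTensor _ (Coalgebra.comul (R := R)) -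
        tri ∘ₗ (TensorProduct.assoc R _ _ _).symm.toLinearMap ∘ₗ
          LinearMap.lTensor _ (Coalgebra.comul (R := R))) := by
    refine TensorProduct.ext' fun a b => ?_
    have h1 : tri (Coalgebra.comul (R := R) a ⊗ₜ b) = twistSq C (s a) * t b := by
      rw [twistSq_eq, ← sign_comul]
      induction Coalgebra.comul (R := R) a with
      | zero => simp
      | add x y hx hy => simp only [TensorProduct.add_tmul, map_add, add_mul, hx, hy]
      | tmul x y => simp [tri, twistMul, sign_sign, s, t]
    have h2 : tri ((TensorProduct.assoc R _ _ _).symm (a ⊗ₜ Coalgebra.comul (R := R) b)) =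
        t a * twistSq C b := by
      rw [twistSq_eq]
      induction Coalgebra.comul (R := R) b with
      | zero => simp
      | add x y hx hy => simp only [TensorProduct.tmul_add, map_add, mul_add, hx, hy]
      | tmul x y => simp [tri, twistMul, s, t, mul_assoc]
    simp only [LinearMap.comp_apply, LinearMap.add_apply, LinearMap.sub_apply,
      LinearMap.rTensor_tmul, LinearMap.lTensor_tmul, LinearEquiv.coe_coe, h1, h2]
    simp only [twistMul, LinearMap.comp_apply, TensorProduct.map_tmul, LinearMap.mul'_apply,
      tensorD, LinearMap.add_apply, map_add, LinearMap.id_apply, cobarD_mul, cobarD_univTwist,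
      sign_univTwist, sign_sign, sign_d, map_neg, s, t]
    noncomm_ring
  rw [twistSq_eq, twistSq_eq, C.comul_d, ← LinearMap.comp_apply, h]
  simp [← Coalgebra.coassoc_apply]

theorem cobarD_cobarD (x : Cobar C) : cobarD C (cobarD C x) = 0 := by
  have hg (v : Desusp C) : cobarD C (cobarD C (TensorAlgebra.ι R v)) = 0 := by
    have : (cobarD C ∘ₗ cobarD C) ∘ₗ TensorAlgebra.ι R = 0 :=
      DirectSum.linearMap_ext _ fun n => LinearMap.ext fun x => by
        simp [← univTwist_coe, cobarD_univTwist, cobarD_twistSq, C.d_d]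
    exact LinearMap.congr_fun this v
  induction x using TensorAlgebra.induction with
  | algebraMap r => simp [cobarD_algebraMap]
  | ι x => exact hg x
  | mul a b ha hb => simp [cobarD_mul, sign_cobarD, sign_sign, ha, hb]
  | add a b ha hb => simp [ha, hb]

variable (C) in
/-- The cobar construction `Ω C` as a chain complex. -/
noncomputable abbrev cobar : ChainCx.{u, max u v} R where
  carrier := Cobar C
  grading := cobarGrading C
  d := cobarD C
  d_mem := cobarD_mem
  d_d := cobarD_cobarD

end Cobar

section
variable {R : Type u} [CommRing R]
  {M : Type v} [AddCommGroup M] [Module R M] {𝓜 : ℕ → Submodule R M}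
  [DirectSum.Decomposition 𝓜]
  {N : Type w} [AddCommGroup N] [Module R N] {𝓝 : ℕ → Submodule R N}
  [DirectSum.Decomposition 𝓝]

theorem sign_pow_mem {p : ℕ} (k : ℕ) {x : M} (hx : x ∈ 𝓜 p) : (sign 𝓜 ^ k) x = (-1 : R) ^ (k * p) • x := by
  induction k with
  | zero => simp
  | succ k ih =>
    rw [pow_succ', Module.End.mul_apply, ih, map_smul, sign_of_mem hx, smul_smul, ← pow_add]
    congr 2; ring

theorem koszulSwap_of_mem {p : ℕ} {x : M} (hx : x ∈ 𝓜 p) (y : N) :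
    koszulSwap 𝓜 𝓝 (x ⊗ₜ y) = (sign 𝓝 ^ p) y ⊗ₜ x := by
  have : koszulSwap 𝓜 𝓝 ∘ₗ TensorProduct.mk R M N x =
      (TensorProduct.mk R N M).flip x ∘ₗ (sign 𝓝 ^ p) :=
    DirectSum.decompose_lhom_ext 𝓝 fun q => LinearMap.ext fun y => by
      simp [koszulSwap_tmul hx y.2, sign_pow_mem p y.2, TensorProduct.smul_tmul']
  exact LinearMap.congr_fun this y

end

section CoHoch
variable {R : Type u} [CommRing R] (C : ChainCoalgebra.{u, v} R)
  {N : Type w} [AddCommGroup N] [Module R N] (𝓝 : ℕ → Submodule R N)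
  [DirectSum.Decomposition 𝓝]

/-- `(n ⊗ b) ⊗ w ↦ (-1) ^ |n| n ⊗ t b · w`. -/
noncomputable def leftTerm : (N ⊗[R] C.carrier) ⊗[R] Cobar C →ₗ[R] N ⊗[R] Cobar C :=
  LinearMap.lTensor N (LinearMap.mul' R (Cobar C)) ∘ₗ
    (TensorProduct.assoc R N (Cobar C) (Cobar C)).toLinearMap ∘ₗ
    LinearMap.rTensor (Cobar C) (TensorProduct.map (sign 𝓝) (univTwist C))

/-- `(a ⊗ n) ⊗ w ↦ (-1) ^ ((|a| - 1) (|n| + |w|)) n ⊗ w · t a`. -/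
noncomputable def rightTerm : (C.carrier ⊗[R] N) ⊗[R] Cobar C →ₗ[R] N ⊗[R] Cobar C :=
  LinearMap.lTensor N (LinearMap.mul' R (Cobar C) ∘ₗ
      koszulSwap (cobarGrading C) (cobarGrading C)) ∘ₗ
    (TensorProduct.assoc R N (Cobar C) (Cobar C)).toLinearMap ∘ₗ
    LinearMap.rTensor (Cobar C)
      (koszulSwap (cobarGrading C) 𝓝 ∘ₗ LinearMap.rTensor N (univTwist C))

/-- The differential of the coHochschild complex of `C`: for `Δ c = ∑ c_i ⊗ c^i`,
`d (c ⊗ w) = d c ⊗ w + (-1) ^ |c| c ⊗ d w - ∑ (-1) ^ |c_i| c_i ⊗ t (c^i) · w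
  + ∑ (-1) ^ ((|c_i| - 1) (|c^i| + |w|)) c^i ⊗ w · t (c_i)`. -/
noncomputable def coHochD : C.carrier ⊗[R] Cobar C →ₗ[R] C.carrier ⊗[R] Cobar C :=
  (tensorD C.toChainCx (cobar C) : C.carrier ⊗[R] Cobar C →ₗ[R] C.carrier ⊗[R] Cobar C)
    - leftTerm C C.grading ∘ₗ LinearMap.rTensor (Cobar C) (Coalgebra.comul (R := R))
    + rightTerm C C.grading ∘ₗ LinearMap.rTensor (Cobar C) (Coalgebra.comul (R := R))

variable {C 𝓝}

theorem leftTerm_tmul (n : N) (b : C.carrier) (w : Cobar C) :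
    leftTerm C 𝓝 ((n ⊗ₜ b) ⊗ₜ w) = sign 𝓝 n ⊗ₜ (univTwist C b * w) := by
  simp [leftTerm]

theorem rightTerm_tmul {p : ℕ} {a : C.carrier} (ha : a ∈ C.grading p) (n : N) (w : Cobar C) :
    rightTerm C 𝓝 ((a ⊗ₜ n) ⊗ₜ w) =
      (sign 𝓝 ^ (p + 1)) n ⊗ₜ ((sign (cobarGrading C) ^ (p + 1)) w * univTwist C a) := by
  cases p with
  | zero => simp [rightTerm, univTwist_of_zero ha]
  | succ p =>
    have h := univTwist_mem ha
    simp only [rightTerm, LinearMap.comp_apply, LinearMap.rTensor_tmul, koszulSwap_of_mem h,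
      LinearEquiv.coe_coe, TensorProduct.assoc_tmul, LinearMap.lTensor_tmul,
      LinearMap.mul'_apply, pow_succ, Module.End.mul_apply, sign_sign]

theorem rightTerm_tmul_lower {p : ℕ} {a : C.carrier} (ha : a ∈ lower C.grading p) (n : N)
    (w : Cobar C) : rightTerm C 𝓝 ((a ⊗ₜ n) ⊗ₜ w) =
      (sign 𝓝 ^ p) n ⊗ₜ ((sign (cobarGrading C) ^ p) w * univTwist C a) := by
  cases p with
  | zero =>
    have h : a = 0 := ha
    simp [h]
  | succ p => exact rightTerm_tmul ha n w

theorem sign_pow_even {p : ℕ} (hp : Even p) (n : N) : (sign 𝓝 ^ p) n = n := by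
  obtain ⟨k, rfl⟩ := hp
  have : sign 𝓝 ^ 2 = 1 := by
    ext x; simp [pow_two, sign_sign]
  rw [← two_mul, pow_mul, this, one_pow, Module.End.one_apply]

theorem sign_pow_odd {p : ℕ} (hp : Odd p) (n : N) : (sign 𝓝 ^ p) n = sign 𝓝 n := by
  obtain ⟨k, rfl⟩ := hp
  rw [pow_succ', Module.End.mul_apply, sign_pow_even (even_two_mul k)]

theorem leftTerm_rTensor (z : C.carrier ⊗[R] C.carrier) (w : Cobar C) :
    LinearMap.rTensor _ (Coalgebra.comul (R := R)) (leftTerm C C.grading (z ⊗ₜ w)) =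
      leftTerm C (tensorGrading C.grading C.grading)
        ((LinearMap.rTensor _ (Coalgebra.comul (R := R)) z) ⊗ₜ w) := by
  induction z with
  | zero => simp
  | add x y hx hy => simp only [TensorProduct.add_tmul, map_add, hx, hy]
  | tmul a b => simp [leftTerm_tmul, sign_tmul, sign_comul]

theorem comul_sign_pow (p : ℕ) (x : C.carrier) :
    Coalgebra.comul (R := R) ((sign C.grading ^ p) x) =
      (sign (tensorGrading C.grading C.grading) ^ p) (Coalgebra.comul (R := R) x) := by
  induction p with
  | zero => simp
  | succ p ih =>
    rw [pow_succ', Module.End.mul_apply, ← sign_comul, ih, ← sign_tmul, pow_succ',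
      Module.End.mul_apply]

theorem rightTerm_rTensor (z : C.carrier ⊗[R] C.carrier) (w : Cobar C) :
    LinearMap.rTensor _ (Coalgebra.comul (R := R)) (rightTerm C C.grading (z ⊗ₜ w)) =
      rightTerm C (tensorGrading C.grading C.grading)
        ((LinearMap.lTensor _ (Coalgebra.comul (R := R)) z) ⊗ₜ w) := by
  have := tensor_hom_ext C.grading C.grading
    (f := LinearMap.rTensor _ (Coalgebra.comul (R := R)) ∘ₗ rightTerm C C.grading ∘ₗ
      (TensorProduct.mk R _ _).flip w)
    (g := rightTerm C (tensorGrading C.grading C.grading) ∘ₗ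
      (TensorProduct.mk R _ _).flip w ∘ₗ LinearMap.lTensor _ (Coalgebra.comul (R := R)))
    fun p q a ha b hb => by
      simp [rightTerm_tmul ha, comul_sign_pow]
  exact LinearMap.congr_fun this z

theorem left_left (z : C.carrier ⊗[R] C.carrier) (w : Cobar C) :
    tensorD C.toChainCx (cobar C) (leftTerm C C.grading (z ⊗ₜ w)) +
      leftTerm C C.grading (tensorD C.toChainCx C.toChainCx z ⊗ₜ w +
        TensorProduct.map (sign C.grading) (sign C.grading) z ⊗ₜ cobarD C w) =
    leftTerm C C.grading (leftTerm C (tensorGrading C.grading C.grading)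
      ((TensorProduct.assoc R _ _ _).symm
        (LinearMap.lTensor _ (Coalgebra.comul (R := R)) z) ⊗ₜ w)) := by
  induction z with
  | zero => simp
  | add x y hx hy =>
    simp only [TensorProduct.add_tmul, map_add] at hx hy ⊢
    rw [← hx, ← hy]; abel
  | tmul a b =>
    have h : leftTerm C C.grading (leftTerm C (tensorGrading C.grading C.grading)
      ((TensorProduct.assoc R _ _ _).symm
        (a ⊗ₜ Coalgebra.comul (R := R) b) ⊗ₜ w)) = a ⊗ₜ (twistSq C b * w) := by
      rw [twistSq_eq]
      induction Coalgebra.comul (R := R) b with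
      | zero => simp
      | add x y hx hy =>
        simp only [TensorProduct.tmul_add, TensorProduct.add_tmul, map_add, add_mul, hx, hy]
      | tmul x y => simp [leftTerm_tmul, sign_tmul, sign_sign, twistMul, mul_assoc]
    rw [LinearMap.lTensor_tmul, h]
    simp only [tensorD, LinearMap.add_apply, TensorProduct.map_tmul, leftTerm_tmul,
      TensorProduct.add_tmul, map_add, LinearMap.id_apply, cobarD_mul, cobarD_univTwist,
      sign_univTwist, sign_sign, sign_d, TensorProduct.tmul_add, TensorProduct.neg_tmul, sub_mul,
      neg_mul, TensorProduct.tmul_sub, TensorProduct.tmul_neg]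
    abel

theorem left_right (z : C.carrier ⊗[R] (C.carrier ⊗[R] C.carrier)) (w : Cobar C) :
    leftTerm C C.grading (rightTerm C (tensorGrading C.grading C.grading) (z ⊗ₜ w)) =
    - rightTerm C C.grading (leftTerm C (tensorGrading C.grading C.grading)
      ((TensorProduct.assoc R _ _ _).symm z ⊗ₜ w)) := by
  have := tensor_hom_ext C.grading (tensorGrading C.grading C.grading)
    (f := leftTerm C C.grading ∘ₗ rightTerm C (tensorGrading C.grading C.grading) ∘ₗ
      (TensorProduct.mk R _ _).flip w)
    (g := - rightTerm C C.grading ∘ₗ leftTerm C (tensorGrading C.grading C.grading) ∘ₗ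
      (TensorProduct.mk R _ _).flip w ∘ₗ (TensorProduct.assoc R _ _ _).symm.toLinearMap)
    fun p q a ha b hb => by
      clear hb
      induction b with
      | zero => simp
      | add x y hx hy => simp only [TensorProduct.tmul_add, map_add, hx, hy]
      | tmul b c =>
        simp only [LinearMap.comp_apply, LinearMap.flip_apply, TensorProduct.mk_apply,
          rightTerm_tmul ha, LinearMap.neg_apply, LinearEquiv.coe_coe,
          TensorProduct.assoc_symm_tmul, leftTerm_tmul, sign_tmul, TensorProduct.map_tmul,
          rightTerm_tmul (sign_mem ha)]
        rcases Nat.even_or_odd p with hp | hp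
        · simp only [sign_pow_odd hp.add_one, sign_tmul, TensorProduct.map_tmul, leftTerm_tmul,
            sign_sign, sign_mul, sign_univTwist, sign_of_mem ha, hp.neg_one_pow, one_smul, neg_mul,
            TensorProduct.tmul_neg, neg_neg, mul_assoc]
        · simp only [sign_pow_even hp.add_one, sign_tmul, TensorProduct.map_tmul, leftTerm_tmul,
            sign_sign, sign_mul, sign_univTwist, sign_of_mem ha, hp.neg_one_pow, neg_smul, one_smul,
            map_neg, mul_neg,
            neg_mul, TensorProduct.tmul_neg, neg_neg, mul_assoc]
  exact LinearMap.congr_fun this z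

theorem right_right (z : C.carrier ⊗[R] C.carrier) (w : Cobar C) :
    tensorD C.toChainCx (cobar C) (rightTerm C C.grading (z ⊗ₜ w)) +
      rightTerm C C.grading (tensorD C.toChainCx C.toChainCx z ⊗ₜ w +
        TensorProduct.map (sign C.grading) (sign C.grading) z ⊗ₜ cobarD C w) =
    - rightTerm C C.grading (rightTerm C (tensorGrading C.grading C.grading)
      ((TensorProduct.assoc R _ _ _)
        (LinearMap.rTensor _ (Coalgebra.comul (R := R)) z) ⊗ₜ w)) := by
  let T := fun w => (TensorProduct.mk R (C.carrier ⊗[R] C.carrier) (Cobar C)).flip w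
  have := tensor_hom_ext C.grading C.grading
    (f := tensorD C.toChainCx (cobar C) ∘ₗ rightTerm C C.grading ∘ₗ T w +
      rightTerm C C.grading ∘ₗ (T w ∘ₗ tensorD C.toChainCx C.toChainCx +
        T (cobarD C w) ∘ₗ TensorProduct.map (sign C.grading) (sign C.grading)))
    (g := - rightTerm C C.grading ∘ₗ rightTerm C (tensorGrading C.grading C.grading) ∘ₗ
      (TensorProduct.mk R _ _).flip w ∘ₗ
      (TensorProduct.assoc R _ _ _).toLinearMap ∘ₗ
        (LinearMap.rTensor _ (Coalgebra.comul (R := R))))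
    fun p q a ha b hb => by
      have h : rightTerm C C.grading (rightTerm C (tensorGrading C.grading C.grading)
          ((TensorProduct.assoc R _ _ _)
          (Coalgebra.comul (R := R) a ⊗ₜ b) ⊗ₜ w)) =
          - ((sign C.grading ^ p) b ⊗ₜ ((sign (cobarGrading C) ^ p) w * twistSq C a)) := by
        have key : tensorGrading C.grading C.grading p ≤ LinearMap.eqLocus
            (rightTerm C C.grading ∘ₗ rightTerm C (tensorGrading C.grading C.grading) ∘ₗ
              (TensorProduct.mk R _ _).flip w ∘ₗ (TensorProduct.assoc R _ _ _).toLinearMap ∘ₗ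
              (TensorProduct.mk R _ _).flip b)
            (- TensorProduct.mk R _ _ ((sign C.grading ^ p) b) ∘ₗ
              LinearMap.mulLeft R ((sign (cobarGrading C) ^ p) w) ∘ₗ twistMul C) :=
          tensorGrading_le fun i j hij x hx y hy => by
            subst hij
            simp only [LinearMap.mem_eqLocus, LinearMap.comp_apply, LinearMap.flip_apply,
              TensorProduct.mk_apply, LinearEquiv.coe_coe, TensorProduct.assoc_tmul,
              rightTerm_tmul hx, LinearMap.neg_apply, LinearMap.mulLeft_apply, twistMul,
              TensorProduct.map_tmul, LinearMap.mul'_apply]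
            rcases Nat.even_or_odd i with hi | hi <;> rcases Nat.even_or_odd j with hj | hj
            · simp [sign_pow_odd hi.add_one, sign_tmul, sign_of_mem hy, sign_of_mem hx,
                rightTerm_tmul hy, sign_pow_odd hj.add_one, sign_sign, sign_mul, sign_univTwist,
                sign_pow_even (hi.add hj), hi.neg_one_pow, hj.neg_one_pow, mul_assoc,
                TensorProduct.neg_tmul, TensorProduct.tmul_neg]
            · simp [sign_pow_odd hi.add_one, sign_tmul, sign_of_mem hy, sign_of_mem hx,
                rightTerm_tmul hy, sign_pow_even hj.add_one,
                sign_pow_odd (hi.add_odd hj), hi.neg_one_pow, hj.neg_one_pow, mul_assoc,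
                TensorProduct.neg_tmul, TensorProduct.tmul_neg]
            · simp [sign_pow_even hi.add_one, sign_of_mem hx,
                rightTerm_tmul hy, sign_pow_odd hj.add_one, sign_mul, sign_univTwist,
                sign_pow_odd (hi.add_even hj), hi.neg_one_pow, mul_assoc,
                TensorProduct.neg_tmul, TensorProduct.tmul_neg]
            · simp [sign_pow_even hi.add_one, sign_of_mem hx,
                rightTerm_tmul hy, sign_pow_even hj.add_one,
                sign_pow_even (hi.add_odd hj), hi.neg_one_pow, mul_assoc,
                TensorProduct.neg_tmul, TensorProduct.tmul_neg]
        exact key (C.comul_mem p a ha)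
      have hd := C.d_mem _ a ha
      simp only [T, LinearMap.comp_apply, LinearMap.add_apply, LinearMap.flip_apply,
        TensorProduct.mk_apply, LinearMap.neg_apply, LinearEquiv.coe_coe, LinearMap.rTensor_tmul, h,
        tensorD, TensorProduct.map_tmul, TensorProduct.add_tmul, map_add, LinearMap.id_apply,
        rightTerm_tmul ha, rightTerm_tmul (sign_mem ha), rightTerm_tmul_lower hd]
      rcases Nat.even_or_odd p with hp | hp
      · simp only [sign_pow_odd hp.add_one, sign_pow_even hp, sign_of_mem ha, hp.neg_one_pow, one_smul,
          cobarD_mul, cobarD_univTwist, sign_sign, TensorProduct.tmul_add, sign_d, sign_cobarD,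
          TensorProduct.neg_tmul, TensorProduct.tmul_neg, mul_sub, TensorProduct.tmul_sub, neg_mul]
        abel
      · simp only [sign_pow_even hp.add_one, sign_pow_odd hp, sign_of_mem ha, hp.neg_one_pow, one_smul,
          neg_smul, map_neg,
          cobarD_mul, cobarD_univTwist, sign_sign, TensorProduct.tmul_add, sign_d, sign_cobarD,
          TensorProduct.neg_tmul, TensorProduct.tmul_neg, mul_sub, TensorProduct.tmul_sub, neg_mul, mul_neg]
        abel
  exact LinearMap.congr_fun this z

theorem tensorD_tensorD (X : ChainCx.{u, v} R) (Y : ChainCx.{u, w} R)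
    (z : X.carrier ⊗[R] Y.carrier) : tensorD X Y (tensorD X Y z) = 0 := by
  induction z with
  | zero => simp
  | add x y hx hy => simp [hx, hy]
  | tmul x y => simp [tensorD, X.d_d, Y.d_d, sign_d, TensorProduct.neg_tmul]

theorem coHochD_tmul (c : C.carrier) (w : Cobar C) : coHochD C (c ⊗ₜ w) =
    tensorD C.toChainCx (cobar C) (c ⊗ₜ w) -
      leftTerm C C.grading (Coalgebra.comul (R := R) c ⊗ₜ w) +
      rightTerm C C.grading (Coalgebra.comul (R := R) c ⊗ₜ w) := rfl

theorem rTensor_tensorD (c : C.carrier) (w : Cobar C) :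
    LinearMap.rTensor _ (Coalgebra.comul (R := R)) (tensorD C.toChainCx (cobar C) (c ⊗ₜ w)) =
      tensorD C.toChainCx C.toChainCx (Coalgebra.comul (R := R) c) ⊗ₜ w +
        TensorProduct.map (sign C.grading) (sign C.grading) (Coalgebra.comul (R := R) c) ⊗ₜ
          cobarD C w := by
  simp [tensorD, sign_comul, C.comul_d]

theorem coHochD_coHochD (z : C.carrier ⊗[R] Cobar C) : coHochD C (coHochD C z) = 0 := by
  induction z with
  | zero => simp
  | add x y hx hy => simp [hx, hy]
  | tmul c w =>
    have h1 := left_left (Coalgebra.comul (R := R) c) w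
    have h2 := right_right (Coalgebra.comul (R := R) c) w
    have h3 := left_right (LinearMap.lTensor _ (Coalgebra.comul (R := R))
      (Coalgebra.comul (R := R) c)) w
    have h4 := tensorD_tensorD C.toChainCx (cobar C) (c ⊗ₜ w)
    rw [← rTensor_tensorD] at h1 h2
    rw [← Coalgebra.coassoc_apply, LinearEquiv.symm_apply_apply, ← leftTerm_rTensor] at h1 h3
    rw [Coalgebra.coassoc_apply, ← rightTerm_rTensor] at h2
    rw [Coalgebra.coassoc_apply, ← rightTerm_rTensor] at h3
    rw [coHochD_tmul]
    simp only [map_add, map_sub]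
    simp only [coHochD, LinearMap.add_apply, LinearMap.sub_apply, LinearMap.comp_apply]
    rw [h4]
    rw [← eq_sub_iff_add_eq] at h1 h2
    rw [h1, h2, h3]
    abel

theorem coHochD_mem (n : ℕ) (z : C.carrier ⊗[R] Cobar C)
    (hz : z ∈ tensorGrading C.grading (cobarGrading C) n) :
    coHochD C z ∈ lower (tensorGrading C.grading (cobarGrading C)) n := by
  have key : tensorGrading C.grading (cobarGrading C) n ≤
      (lower (tensorGrading C.grading (cobarGrading C)) n).comap (coHochD C) :=
    tensorGrading_le fun p q h c hc w hw => by
      rw [Submodule.mem_comap, coHochD_tmul]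
      refine add_mem (sub_mem ?_ ?_) ?_
      · simp only [tensorD, LinearMap.add_apply, TensorProduct.map_tmul]
        exact add_mem (tmul_mem_lower h (C.d_mem p c hc) hw)
          (tmul_mem_lower' h (sign_mem hc) (cobarD_mem q w hw))
      · have : tensorGrading C.grading C.grading p ≤
            (lower (tensorGrading C.grading (cobarGrading C)) n).comap
              (leftTerm C C.grading ∘ₗ (TensorProduct.mk R _ _).flip w) :=
          tensorGrading_le fun i j hij a ha b hb => by
            simp only [Submodule.mem_comap, LinearMap.comp_apply, LinearMap.flip_apply,
              TensorProduct.mk_apply, leftTerm_tmul]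
            exact tmul_mem_lower' (q := j + q) (by omega) (sign_mem ha)
              (mul_mem_lower rfl (univTwist_mem_lower hb) hw)
        exact this (C.comul_mem p c hc)
      · have : tensorGrading C.grading C.grading p ≤
            (lower (tensorGrading C.grading (cobarGrading C)) n).comap
              (rightTerm C C.grading ∘ₗ (TensorProduct.mk R _ _).flip w) :=
          tensorGrading_le fun i j hij a ha b hb => by
            simp only [Submodule.mem_comap, LinearMap.comp_apply, LinearMap.flip_apply,
              TensorProduct.mk_apply, rightTerm_tmul ha, sign_pow_mem _ hb, sign_pow_mem _ hw]
            exact tmul_mem_lower' (q := q + i) (by omega) (Submodule.smul_mem _ _ hb)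
              (mul_mem_lower' rfl (Submodule.smul_mem _ _ hw) (univTwist_mem_lower ha))
        exact this (C.comul_mem p c hc)
  exact key hz

variable (C) in
/-- The coHochschild complex of `C`, i.e. the Hochschild complex of the universal twisting cochain
`t : C → Ω C`: the graded module `C ⊗ Ω C` with the differential `coHochD`. -/
noncomputable abbrev coHoch : ChainCx.{u, max u v} R where
  carrier := C.carrier ⊗[R] Cobar C
  grading := tensorGrading C.grading (cobarGrading C)
  d := coHochD C
  d_mem := coHochD_mem
  d_d := coHochD_coHochD

variable (C) in
/-- The augmentation `Ω C → R`, which kills the generators. -/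
noncomputable def cobarCounit : Cobar C →ₐ[R] R := TensorAlgebra.algebraMapInv

theorem cobarCounit_univTwist (c : C.carrier) : cobarCounit C (univTwist C c) = 0 := by
  simp [cobarCounit, univTwist, TensorAlgebra.algebraMapInv]

theorem cobarCounit_of_pos {n : ℕ} (hn : n ≠ 0) {w : Cobar C} (hw : w ∈ cobarGrading C n) :
    cobarCounit C w = 0 := by
  have : cobarGrading C n ≤ LinearMap.ker (cobarCounit C).toLinearMap := by
    refine Submodule.span_le.2 ?_
    rintro _ ⟨l, rfl, rfl⟩
    cases l with
    | nil => simp at hn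
    | cons p l => simp [cobarCounit_univTwist]
  exact this hw

theorem cobarCounit_cobarD (w : Cobar C) : cobarCounit C (cobarD C w) = 0 := by
  have hT (c : C.carrier) : cobarCounit C (twistSq C c) = 0 := by
    rw [twistSq_eq]
    induction Coalgebra.comul (R := R) c with
    | zero => simp
    | add x y hx hy => simp [hx, hy]
    | tmul x y => simp [twistMul, cobarCounit_univTwist]
  have hg (v : Desusp C) : cobarCounit C (cobarD C (TensorAlgebra.ι R v)) = 0 := by
    have : ((cobarCounit C).toLinearMap ∘ₗ cobarD C) ∘ₗ TensorAlgebra.ι R = 0 :=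
      DirectSum.linearMap_ext _ fun n => LinearMap.ext fun x => by
        simp [← univTwist_coe, cobarD_univTwist, hT, cobarCounit_univTwist]
    exact LinearMap.congr_fun this v
  have hs (a : Cobar C) : cobarCounit C (sign (cobarGrading C) a) = cobarCounit C a := by
    have : (cobarCounit C).toLinearMap ∘ₗ sign (cobarGrading C) = (cobarCounit C).toLinearMap :=
      DirectSum.decompose_lhom_ext (cobarGrading C) fun n => LinearMap.ext fun x => by
        rcases eq_or_ne n 0 with rfl | hn
        · simp [sign_of_mem x.2]
        · simp [sign_of_mem x.2, cobarCounit_of_pos hn x.2]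
    exact LinearMap.congr_fun this a
  induction w using TensorAlgebra.induction with
  | algebraMap r => simp [cobarD_algebraMap]
  | ι x => exact hg x
  | mul a b ha hb => simp [cobarD_mul, ha, hb]
  | add a b ha hb => simp [ha, hb]

variable (C) in
/-- The inclusion of `Ω C` in the coHochschild complex, `w ↦ 1 ⊗ w`. -/
noncomputable def coHochIncl : ChainMap (cobar C) (coHoch C) where
  toLin := TensorProduct.mk R C.carrier (Cobar C) C.unit
  map_mem n w hw := tmul_mem_tensorGrading (p := 0) (by omega) C.unit_mem hw
  map_d w := by
    have h : C.d C.unit = 0 := C.d_mem 0 _ C.unit_mem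
    simp [coHochD_tmul, C.unit_isGroupLike.comul_eq_tmul_self, leftTerm_tmul,
      rightTerm_tmul C.unit_mem, univTwist_of_zero C.unit_mem, tensorD, h, sign_of_mem C.unit_mem]

variable (C) in
/-- The projection of the coHochschild complex to `C`, `c ⊗ w ↦ ε w • c`. -/
noncomputable def coHochProj : ChainMap (coHoch C) C.toChainCx where
  toLin := TensorProduct.rid R C.carrier ∘ₗ LinearMap.lTensor _ (cobarCounit C).toLinearMap
  map_mem n z hz := by
    have key : tensorGrading C.grading (cobarGrading C) n ≤ (C.grading n).comap
        (TensorProduct.rid R C.carrier ∘ₗ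
          LinearMap.lTensor _ (cobarCounit C).toLinearMap) :=
      tensorGrading_le fun p q h c hc w hw => by
        rcases eq_or_ne q 0 with rfl | hq
        · obtain rfl : p = n := h
          simpa using Submodule.smul_mem _ _ hc
        · simp [cobarCounit_of_pos hq hw]
    exact key hz
  map_d z := by
    refine TensorProduct.induction_on z (by simp) (fun c w => ?_)
      (fun x y hx hy => by simp only [map_add, hx, hy])
    have hl (z : C.carrier ⊗[R] C.carrier) : LinearMap.lTensor _ (cobarCounit C).toLinearMap
        (leftTerm C C.grading (z ⊗ₜ w)) = 0 := by
      induction z with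
      | zero => simp
      | add x y hx hy => simp only [TensorProduct.add_tmul, map_add, hx, hy, add_zero]
      | tmul a b => simp [leftTerm_tmul, cobarCounit_univTwist]
    have hr (z : C.carrier ⊗[R] C.carrier) : LinearMap.lTensor _ (cobarCounit C).toLinearMap
        (rightTerm C C.grading (z ⊗ₜ w)) = 0 := by
      have := tensor_hom_ext C.grading C.grading
        (f := LinearMap.lTensor _ (cobarCounit C).toLinearMap ∘ₗ rightTerm C C.grading ∘ₗ
          (TensorProduct.mk R _ _).flip w) (g := 0) fun p q a ha b hb => by
            simp [rightTerm_tmul ha, cobarCounit_univTwist]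
      exact LinearMap.congr_fun this z
    simp [coHochD_tmul, hl, hr, tensorD, cobarCounit_cobarD]


end CoHoch

section Maps
variable {R : Type u} [CommRing R]

/-- Morphisms of coaugmented chain coalgebras. -/
structure CoalgebraMap (C : ChainCoalgebra.{u, v} R) (C' : ChainCoalgebra.{u, w} R) extends
    ChainMap C.toChainCx C'.toChainCx where
  map_comul : ∀ x, Coalgebra.comul (R := R) (toLin x) =
    TensorProduct.map toLin toLin (Coalgebra.comul (R := R) x)
  map_counit : ∀ x, Coalgebra.counit (R := R) (toLin x) = Coalgebra.counit (R := R) x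
  map_unit : toLin C.unit = C'.unit

variable {C : ChainCoalgebra.{u, v} R} {C' : ChainCoalgebra.{u, w} R} (f : CoalgebraMap C C')

/-- The algebra map `Ω f : Ω C → Ω C'`, `s⁻¹ c ↦ s⁻¹ (f c)`. -/
noncomputable def cobarMap : Cobar C →ₐ[R] Cobar C' :=
  TensorAlgebra.lift R (univTwist C' ∘ₗ f.toLin ∘ₗ resusp C)

theorem cobarMap_univTwist (c : C.carrier) :
    cobarMap f (univTwist C c) = univTwist C' (f.toLin c) := by
  have : (cobarMap f).toLinearMap ∘ₗ univTwist C = univTwist C' ∘ₗ f.toLin :=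
    DirectSum.decompose_lhom_ext C.grading fun n => LinearMap.ext fun x => by
      cases n with
      | zero => simp [univTwist_of_zero x.2, univTwist_of_zero (f.map_mem 0 x x.2)]
      | succ n => simp [univTwist_coe, cobarMap, resusp]
  exact LinearMap.congr_fun this c

theorem cobarMap_mem (n : ℕ) (w : Cobar C) (hw : w ∈ cobarGrading C n) :
    cobarMap f w ∈ cobarGrading C' n := by
  have : cobarGrading C n ≤ (cobarGrading C' n).comap (cobarMap f).toLinearMap := by
    refine Submodule.span_le.2 ?_
    rintro _ ⟨l, rfl, rfl⟩
    simp only [Submodule.comap_coe, Set.mem_preimage, AlgHom.toLinearMap_apply, map_list_prod,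
      List.map_map, SetLike.mem_coe]
    have := prod_mem_cobarGrading (C := C')
      (l.map fun p => ⟨p.1, f.toLin p.2, f.map_mem _ _ p.2.2⟩)
    simpa [List.map_map, Function.comp_def, cobarMap_univTwist] using this
  exact this hw

theorem cobarMap_sign (w : Cobar C) :
    cobarMap f (sign (cobarGrading C) w) = sign (cobarGrading C') (cobarMap f w) := by
  have : (cobarMap f).toLinearMap ∘ₗ sign (cobarGrading C) =
      sign (cobarGrading C') ∘ₗ (cobarMap f).toLinearMap :=
    DirectSum.decompose_lhom_ext (cobarGrading C) fun n => LinearMap.ext fun x => by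
      simp [sign_of_mem x.2, sign_of_mem (cobarMap_mem f n x x.2)]
  exact LinearMap.congr_fun this w

theorem map_sign (c : C.carrier) :
    f.toLin (sign C.grading c) = sign C'.grading (f.toLin c) := by
  have : f.toLin ∘ₗ sign C.grading = sign C'.grading ∘ₗ f.toLin :=
    DirectSum.decompose_lhom_ext C.grading fun n => LinearMap.ext fun x => by
      simp [sign_of_mem x.2, sign_of_mem (f.map_mem n x x.2)]
  exact LinearMap.congr_fun this c

theorem cobarMap_twistSq (c : C.carrier) :
    cobarMap f (twistSq C c) = twistSq C' (f.toLin c) := by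
  rw [twistSq_eq, twistSq_eq, f.map_comul]
  induction Coalgebra.comul (R := R) c with
  | zero => simp
  | add x y hx hy => simp only [map_add, hx, hy]
  | tmul x y => simp [twistMul, cobarMap_univTwist, map_sign]

theorem cobarMap_cobarD (w : Cobar C) :
    cobarMap f (cobarD C w) = cobarD C' (cobarMap f w) := by
  have hg (v : Desusp C) : cobarMap f (cobarD C (TensorAlgebra.ι R v)) =
      cobarD C' (cobarMap f (TensorAlgebra.ι R v)) := by
    have : ((cobarMap f).toLinearMap ∘ₗ cobarD C) ∘ₗ TensorAlgebra.ι R =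
        (cobarD C' ∘ₗ (cobarMap f).toLinearMap) ∘ₗ TensorAlgebra.ι R :=
      DirectSum.linearMap_ext _ fun n => LinearMap.ext fun x => by
        simp [← univTwist_coe, cobarD_univTwist, cobarMap_univTwist, cobarMap_twistSq, f.map_d]
    exact LinearMap.congr_fun this v
  induction w using TensorAlgebra.induction with
  | algebraMap r => simp [cobarD_algebraMap]
  | ι x => exact hg x
  | mul a b ha hb => simp [cobarD_mul, ha, hb, cobarMap_sign]
  | add a b ha hb => simp [ha, hb]

/-- The chain map `f ⊗ Ω f` of coHochschild complexes induced by a coalgebra map `f`. -/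
noncomputable def coHochMap : ChainMap (coHoch C) (coHoch C') where
  toLin := TensorProduct.map f.toLin (cobarMap f).toLinearMap
  map_mem n z hz := by
    have key : tensorGrading C.grading (cobarGrading C) n ≤
        (tensorGrading C'.grading (cobarGrading C') n).comap
          (TensorProduct.map f.toLin (cobarMap f).toLinearMap) :=
      tensorGrading_le fun p q h c hc w hw =>
        tmul_mem_tensorGrading h (f.map_mem p c hc) (cobarMap_mem f q w hw)
    exact key hz
  map_d z := by
    refine TensorProduct.induction_on z (by simp) (fun c w => ?_)
      (fun x y hx hy => by simp only [map_add, hx, hy])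
    have hl (z : C.carrier ⊗[R] C.carrier) :
        TensorProduct.map f.toLin (cobarMap f).toLinearMap (leftTerm C C.grading (z ⊗ₜ w)) =
          leftTerm C' C'.grading (TensorProduct.map f.toLin f.toLin z ⊗ₜ cobarMap f w) := by
      induction z with
      | zero => simp
      | add x y hx hy => simp only [TensorProduct.add_tmul, map_add, hx, hy]
      | tmul a b => simp [leftTerm_tmul, map_sign, cobarMap_univTwist]
    have hr (z : C.carrier ⊗[R] C.carrier) :
        TensorProduct.map f.toLin (cobarMap f).toLinearMap (rightTerm C C.grading (z ⊗ₜ w)) =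
          rightTerm C' C'.grading (TensorProduct.map f.toLin f.toLin z ⊗ₜ cobarMap f w) := by
      have := tensor_hom_ext C.grading C.grading
        (f := TensorProduct.map f.toLin (cobarMap f).toLinearMap ∘ₗ rightTerm C C.grading ∘ₗ
          (TensorProduct.mk R _ _).flip w)
        (g := rightTerm C' C'.grading ∘ₗ (TensorProduct.mk R _ _).flip (cobarMap f w) ∘ₗ
          TensorProduct.map f.toLin f.toLin) fun p q a ha b hb => by
            simp only [LinearMap.comp_apply, LinearMap.flip_apply, TensorProduct.mk_apply,
              rightTerm_tmul ha, TensorProduct.map_tmul, rightTerm_tmul (f.map_mem p a ha)]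
            rcases Nat.even_or_odd (p + 1) with hp | hp
            · simp [sign_pow_even hp, cobarMap_univTwist]
            · simp [sign_pow_odd hp, cobarMap_univTwist, map_sign, cobarMap_sign]
      exact LinearMap.congr_fun this z
    simp only [coHochD_tmul, TensorProduct.map_tmul, AlgHom.toLinearMap_apply, map_add, map_sub,
      hl, hr, ← f.map_comul]
    simp [tensorD, f.map_d, map_sign, cobarMap_cobarD]

end Maps

section Hirsch

variable {R : Type u} [CommRing R]

/-- An algebra map from the cobar construction to its graded tensor square, seen as a linear map
into the ordinary tensor product (`ᵍ⊗` is `⊗` as a module, with the Koszul-signed product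
`(a ⊗ b) (a' ⊗ b') = (-1) ^ (|b| |a'|) a a' ⊗ b b'`). -/
noncomputable def tensorSquareLin {C : ChainCoalgebra.{u, v} R}
    (psi : Cobar C →ₐ[R] cobarGrading C ᵍ⊗[R] cobarGrading C) :
    Cobar C →ₗ[R] Cobar C ⊗[R] Cobar C :=
  (GradedTensorProduct.of R (cobarGrading C) (cobarGrading C)).symm.toLinearMap ∘ₗ
    psi.toLinearMap

/-- A Hirsch coalgebra: a connected coaugmented chain coalgebra `C` with a loop comultiplication
`ψ : Ω C → Ω C ⊗ Ω C`, which is a morphism of chain algebras (multiplicative, of degree zero,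
compatible with the differentials), coassociative, and counital with respect to the augmentation
of `Ω C`; thus `(Ω C, ψ)` is a chain Hopf algebra. -/
structure HirschCoalgebra (R : Type u) [CommRing R] extends ChainCoalgebra.{u, v} R where
  psi : Cobar toChainCoalgebra →ₐ[R]
    cobarGrading toChainCoalgebra ᵍ⊗[R] cobarGrading toChainCoalgebra
  psi_mem : ∀ n, ∀ w ∈ cobarGrading toChainCoalgebra n, tensorSquareLin psi w ∈
    tensorGrading (cobarGrading toChainCoalgebra) (cobarGrading toChainCoalgebra) n
  psi_d : ∀ w, tensorSquareLin psi (cobarD toChainCoalgebra w) =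
    tensorD (cobar toChainCoalgebra) (cobar toChainCoalgebra) (tensorSquareLin psi w)
  psi_coassoc : ∀ w, TensorProduct.assoc R _ _ _
      (LinearMap.rTensor _ (tensorSquareLin psi) (tensorSquareLin psi w)) =
    LinearMap.lTensor _ (tensorSquareLin psi) (tensorSquareLin psi w)
  psi_counit_left : ∀ w, TensorProduct.lid R _ (LinearMap.rTensor _
    (cobarCounit toChainCoalgebra).toLinearMap (tensorSquareLin psi w)) = w
  psi_counit_right : ∀ w, TensorProduct.rid R _ (LinearMap.lTensor _
    (cobarCounit toChainCoalgebra).toLinearMap (tensorSquareLin psi w)) = w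

namespace HirschCoalgebra

variable (B : HirschCoalgebra.{u, v} R)

/-- The loop comultiplication as a linear map `Ω C → Ω C ⊗ Ω C`. -/
noncomputable def loopComul :
    Cobar B.toChainCoalgebra →ₗ[R] Cobar B.toChainCoalgebra ⊗[R] Cobar B.toChainCoalgebra :=
  tensorSquareLin B.psi

/-- A Hirsch coalgebra is balanced if its loop comultiplication is (graded) cocommutative. -/
def IsBalanced : Prop :=
  ∀ w, koszulSwap (cobarGrading B.toChainCoalgebra) (cobarGrading B.toChainCoalgebra)
    (B.loopComul w) = B.loopComul w

/-- The `r`-th power map `λ_r` of the chain Hopf algebra `(Ω C, ψ)`: the `r`-fold convolution power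
of the identity, i.e. `λ_0 = η ε` and `λ_(r+1) = μ (λ_r ⊗ id) ψ`; so `λ_1 = id`, and `λ_r` is the
iterated comultiplication followed by the iterated multiplication. -/
noncomputable def powerMap : ℕ → Cobar B.toChainCoalgebra →ₗ[R] Cobar B.toChainCoalgebra
  | 0 => Algebra.linearMap R _ ∘ₗ (cobarCounit B.toChainCoalgebra).toLinearMap
  | r + 1 => LinearMap.mul' R _ ∘ₗ TensorProduct.map (powerMap r) LinearMap.id ∘ₗ B.loopComul

/-- The coHochschild complex of the underlying coalgebra of a Hirsch coalgebra. -/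
noncomputable abbrev coHochschild : ChainCx.{u, max u v} R := coHoch B.toChainCoalgebra

end HirschCoalgebra

/-- Morphisms of Hirsch coalgebras: morphisms `f` of coaugmented chain coalgebras such that
`(Ω f ⊗ Ω f) ψ = ψ' (Ω f)`. -/
structure HirschMap (B : HirschCoalgebra.{u, v} R) (B' : HirschCoalgebra.{u, w} R) extends
    CoalgebraMap B.toChainCoalgebra B'.toChainCoalgebra where
  map_psi : ∀ w, TensorProduct.map (cobarMap toCoalgebraMap).toLinearMap
      (cobarMap toCoalgebraMap).toLinearMap (B.loopComul w) =
    B'.loopComul (cobarMap toCoalgebraMap w)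

end Hirsch

end CoHochschild

/-!
The tensor algebra `A = Ω C` is a graded bialgebra with comultiplication `ψ`. Write `t c` for the
word `s⁻¹ c`. Identifying `c ⊗ h`, for `c` of positive degree, with the form `D (t c) · h` turns the
coHochschild complex into the cone of the commutator map `Da · h ↦ ± (a h - ± h a)` from the cyclic
one-forms of `A` to `A`. Here the symbol `Da · h` (`cyclicForm`) is defined for all `a` and `h` by
the Leibniz rule `D (a b) · h = Da · b h ± Db · h a`, and the formula for the differential on
`D (t c) · h` extends to all forms (`coHochD_cyclicForm`).

The power map of the coHochschild complex is `λ_r` on `1 ⊗ A`, and on forms it is the extension of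
`Da · h ↦ Da · h (a h) ^ (r - 1)` from grouplike elements to `A`: copies of `a` and `h` are produced
by `ψ`, and the factors are interleaved with Koszul signs (`interleave`, `formPower`). Three
identities, obvious for grouplike elements, carry the proof:

* `a h (a h) ^ k = (a h) ^ (k + 1)` and `h (a h) ^ k a = (h a) ^ (k + 1)`, which say that the map
  commutes with the commutator map (`mul_formPower`, `mul_koszulSwap_formPower`);
* `D (a b) · h (a b h) ^ k = Da · b h (a b h) ^ k + Db · h a (b h a) ^ k`, which says that it is
  compatible with the Leibniz rule (`cyclicForm_formPower_mul`).

The second and the third move a copy of `a` from the first place to the last, so they need `ψ` to be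
graded cocommutative (`koszulSwap_map_comul`). Everything else is formal: the map of tensor squares
`formPower` is composed of structure maps, so it is a chain map and natural, and its compatibility
with the counit gives the projection to `C`.
-/

namespace CoHochschild

/-! ### Signs and homogeneous tensors -/

section Induction

variable {R : Type u} [CommRing R]
  {M : Type v} [AddCommGroup M] [Module R M] {𝓜 : ℕ → Submodule R M}
  {N : Type w} [AddCommGroup N] [Module R N] {𝓝 : ℕ → Submodule R N}

/-- Induction on an element of a given total degree of a tensor product. -/
theorem tensorGrading_induction {n : ℕ} {P : M ⊗[R] N → Prop} (zero : P 0)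
    (add : ∀ x y, P x → P y → P (x + y))
    (tmul : ∀ p q, p + q = n → ∀ x ∈ 𝓜 p, ∀ y ∈ 𝓝 q, P (x ⊗ₜ y))
    {z : M ⊗[R] N} (hz : z ∈ tensorGrading 𝓜 𝓝 n) : P z := by
  refine Submodule.iSup_induction _ (motive := P) hz (fun p z hz => ?_) zero add
  rw [Submodule.map₂_eq_span_image2] at hz
  induction hz using Submodule.closure_induction with
  | zero => exact zero
  | add x y _ _ hx hy => exact add x y hx hy
  | smul_mem r z hz =>
    obtain ⟨x, hx, y, hy, rfl⟩ := hz
    change P (r • x ⊗ₜ[R] y)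
    rw [TensorProduct.smul_tmul']
    exact tmul _ _ p.2 _ (Submodule.smul_mem _ r hx) y hy

end Induction

section Sign

variable {R : Type u} [CommRing R]
  {M : Type v} [AddCommGroup M] [Module R M] {𝓜 : ℕ → Submodule R M}
  [DirectSum.Decomposition 𝓜]
  {N : Type w} [AddCommGroup N] [Module R N] {𝓝 : ℕ → Submodule R N}
  [DirectSum.Decomposition 𝓝]

theorem sign_pow_sign_pow (k : ℕ) (x : M) : (sign 𝓜 ^ k) ((sign 𝓜 ^ k) x) = x := by
  rw [← Module.End.mul_apply, ← pow_add, sign_pow_even (Even.add_self k)]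

theorem sign_pow_add (k l : ℕ) (x : M) :
    (sign 𝓜 ^ (k + l)) x = (sign 𝓜 ^ k) ((sign 𝓜 ^ l) x) := by
  rw [pow_add, Module.End.mul_apply]

theorem sign_pow_mem_grading (k : ℕ) {n : ℕ} {x : M} (hx : x ∈ 𝓜 n) : (sign 𝓜 ^ k) x ∈ 𝓜 n := by
  rw [sign_pow_mem k hx]; exact Submodule.smul_mem _ _ hx

theorem sign_pow_tmul (k : ℕ) (z : M ⊗[R] N) :
    (sign (tensorGrading 𝓜 𝓝) ^ k) z = TensorProduct.map (sign 𝓜 ^ k) (sign 𝓝 ^ k) z := by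
  induction k generalizing z with
  | zero => simp [Module.End.one_eq_id]
  | succ k ih =>
    rw [pow_succ, Module.End.mul_apply, ih, sign_tmul, pow_succ, pow_succ, Module.End.mul_eq_comp,
      Module.End.mul_eq_comp, TensorProduct.map_comp]
    rfl

/-- A map that raises degrees by `e`, up to parity, commutes with the sign involution up to
`(-1) ^ e`. -/
theorem sign_map_of_degree {f : M →ₗ[R] N} {e : ℕ} (hf : ∀ n, ∀ x ∈ 𝓜 n, f x ∈ 𝓝 (n + e)) (x : M) :
    sign 𝓝 (f x) = (-1 : R) ^ e • f (sign 𝓜 x) := by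
  have : sign 𝓝 ∘ₗ f = (-1 : R) ^ e • f ∘ₗ sign 𝓜 :=
    DirectSum.decompose_lhom_ext 𝓜 fun n => LinearMap.ext fun x => by
      simp [sign_of_mem x.2, sign_of_mem (hf n x x.2), smul_smul, pow_add, mul_comm]
  exact LinearMap.congr_fun this x

theorem sign_pow_map_of_degree {f : M →ₗ[R] N} {e : ℕ}
    (hf : ∀ n, ∀ x ∈ 𝓜 n, f x ∈ 𝓝 (n + e)) (k : ℕ) (x : M) :
    (sign 𝓝 ^ k) (f x) = (-1 : R) ^ (k * e) • f ((sign 𝓜 ^ k) x) := by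
  induction k generalizing x with
  | zero => simp
  | succ k ih =>
    rw [pow_succ, Module.End.mul_apply, sign_map_of_degree hf, map_smul, ih, smul_smul, ← pow_add,
      pow_succ, Module.End.mul_apply]
    congr 2; ring

theorem sign_pow_map {f : M →ₗ[R] N} (hf : ∀ n, ∀ x ∈ 𝓜 n, f x ∈ 𝓝 n) (k : ℕ) (x : M) :
    (sign 𝓝 ^ k) (f x) = f ((sign 𝓜 ^ k) x) := by
  simpa using sign_pow_map_of_degree (e := 0) hf k x

theorem sign_pow_mul {A : Type v} [Ring A] [Algebra R A] (𝓐 : ℕ → Submodule R A) [GradedAlgebra 𝓐]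
    (k : ℕ) (a b : A) : (sign 𝓐 ^ k) (a * b) = (sign 𝓐 ^ k) a * (sign 𝓐 ^ k) b := by
  induction k with
  | zero => simp
  | succ k ih => rw [pow_succ', Module.End.mul_apply, ih, sign_mul]; rfl

theorem sign_pow_anti {D : M →ₗ[R] M} (hD : ∀ n, ∀ x ∈ 𝓜 n, D x ∈ lower 𝓜 n) (k : ℕ) (x : M) :
    (sign 𝓜 ^ k) (D x) = (-1 : R) ^ k • D ((sign 𝓜 ^ k) x) := by
  induction k generalizing x with
  | zero => simp
  | succ k ih =>
    rw [pow_succ, Module.End.mul_apply, sign_anti hD, map_neg, ih, pow_succ, mul_neg_one, neg_smul,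
      Module.End.mul_apply]

theorem neg_one_pow_smul_eq {k l : ℕ} (h : Even k ↔ Even l) (x : M) :
    (-1 : R) ^ k • x = (-1 : R) ^ l • x := by
  rw [(neg_one_pow_congr h : (-1 : R) ^ k = (-1 : R) ^ l)]

theorem sign_pow_congr {k l : ℕ} (h : Even k ↔ Even l) : sign 𝓜 ^ k = sign 𝓜 ^ l := by
  ext x
  rcases Nat.even_or_odd k with hk | hk
  · rw [sign_pow_even hk, sign_pow_even (h.1 hk)]
  · rw [sign_pow_odd hk, sign_pow_odd]
    rw [← Nat.not_even_iff_odd] at hk ⊢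
    rwa [← h]

theorem koszulSwap_of_mem_right {q : ℕ} (x : M) {y : N} (hy : y ∈ 𝓝 q) :
    koszulSwap 𝓜 𝓝 (x ⊗ₜ y) = y ⊗ₜ (sign 𝓜 ^ q) x := by
  have : koszulSwap 𝓜 𝓝 ∘ₗ (TensorProduct.mk R M N).flip y =
      TensorProduct.mk R N M y ∘ₗ (sign 𝓜 ^ q) :=
    DirectSum.decompose_lhom_ext 𝓜 fun p => LinearMap.ext fun x => by
      simp [koszulSwap_tmul x.2 hy, sign_pow_mem q x.2, mul_comm]
  exact LinearMap.congr_fun this x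

theorem koszulSwap_of_mem_lower {p : ℕ} {x : M} (hx : x ∈ lower 𝓜 p) (y : N) :
    koszulSwap 𝓜 𝓝 (x ⊗ₜ y) = (sign 𝓝 ^ (p + 1)) y ⊗ₜ x := by
  cases p with
  | zero => have h : x = 0 := hx
            simp [h]
  | succ p => have h : x ∈ 𝓜 p := hx
              rw [koszulSwap_of_mem h, sign_pow_congr (k := p + 1 + 1) (l := p)]
              simp [Nat.even_add_one]

theorem homogeneous_induction (𝓜 : ℕ → Submodule R M) [DirectSum.Decomposition 𝓜]
    {P : M → Prop} (add : ∀ x y, P x → P y → P (x + y)) (mem : ∀ p, ∀ x ∈ 𝓜 p, P x) (x : M) : P x :=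
  DirectSum.Decomposition.inductionOn 𝓜 (mem 0 0 (zero_mem _)) (fun x => mem _ x x.2)
    (fun x y => add x y) x

end Sign

/-! ### Tensor products of complexes -/

section Complexes

variable {R : Type u} [CommRing R]

theorem ChainMap.sign_pow {X : ChainCx.{u, v} R} {Y : ChainCx.{u, w} R} (f : ChainMap X Y) (k : ℕ)
    (x : X.carrier) : (sign Y.grading ^ k) (f.toLin x) = f.toLin ((sign X.grading ^ k) x) :=
  sign_pow_map f.map_mem k x

/-- The tensor product of two chain complexes. -/
noncomputable abbrev tensorCx (X : ChainCx.{u, v} R) (Y : ChainCx.{u, w} R) :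
    ChainCx.{u, max v w} R where
  carrier := X.carrier ⊗[R] Y.carrier
  grading := tensorGrading X.grading Y.grading
  d := tensorD X Y
  d_mem n z hz := by
    refine tensorGrading_induction (P := fun z => tensorD X Y z ∈
      lower (tensorGrading X.grading Y.grading) n) (by simp)
      (fun x y hx hy => by rw [map_add]; exact add_mem hx hy) (fun p q h x hx y hy => ?_) hz
    simp only [tensorD, LinearMap.add_apply, TensorProduct.map_tmul]
    exact add_mem (tmul_mem_lower h (X.d_mem p x hx) hy)
      (tmul_mem_lower' h (sign_mem hx) (Y.d_mem q y hy))
  d_d := tensorD_tensorD X Y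

variable {X : ChainCx.{u, v} R} {Y : ChainCx.{u, w} R} {Z : ChainCx.{u, w'} R}

theorem tensorD_tmul (x : X.carrier) (y : Y.carrier) :
    tensorD X Y (x ⊗ₜ y) = X.d x ⊗ₜ y + sign X.grading x ⊗ₜ Y.d y := rfl

/-- The tensor product of two chain maps. -/
noncomputable def ChainMap.tensor {X' : ChainCx.{u, v} R} {Y' : ChainCx.{u, w} R}
    (f : ChainMap X X') (g : ChainMap Y Y') : ChainMap (tensorCx X Y) (tensorCx X' Y') where
  toLin := TensorProduct.map f.toLin g.toLin
  map_mem n z hz := by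
    refine tensorGrading_induction (P := fun z => TensorProduct.map f.toLin g.toLin z ∈
      tensorGrading X'.grading Y'.grading n) (by simp)
      (fun x y hx hy => by rw [map_add]; exact add_mem hx hy) (fun p q h x hx y hy => ?_) hz
    exact tmul_mem_tensorGrading h (f.map_mem p x hx) (g.map_mem q y hy)
  map_d z := by
    refine TensorProduct.induction_on z (by simp) (fun x y => ?_)
      (fun x y hx hy => by simp only [map_add, hx, hy])
    have h := f.sign_pow 1 x
    simp only [pow_one] at h
    simp [tensorD_tmul, f.map_d, g.map_d, h]

variable (X Y Z)

/-- The associativity isomorphism of chain complexes. -/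
noncomputable def ChainMap.assoc :
    ChainMap (tensorCx (tensorCx X Y) Z) (tensorCx X (tensorCx Y Z)) where
  toLin := (TensorProduct.assoc R X.carrier Y.carrier Z.carrier).toLinearMap
  map_mem n z hz := by
    refine tensorGrading_induction (P := fun z => TensorProduct.assoc R _ _ _ z ∈
      tensorGrading X.grading (tensorGrading Y.grading Z.grading) n) (by simp)
      (fun x y hx hy => by rw [map_add]; exact add_mem hx hy) (fun p q h x hx z hz => ?_) hz
    refine tensorGrading_induction (P := fun x => TensorProduct.assoc R _ _ _ (x ⊗ₜ z) ∈
      tensorGrading X.grading (tensorGrading Y.grading Z.grading) n) (by simp)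
      (fun x y hx hy => by rw [TensorProduct.add_tmul, map_add]; exact add_mem hx hy)
      (fun i j h' x hx y hy => ?_) hx
    exact tmul_mem_tensorGrading (p := i) (q := j + q) (by omega) hx
      (tmul_mem_tensorGrading rfl hy hz)
  map_d z := by
    refine TensorProduct.induction_on z (by simp) (fun x z => ?_)
      (fun x y hx hy => by simp only [map_add, hx, hy])
    refine TensorProduct.induction_on x (by simp) (fun x y => ?_)
      (fun x y hx hy => by simp only [map_add, TensorProduct.add_tmul, hx, hy])
    have h₁ : tensorD (tensorCx X Y) Z ((x ⊗ₜ y) ⊗ₜ z) = tensorD X Y (x ⊗ₜ y) ⊗ₜ z +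
      sign (tensorGrading X.grading Y.grading) (x ⊗ₜ y) ⊗ₜ Z.d z := rfl
    have h₂ : tensorD X (tensorCx Y Z) (x ⊗ₜ (y ⊗ₜ z)) = X.d x ⊗ₜ (y ⊗ₜ z) +
      sign X.grading x ⊗ₜ tensorD Y Z (y ⊗ₜ z) := rfl
    simp [h₁, h₂, tensorD_tmul, sign_tmul, TensorProduct.add_tmul, TensorProduct.tmul_add,
      add_assoc]

/-- The inverse associativity isomorphism of chain complexes. -/
noncomputable def ChainMap.assocSymm :
    ChainMap (tensorCx X (tensorCx Y Z)) (tensorCx (tensorCx X Y) Z) where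
  toLin := (TensorProduct.assoc R X.carrier Y.carrier Z.carrier).symm.toLinearMap
  map_mem n z hz := by
    refine tensorGrading_induction (P := fun z => (TensorProduct.assoc R _ _ _).symm z ∈
      tensorGrading (tensorGrading X.grading Y.grading) Z.grading n) (by simp)
      (fun x y hx hy => by rw [map_add]; exact add_mem hx hy) (fun p q h x hx y hy => ?_) hz
    refine tensorGrading_induction (P := fun y => (TensorProduct.assoc R _ _ _).symm (x ⊗ₜ y) ∈
      tensorGrading (tensorGrading X.grading Y.grading) Z.grading n) (by simp)
      (fun x y hx hy => by rw [TensorProduct.tmul_add, map_add]; exact add_mem hx hy)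
      (fun i j h' y hy z hz => ?_) hy
    exact tmul_mem_tensorGrading (p := p + i) (q := j) (by omega)
      (tmul_mem_tensorGrading rfl hx hy) hz
  map_d z := by
    obtain ⟨z, rfl⟩ := (TensorProduct.assoc R X.carrier Y.carrier Z.carrier).surjective z
    have h := (ChainMap.assoc X Y Z).map_d z
    simp only [ChainMap.assoc, LinearEquiv.coe_coe] at h
    simp [← h]

/-- The symmetry isomorphism of chain complexes. -/
noncomputable def ChainMap.swap : ChainMap (tensorCx X Y) (tensorCx Y X) where
  toLin := koszulSwap X.grading Y.grading
  map_mem n z hz := by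
    refine tensorGrading_induction (P := fun z => koszulSwap X.grading Y.grading z ∈
      tensorGrading Y.grading X.grading n) (by simp)
      (fun x y hx hy => by rw [map_add]; exact add_mem hx hy) (fun p q h x hx y hy => ?_) hz
    rw [koszulSwap_of_mem hx]
    exact tmul_mem_tensorGrading (by omega) (sign_pow_mem_grading p hy) hx
  map_d z := by
    have := tensor_hom_ext X.grading Y.grading
      (f := koszulSwap X.grading Y.grading ∘ₗ tensorD X Y)
      (g := tensorD Y X ∘ₗ koszulSwap X.grading Y.grading) fun p q x hx y hy => by
        simp only [LinearMap.comp_apply, tensorD_tmul, map_add, koszulSwap_of_mem hx,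
          koszulSwap_of_mem (sign_mem hx), koszulSwap_of_mem_lower (X.d_mem p x hx),
          sign_of_mem hx, sign_pow_anti Y.d_mem, TensorProduct.tmul_smul,
          ← TensorProduct.smul_tmul', map_smul, smul_smul, ← pow_add,
          (Even.add_self p).neg_one_pow, one_smul]
        rw [add_comm, pow_succ' (sign Y.grading), Module.End.mul_apply]
    exact LinearMap.congr_fun this z

end Complexes

/-! ### Graded bialgebras and interleaved powers -/

section GradedBialgebra

variable {R : Type u} [CommRing R] {A : Type v} [Ring A] [Algebra R A]
  (𝓐 : ℕ → Submodule R A) [GradedAlgebra 𝓐]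

/-- The multiplication `(a ⊗ b) (a' ⊗ b') = (-1) ^ (|b| |a'|) a a' ⊗ b b'` of the graded tensor
square of an algebra, as a bilinear map on the ordinary tensor square. -/
noncomputable def gradedMul : A ⊗[R] A →ₗ[R] A ⊗[R] A →ₗ[R] A ⊗[R] A :=
  ((LinearMap.mul R (𝓐 ᵍ⊗[R] 𝓐)).compl₁₂ (GradedTensorProduct.of R 𝓐 𝓐).toLinearMap
    (GradedTensorProduct.of R 𝓐 𝓐).toLinearMap).compr₂
      (GradedTensorProduct.of R 𝓐 𝓐).symm.toLinearMap

theorem gradedMul_apply (x y : A ⊗[R] A) : gradedMul 𝓐 x y =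
    (GradedTensorProduct.of R 𝓐 𝓐).symm
      (GradedTensorProduct.of R 𝓐 𝓐 x * GradedTensorProduct.of R 𝓐 𝓐 y) := rfl

variable {𝓐}

theorem gradedMul_tmul_tmul {p q : ℕ} (a : A) {b : A} (hb : b ∈ 𝓐 p) {a' : A} (ha' : a' ∈ 𝓐 q)
    (b' : A) : gradedMul 𝓐 (a ⊗ₜ b) (a' ⊗ₜ b') = (-1 : R) ^ (p * q) • ((a * a') ⊗ₜ (b * b')) := by
  have h := GradedTensorProduct.tmul_coe_mul_coe_tmul (R := R) 𝓐 𝓐 a ⟨b, hb⟩ ⟨a', ha'⟩ b'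
  rw [gradedMul_apply]
  refine (congrArg _ h).trans ?_
  rcases Nat.even_or_odd (p * q) with h | h <;> simp [h.neg_one_pow]

theorem gradedMul_left (a b : A) {q : ℕ} {a' : A} (ha' : a' ∈ 𝓐 q) (b' : A) :
    gradedMul 𝓐 (a ⊗ₜ b) (a' ⊗ₜ b') = (a * a') ⊗ₜ ((sign 𝓐 ^ q) b * b') := by
  refine homogeneous_induction 𝓐 (P := fun b => gradedMul 𝓐 (a ⊗ₜ b) (a' ⊗ₜ b') =
    (a * a') ⊗ₜ ((sign 𝓐 ^ q) b * b')) (fun x y hx hy => ?_) (fun p b hb => ?_) b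
  · simp only [TensorProduct.tmul_add, map_add, LinearMap.add_apply, hx, hy, add_mul]
  · rw [gradedMul_tmul_tmul a hb ha', sign_pow_mem q hb, smul_mul_assoc, TensorProduct.tmul_smul,
      mul_comm]

theorem gradedMul_right (a : A) {p : ℕ} {b : A} (hb : b ∈ 𝓐 p) (a' b' : A) :
    gradedMul 𝓐 (a ⊗ₜ b) (a' ⊗ₜ b') = (a * (sign 𝓐 ^ p) a') ⊗ₜ (b * b') := by
  refine homogeneous_induction 𝓐 (P := fun a' => gradedMul 𝓐 (a ⊗ₜ b) (a' ⊗ₜ b') =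
    (a * (sign 𝓐 ^ p) a') ⊗ₜ (b * b')) (fun x y hx hy => ?_) (fun q a' ha' => ?_) a'
  · simp only [TensorProduct.add_tmul, map_add, hx, hy, mul_add]
  · rw [gradedMul_tmul_tmul a hb ha', sign_pow_mem p ha', mul_smul_comm, TensorProduct.smul_tmul']

theorem gradedMul_tmul_left {p : ℕ} {a : A} (ha : a ∈ 𝓐 p) (b : A) (z : A ⊗[R] A) :
    gradedMul 𝓐 z (a ⊗ₜ b) = TensorProduct.map (LinearMap.mulRight R a)
      (LinearMap.mulRight R b ∘ₗ (sign 𝓐 ^ p)) z := by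
  induction z with
  | zero => simp
  | add x y hx hy => simp only [map_add, LinearMap.add_apply, hx, hy]
  | tmul x y => simp [gradedMul_left x y ha]

theorem gradedMul_tmul_right (a : A) {q : ℕ} {b : A} (hb : b ∈ 𝓐 q) (z : A ⊗[R] A) :
    gradedMul 𝓐 (a ⊗ₜ b) z = TensorProduct.map (LinearMap.mulLeft R a ∘ₗ (sign 𝓐 ^ q))
      (LinearMap.mulLeft R b) z := by
  induction z with
  | zero => simp
  | add x y hx hy => simp only [map_add, LinearMap.add_apply, hx, hy]
  | tmul x y => simp [gradedMul_right a hb]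

variable (𝓐) in
/-- The laws of a graded bialgebra with comultiplication `ψ` and counit `ε`: the comultiplication
has degree zero, is multiplicative for the Koszul-signed product of the tensor square, and is
coassociative and counital, and the counit vanishes in positive degrees. -/
structure IsGradedBialgebra (ψ : A →ₗ[R] A ⊗[R] A) (ε : A →ₐ[R] R) : Prop where
  comul_mem : ∀ n, ∀ x ∈ 𝓐 n, ψ x ∈ tensorGrading 𝓐 𝓐 n
  comul_one : ψ 1 = 1 ⊗ₜ 1
  comul_mul : ∀ x y, ψ (x * y) = gradedMul 𝓐 (ψ x) (ψ y)
  coassoc : ∀ x, TensorProduct.assoc R _ _ _ (LinearMap.rTensor _ ψ (ψ x)) =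
    LinearMap.lTensor _ ψ (ψ x)
  counit_left : ∀ x, TensorProduct.lid R _ (LinearMap.rTensor _ ε.toLinearMap (ψ x)) = x
  counit_right : ∀ x, TensorProduct.rid R _ (LinearMap.lTensor _ ε.toLinearMap (ψ x)) = x
  counit_of_pos : ∀ n, n ≠ 0 → ∀ x ∈ 𝓐 n, ε x = 0

/-- The convolution powers of the identity: `λ_0 = η ε` and `λ_(k+1) = μ (λ_k ⊗ id) ψ`. -/
noncomputable def convPower (ψ : A →ₗ[R] A ⊗[R] A) (ε : A →ₐ[R] R) : ℕ → A →ₗ[R] A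
  | 0 => Algebra.linearMap R A ∘ₗ ε.toLinearMap
  | k + 1 => LinearMap.mul' R A ∘ₗ TensorProduct.map (convPower ψ ε k) LinearMap.id ∘ₗ ψ

variable (𝓐) in
/-- The map `x ⊗ (h ⊗ h') ↦ (-1) ^ (|x| |h|) h · l (x h')`. -/
noncomputable def interleaveAux (l : A →ₗ[R] A) : A ⊗[R] (A ⊗[R] A) →ₗ[R] A :=
  LinearMap.mul' R A ∘ₗ TensorProduct.map LinearMap.id (l ∘ₗ LinearMap.mul' R A) ∘ₗ
    (TensorProduct.assoc R A A A).toLinearMap ∘ₗ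
    TensorProduct.map (koszulSwap 𝓐 𝓐) LinearMap.id ∘ₗ
    (TensorProduct.assoc R A A A).symm.toLinearMap

variable (𝓐) in
/-- The map `x ⊗ h ↦ ∑ (-1) ^ (|x| |h₁|) h₁ · l (x h₂)`, where `ψ h = ∑ h₁ ⊗ h₂`. For `l = λ_k` it
is the bilinear extension of `x ⊗ h ↦ h (x h) ^ k` from grouplike elements. -/
noncomputable def interleave (ψ : A →ₗ[R] A ⊗[R] A) (l : A →ₗ[R] A) : A ⊗[R] A →ₗ[R] A :=
  interleaveAux 𝓐 l ∘ₗ TensorProduct.map LinearMap.id ψ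

theorem interleaveAux_left (l : A →ₗ[R] A) {q : ℕ} {x : A} (hx : x ∈ 𝓐 q) (z : A ⊗[R] A) :
    interleaveAux 𝓐 l (x ⊗ₜ z) = LinearMap.mul' R A
      (TensorProduct.map (sign 𝓐 ^ q) (l ∘ₗ LinearMap.mulLeft R x) z) := by
  induction z with
  | zero => simp
  | add x y hx hy => simp only [map_add, TensorProduct.tmul_add, hx, hy]
  | tmul h h' => simp [interleaveAux, koszulSwap_of_mem hx]

theorem interleaveAux_right (l : A →ₗ[R] A) (x : A) {p : ℕ} {h : A} (hh : h ∈ 𝓐 p) (h' : A) :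
    interleaveAux 𝓐 l (x ⊗ₜ (h ⊗ₜ h')) = h * l ((sign 𝓐 ^ p) x * h') := by
  simp [interleaveAux, koszulSwap_of_mem_right x hh]

variable {ψ : A →ₗ[R] A ⊗[R] A} {ε : A →ₐ[R] R}

theorem interleave_of_mem (l : A →ₗ[R] A) {q : ℕ} {x : A} (hx : x ∈ 𝓐 q) (h : A) :
    interleave 𝓐 ψ l (x ⊗ₜ h) = LinearMap.mul' R A
      (TensorProduct.map (sign 𝓐 ^ q) (l ∘ₗ LinearMap.mulLeft R x) (ψ h)) := by
  simp [interleave, interleaveAux_left l hx]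

/-- If `ψ` is graded cocommutative, then `a₁ ⊗ G a₂` and `a₂ ⊗ G a₁` agree up to signs. -/
theorem koszulSwap_map_comul (hcomm : ∀ x, koszulSwap 𝓐 𝓐 (ψ x) = ψ x) {G : A →ₗ[R] A} {e : ℕ}
    (hG : ∀ n, ∀ x ∈ 𝓐 n, G x ∈ 𝓐 (n + e)) (a : A) :
    koszulSwap 𝓐 𝓐 (TensorProduct.map LinearMap.id G (ψ a)) =
      TensorProduct.map G (sign 𝓐 ^ e) (ψ a) := by
  have := tensor_hom_ext 𝓐 𝓐
    (f := koszulSwap 𝓐 𝓐 ∘ₗ TensorProduct.map LinearMap.id G ∘ₗ koszulSwap 𝓐 𝓐)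
    (g := TensorProduct.map G (sign 𝓐 ^ e)) fun p q x hx y hy => by
      simp only [LinearMap.comp_apply, koszulSwap_tmul hx hy, map_smul, TensorProduct.map_tmul,
        LinearMap.id_apply, koszulSwap_tmul hy (hG p x hx), smul_smul, sign_pow_mem e hy,
        TensorProduct.tmul_smul, ← pow_add]
      refine neg_one_pow_smul_eq ?_ _
      simp only [Nat.even_add, Nat.even_mul]; tauto
  have := LinearMap.congr_fun this (ψ a)
  simpa only [LinearMap.comp_apply, hcomm] using this

namespace IsGradedBialgebra

variable (H : IsGradedBialgebra 𝓐 ψ ε)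
include H

theorem counit_sign (x : A) : ε (sign 𝓐 x) = ε x := by
  refine homogeneous_induction 𝓐 (P := fun x => ε (sign 𝓐 x) = ε x)
    (fun x y hx hy => by simp only [map_add, hx, hy]) (fun n x hx => ?_) x
  rcases eq_or_ne n 0 with rfl | hn
  · simp [sign_of_mem hx]
  · simp [sign_of_mem hx, H.counit_of_pos n hn x hx]

theorem counit_sign_pow (k : ℕ) (x : A) : ε ((sign 𝓐 ^ k) x) = ε x := by
  induction k with
  | zero => simp
  | succ k ih => rw [pow_succ', Module.End.mul_apply, H.counit_sign, ih]

theorem comul_sign_pow (k : ℕ) (x : A) :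
    ψ ((sign 𝓐 ^ k) x) = TensorProduct.map (sign 𝓐 ^ k) (sign 𝓐 ^ k) (ψ x) := by
  rw [← sign_pow_map H.comul_mem, sign_pow_tmul]

theorem counit_left' {M : Type*} [AddCommGroup M] [Module R M] (f : A →ₗ[R] M) (x : A) :
    TensorProduct.lid R M (TensorProduct.map ε.toLinearMap f (ψ x)) = f x := by
  conv_rhs => rw [← H.counit_left x]
  induction ψ x with
  | zero => simp
  | add x y hx hy => simp only [map_add, hx, hy]
  | tmul x y => simp

theorem counit_right' {M : Type*} [AddCommGroup M] [Module R M] (f : A →ₗ[R] M) (x : A) :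
    TensorProduct.rid R M (TensorProduct.map f ε.toLinearMap (ψ x)) = f x := by
  conv_rhs => rw [← H.counit_right x]
  induction ψ x with
  | zero => simp
  | add x y hx hy => simp only [map_add, hx, hy]
  | tmul x y => simp

/-- The identity `(a g) ^ k a = a (g a) ^ k`, extended from grouplike elements to all of `A`. -/
theorem mul_convPower (k : ℕ) {q : ℕ} {g : A} (hg : g ∈ 𝓐 q) (a : A) :
    LinearMap.mul' R A (TensorProduct.map
      (convPower ψ ε k ∘ₗ LinearMap.mulRight R g ∘ₗ (sign 𝓐 ^ q)) LinearMap.id (ψ a)) =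
    LinearMap.mul' R A (TensorProduct.map (sign 𝓐 ^ q)
      (convPower ψ ε k ∘ₗ LinearMap.mulLeft R g) (ψ a)) := by
  induction k generalizing q g a with
  | zero =>
    have h₁ : LinearMap.mul' R A ∘ₗ TensorProduct.map
        (convPower ψ ε 0 ∘ₗ LinearMap.mulRight R g ∘ₗ (sign 𝓐 ^ q)) LinearMap.id =
        ε g • (TensorProduct.lid R A).toLinearMap ∘ₗ
          TensorProduct.map ε.toLinearMap LinearMap.id :=
      TensorProduct.ext' fun x y => by
        simp only [convPower, LinearMap.comp_apply, TensorProduct.map_tmul, LinearMap.mul'_apply,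
          AlgHom.toLinearMap_apply, LinearMap.mulRight_apply, map_mul, Algebra.linearMap_apply,
          LinearMap.smul_apply, LinearEquiv.coe_coe, TensorProduct.lid_tmul, smul_smul,
          H.counit_sign_pow, LinearMap.id_apply]
        rw [Algebra.smul_def, ← map_mul, mul_comm]
    have h₂ : LinearMap.mul' R A ∘ₗ TensorProduct.map (sign 𝓐 ^ q)
        (convPower ψ ε 0 ∘ₗ LinearMap.mulLeft R g) =
        ε g • (TensorProduct.rid R A).toLinearMap ∘ₗ
          TensorProduct.map (sign 𝓐 ^ q) ε.toLinearMap :=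
      TensorProduct.ext' fun x y => by
        simp only [convPower, LinearMap.comp_apply, TensorProduct.map_tmul, LinearMap.mul'_apply,
          AlgHom.toLinearMap_apply, LinearMap.mulLeft_apply, map_mul, Algebra.linearMap_apply,
          LinearMap.smul_apply, LinearEquiv.coe_coe, TensorProduct.rid_tmul, smul_smul]
        rw [← map_mul, ← Algebra.commutes, ← Algebra.smul_def, mul_comm]
    have h := LinearMap.congr_fun h₁ (ψ a)
    have h' := LinearMap.congr_fun h₂ (ψ a)
    simp only [LinearMap.comp_apply, LinearMap.smul_apply, LinearEquiv.coe_coe, H.counit_left',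
      H.counit_right', LinearMap.id_apply] at h h'
    rw [h, h']
    rcases eq_or_ne q 0 with rfl | hq
    · simp
    · simp [H.counit_of_pos q hq g hg]
  | succ k ih =>
    set l := convPower ψ ε k with hl
    have hR : convPower ψ ε (k + 1) ∘ₗ LinearMap.mulRight R g ∘ₗ (sign 𝓐 ^ q) =
        LinearMap.mul' R A ∘ₗ TensorProduct.map l LinearMap.id ∘ₗ (gradedMul 𝓐).flip (ψ g) ∘ₗ
          ψ ∘ₗ (sign 𝓐 ^ q) :=
      LinearMap.ext fun x => by simp [convPower, H.comul_mul, hl]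
    have hL : convPower ψ ε (k + 1) ∘ₗ LinearMap.mulLeft R g =
        LinearMap.mul' R A ∘ₗ TensorProduct.map l LinearMap.id ∘ₗ gradedMul 𝓐 (ψ g) ∘ₗ ψ :=
      LinearMap.ext fun x => by simp [convPower, H.comul_mul, hl]
    rw [hR, hL]
    refine tensorGrading_induction (P := fun z => LinearMap.mul' R A (TensorProduct.map
      (LinearMap.mul' R A ∘ₗ TensorProduct.map l LinearMap.id ∘ₗ (gradedMul 𝓐).flip z ∘ₗ
          ψ ∘ₗ (sign 𝓐 ^ q)) LinearMap.id (ψ a)) =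
        LinearMap.mul' R A (TensorProduct.map (sign 𝓐 ^ q) (LinearMap.mul' R A ∘ₗ
          TensorProduct.map l LinearMap.id ∘ₗ gradedMul 𝓐 z ∘ₗ ψ) (ψ a)))
      (by simp) (fun x y hx hy => ?_) (fun i j hij g₁ hg₁ g₂ hg₂ => ?_) (H.comul_mem q g hg)
    · simp only [map_add, LinearMap.add_comp, LinearMap.comp_add, TensorProduct.map_add_left,
        TensorProduct.map_add_right, LinearMap.add_apply, hx, hy]
    -- both sides are values of the trilinear map `T` on the iterated comultiplication of `a`
    let T : A ⊗[R] (A ⊗[R] A) →ₗ[R] A := LinearMap.mul' R A ∘ₗ TensorProduct.map (sign 𝓐 ^ q)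
      (LinearMap.mul' R A ∘ₗ TensorProduct.map (l ∘ₗ LinearMap.mulLeft R g₁ ∘ₗ (sign 𝓐 ^ j))
        (LinearMap.mulLeft R g₂))
    have hN : LinearMap.mul' R A ∘ₗ TensorProduct.map l LinearMap.id ∘ₗ
        (gradedMul 𝓐).flip (g₁ ⊗ₜ g₂) ∘ₗ ψ ∘ₗ (sign 𝓐 ^ q) =
        LinearMap.mulRight R g₂ ∘ₗ LinearMap.mul' R A ∘ₗ
          TensorProduct.map (sign 𝓐 ^ q) (l ∘ₗ LinearMap.mulLeft R g₁ ∘ₗ (sign 𝓐 ^ j)) ∘ₗ ψ :=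
      LinearMap.ext fun x => by
        have h := ih hg₁ ((sign 𝓐 ^ j) x)
        rw [H.comul_sign_pow] at h
        simp only [LinearMap.comp_apply, LinearMap.flip_apply, H.comul_sign_pow,
          gradedMul_tmul_left hg₁, LinearMap.mulRight_apply]
        have h₁ (z : A ⊗[R] A) : LinearMap.mul' R A (TensorProduct.map l LinearMap.id
            (TensorProduct.map (LinearMap.mulRight R g₁) (LinearMap.mulRight R g₂ ∘ₗ sign 𝓐 ^ i)
              (TensorProduct.map (sign 𝓐 ^ q) (sign 𝓐 ^ q) z))) =
            LinearMap.mul' R A (TensorProduct.map (l ∘ₗ LinearMap.mulRight R g₁ ∘ₗ sign 𝓐 ^ i)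
              LinearMap.id (TensorProduct.map (sign 𝓐 ^ j) (sign 𝓐 ^ j) z)) * g₂ := by
          induction z with
          | zero => simp
          | add x y hx hy => simp only [map_add, add_mul, hx, hy]
          | tmul x y => simp [← hij, sign_pow_add, sign_pow_sign_pow, mul_assoc]
        have h₂ (z : A ⊗[R] A) : TensorProduct.map (sign 𝓐 ^ i) (l ∘ₗ LinearMap.mulLeft R g₁)
            (TensorProduct.map (sign 𝓐 ^ j) (sign 𝓐 ^ j) z) = TensorProduct.map (sign 𝓐 ^ q)
              (l ∘ₗ LinearMap.mulLeft R g₁ ∘ₗ (sign 𝓐 ^ j)) z := by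
          induction z with
          | zero => simp
          | add x y hx hy => simp only [map_add, hx, hy]
          | tmul x y => simp [← hij, sign_pow_add]
        rw [h₁, h, h₂]
    have hT := congrArg T (H.coassoc a)
    have hT₁ (z : A ⊗[R] A) : T (TensorProduct.assoc R _ _ _ (LinearMap.rTensor _ ψ z)) =
        LinearMap.mul' R A (TensorProduct.map (LinearMap.mulRight R g₂ ∘ₗ LinearMap.mul' R A ∘ₗ
          TensorProduct.map (sign 𝓐 ^ q) (l ∘ₗ LinearMap.mulLeft R g₁ ∘ₗ (sign 𝓐 ^ j)) ∘ₗ ψ)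
            LinearMap.id z) := by
      induction z with
      | zero => simp
      | add x y hx hy => simp only [map_add, hx, hy]
      | tmul x y =>
        simp only [LinearMap.rTensor_tmul, TensorProduct.map_tmul, LinearMap.comp_apply]
        induction ψ x with
        | zero => simp
        | add x y hx hy =>
          simp only [map_add, TensorProduct.add_tmul] at hx hy ⊢
          rw [hx, hy]
        | tmul x₁ x₂ => simp [T, mul_assoc]
    have hT₂ (z : A ⊗[R] A) : T (LinearMap.lTensor _ ψ z) =
        LinearMap.mul' R A (TensorProduct.map (sign 𝓐 ^ q) (LinearMap.mul' R A ∘ₗ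
          TensorProduct.map l LinearMap.id ∘ₗ gradedMul 𝓐 (g₁ ⊗ₜ g₂) ∘ₗ ψ) z) := by
      induction z with
      | zero => simp
      | add x y hx hy => simp only [map_add, hx, hy]
      | tmul x y =>
        simp only [LinearMap.lTensor_tmul, TensorProduct.map_tmul, LinearMap.comp_apply, T,
          gradedMul_tmul_right g₁ hg₂]
        rw [← LinearMap.comp_apply (TensorProduct.map l LinearMap.id), ← TensorProduct.map_comp]
        rfl
    rw [hN, ← hT₁, hT, hT₂]

theorem interleave_one (k : ℕ) (h : A) :
    interleave 𝓐 ψ (convPower ψ ε k) (1 ⊗ₜ h) = convPower ψ ε (k + 1) h := by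
  have h₁ := H.mul_convPower k (SetLike.one_mem_graded 𝓐) h
  rw [interleave_of_mem _ (SetLike.one_mem_graded 𝓐), ← h₁]
  simp [convPower, Module.End.one_eq_id]

/-- On grouplike elements: `b h (x b h) ^ k = b l (x b)` for `l y = h (y h) ^ k`. -/
theorem interleave_mul_left (l : A →ₗ[R] A) (x b h : A) : interleave 𝓐 ψ l (x ⊗ₜ (b * h)) =
    interleaveAux 𝓐 (interleave 𝓐 ψ l ∘ₗ (TensorProduct.mk R A A).flip h) (x ⊗ₜ ψ b) := by
  have key := tensor_hom_ext 𝓐 𝓐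
    (f := interleaveAux 𝓐 l ∘ₗ TensorProduct.mk R _ _ x ∘ₗ (gradedMul 𝓐).flip (ψ h))
    (g := interleaveAux 𝓐 (interleave 𝓐 ψ l ∘ₗ (TensorProduct.mk R A A).flip h) ∘ₗ
      TensorProduct.mk R _ _ x) fun i j b₁ hb₁ b₂ hb₂ => by
      have key' := tensor_hom_ext 𝓐 𝓐
        (f := interleaveAux 𝓐 l ∘ₗ TensorProduct.mk R _ _ x ∘ₗ gradedMul 𝓐 (b₁ ⊗ₜ b₂))
        (g := LinearMap.mulLeft R b₁ ∘ₗ interleaveAux 𝓐 l ∘ₗ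
          TensorProduct.mk R _ _ ((sign 𝓐 ^ i) x * b₂)) fun m n h₁ hh₁ h₂ hh₂ => by
          simp only [LinearMap.comp_apply, TensorProduct.mk_apply, gradedMul_tmul_right b₁ hb₂,
            TensorProduct.map_tmul, LinearMap.mulLeft_apply, interleaveAux_right l _ hh₁]
          rw [interleaveAux_right l x
            (SetLike.mul_mem_graded hb₁ (sign_pow_mem_grading j hh₁)), sign_pow_mul,
            sign_pow_mem m hb₂, sign_pow_mem j hh₁, add_comm i m, sign_pow_add, mul_comm m j]
          simp [mul_assoc]
      have := LinearMap.congr_fun key' (ψ h)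
      simp only [LinearMap.comp_apply, TensorProduct.mk_apply, LinearMap.flip_apply,
        LinearMap.mulLeft_apply, interleaveAux_right _ _ hb₁] at this ⊢
      rw [this]
      simp [interleave]
  have := LinearMap.congr_fun key (ψ b)
  simpa [interleave, H.comul_mul] using this

/-- On grouplike elements: `h a (x h a) ^ k = h (a x h) ^ k a`. -/
theorem interleave_mul_right (k : ℕ) {p q : ℕ} {x h : A} (hx : x ∈ 𝓐 p) (hh : h ∈ 𝓐 q) (a : A) :
    interleave 𝓐 ψ (convPower ψ ε k) (x ⊗ₜ (h * a)) =
      LinearMap.mul' R A (TensorProduct.map (interleave 𝓐 ψ (convPower ψ ε k) ∘ₗ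
        (TensorProduct.mk R A A).flip h ∘ₗ LinearMap.mulRight R x ∘ₗ (sign 𝓐 ^ (p + q)))
          LinearMap.id (ψ a)) := by
  set l := convPower ψ ε k with hl
  have hF : interleave 𝓐 ψ l ∘ₗ (TensorProduct.mk R A A).flip h ∘ₗ LinearMap.mulRight R x ∘ₗ
      (sign 𝓐 ^ (p + q)) = interleaveAux 𝓐 l ∘ₗ (TensorProduct.mk R A _).flip (ψ h) ∘ₗ
        LinearMap.mulRight R x ∘ₗ (sign 𝓐 ^ (p + q)) :=
    LinearMap.ext fun y => by simp [interleave]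
  rw [H.interleave_mul_left, hF]
  refine tensorGrading_induction (P := fun z => interleaveAux 𝓐 (interleave 𝓐 ψ l ∘ₗ
      (TensorProduct.mk R A A).flip a) (x ⊗ₜ z) =
      LinearMap.mul' R A (TensorProduct.map (interleaveAux 𝓐 l ∘ₗ
        (TensorProduct.mk R A _).flip z ∘ₗ LinearMap.mulRight R x ∘ₗ (sign 𝓐 ^ (p + q)))
          LinearMap.id (ψ a)))
    (by simp) (fun x y hx hy => ?_) (fun i j hij h₁ hh₁ h₂ hh₂ => ?_) (H.comul_mem q h hh)
  · simp only [map_add, LinearMap.add_comp, LinearMap.comp_add, TensorProduct.map_add_left,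
      TensorProduct.tmul_add, LinearMap.add_apply, hx, hy]
  have hm := SetLike.mul_mem_graded hx hh₂
  rw [interleaveAux_left _ hx]
  simp only [TensorProduct.map_tmul, LinearMap.mul'_apply, LinearMap.comp_apply,
    LinearMap.mulLeft_apply, LinearMap.flip_apply, TensorProduct.mk_apply]
  rw [interleave_of_mem l hm, hl, ← H.mul_convPower k hm, ← hl]
  induction ψ a with
  | zero => simp
  | add x y hx hy => simp only [map_add, mul_add, hx, hy]
  | tmul x₁ x₂ =>
    simp only [TensorProduct.map_tmul, LinearMap.mul'_apply, LinearMap.comp_apply,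
      LinearMap.mulRight_apply, LinearMap.flip_apply, TensorProduct.mk_apply, LinearMap.id_apply,
      interleaveAux_right l _ hh₁, sign_pow_mul, sign_pow_mem i hx, sign_pow_mem p hh₁]
    rw [← sign_pow_add, sign_pow_congr (k := i + (p + q)) (l := p + j), mul_comm p i]
    · simp [mul_assoc]
    · rw [← hij]; simp only [Nat.even_add]; tauto

theorem counit_convPower (k : ℕ) (x : A) : ε (convPower ψ ε k x) = ε x := by
  induction k generalizing x with
  | zero => simp [convPower]
  | succ k ih =>
    conv_rhs => rw [← H.counit_left x]
    simp only [convPower, LinearMap.comp_apply]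
    induction ψ x with
    | zero => simp
    | add x y hx hy => simp only [map_add, hx, hy]
    | tmul x y => simp [ih]

theorem counit_interleave {l : A →ₗ[R] A} (hl : ∀ x, ε (l x) = ε x) (x h : A) :
    ε (interleave 𝓐 ψ l (x ⊗ₜ h)) = ε x * ε h := by
  have := tensor_hom_ext 𝓐 𝓐
    (f := ε.toLinearMap ∘ₗ interleaveAux 𝓐 l ∘ₗ TensorProduct.mk R A _ x)
    (g := ε x • ε.toLinearMap ∘ₗ (TensorProduct.lid R A).toLinearMap ∘ₗ
      LinearMap.rTensor _ ε.toLinearMap) fun p q y hy z hz => by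
      simp only [LinearMap.comp_apply, TensorProduct.mk_apply, interleaveAux_right l x hy]
      simp [hl, H.counit_sign_pow]
      ring
  have := LinearMap.congr_fun this (ψ h)
  simpa [interleave, H.counit_left] using this

end IsGradedBialgebra

end GradedBialgebra

/-! ### Powers of cyclic one-forms -/

section CyclicPower

variable {R : Type u} [CommRing R] {A : Type v} [Ring A] [Algebra R A]
  {𝓐 : ℕ → Submodule R A} [GradedAlgebra 𝓐] {ψ : A →ₗ[R] A ⊗[R] A} {ε : A →ₐ[R] R}

variable (𝓐) in
/-- The map `a ⊗ h ↦ ∑ a₁ ⊗ interleave (a₂ ⊗ h)`. For `l = λ_k` it is the bilinear extension of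
`a ⊗ h ↦ a ⊗ h (a h) ^ k` from grouplike elements. -/
noncomputable def formPower (ψ : A →ₗ[R] A ⊗[R] A) (l : A →ₗ[R] A) : A ⊗[R] A →ₗ[R] A ⊗[R] A :=
  TensorProduct.map LinearMap.id (interleave 𝓐 ψ l) ∘ₗ
    (TensorProduct.assoc R A A A).toLinearMap ∘ₗ TensorProduct.map ψ LinearMap.id

theorem formPower_tmul (l : A →ₗ[R] A) (a h : A) : formPower 𝓐 ψ l (a ⊗ₜ h) =
    TensorProduct.map LinearMap.id (interleave 𝓐 ψ l ∘ₗ (TensorProduct.mk R A A).flip h) (ψ a) := by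
  simp only [formPower, LinearMap.comp_apply, TensorProduct.map_tmul, LinearMap.id_apply,
    LinearEquiv.coe_coe]
  induction ψ a with
  | zero => simp
  | add x y hx hy => simp only [TensorProduct.add_tmul, map_add, hx, hy]
  | tmul x y => simp

/-- A pairing `κ a h = Da · h` of degree one that satisfies the cyclic Leibniz rule
`D (a b) · h = Da · b h ± Db · h a`. The sign is written with the sign involution of the target. -/
structure IsCyclicForm {E : Type w} [AddCommGroup E] [Module R E] (𝓐 : ℕ → Submodule R A)
    (𝓔 : ℕ → Submodule R E) [DirectSum.Decomposition 𝓔] (κ : A →ₗ[R] A →ₗ[R] E) : Prop where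
  mem : ∀ p q, ∀ a ∈ 𝓐 p, ∀ h ∈ 𝓐 q, κ a h ∈ 𝓔 (p + q + 1)
  mul : ∀ n, ∀ a ∈ 𝓐 n, ∀ b h, κ (a * b) h = κ a (b * h) + (sign 𝓔 ^ n) (κ b (h * a))

namespace IsCyclicForm

variable {E : Type w} [AddCommGroup E] [Module R E] {𝓔 : ℕ → Submodule R E}
  [DirectSum.Decomposition 𝓔] {κ : A →ₗ[R] A →ₗ[R] E} (K : IsCyclicForm 𝓐 𝓔 κ)
include K

theorem sign_pow (k : ℕ) (a h : A) :
    (sign 𝓔 ^ k) (κ a h) = (-1 : R) ^ k • κ ((sign 𝓐 ^ k) a) ((sign 𝓐 ^ k) h) := by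
  have hdeg : ∀ n, ∀ z ∈ tensorGrading 𝓐 𝓐 n, TensorProduct.lift κ z ∈ 𝓔 (n + 1) :=
    fun n z hz => tensorGrading_induction (P := fun z => TensorProduct.lift κ z ∈ 𝓔 (n + 1))
      (by simp) (fun x y hx hy => by rw [map_add]; exact add_mem hx hy)
      (fun p q hpq a ha h hh => by subst hpq; simpa using K.mem p q a ha h hh) hz
  simpa [sign_pow_tmul] using sign_pow_map_of_degree hdeg k (a ⊗ₜ h)

/-- The cyclic rotation of the factor `a` in a form `Db · y a`. -/
theorem sign_pow_mul {i l : ℕ} {b a : A} (hb : b ∈ 𝓐 i) (ha : a ∈ 𝓐 l) (y : A) :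
    (sign 𝓔 ^ l) (κ b (y * a)) =
      κ b (LinearMap.mul' R _ (koszulSwap 𝓐 𝓐 ((sign 𝓐 ^ i) a ⊗ₜ y))) := by
  rw [K.sign_pow, koszulSwap_of_mem (sign_pow_mem_grading i ha), LinearMap.mul'_apply,
    sign_pow_mem l hb, CoHochschild.sign_pow_mul 𝓐, sign_pow_mem l ha, sign_pow_mem i ha,
    mul_smul_comm, mul_smul_comm, map_smul, map_smul, map_smul, LinearMap.smul_apply, smul_smul,
    smul_smul, ← pow_add, ← pow_add]
  refine neg_one_pow_smul_eq ?_ _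
  simp only [Nat.even_add, Nat.even_mul]; tauto

end IsCyclicForm

namespace IsGradedBialgebra

variable (H : IsGradedBialgebra 𝓐 ψ ε)
include H

theorem convPower_mem (k n : ℕ) (x : A) (hx : x ∈ 𝓐 n) : convPower ψ ε k x ∈ 𝓐 n := by
  induction k generalizing n x with
  | zero =>
    rcases eq_or_ne n 0 with rfl | hn
    · exact SetLike.algebraMap_mem_graded _ _
    · simp [convPower, H.counit_of_pos n hn x hx]
  | succ k ih =>
    refine tensorGrading_induction (P := fun z => LinearMap.mul' R A
      (TensorProduct.map (convPower ψ ε k) LinearMap.id z) ∈ 𝓐 n) (by simp)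
      (fun x y hx hy => by simp only [map_add]; exact add_mem hx hy)
      (fun p q hpq a ha b hb => ?_) (H.comul_mem n x hx)
    subst hpq
    exact SetLike.mul_mem_graded (ih p a ha) hb

theorem interleave_mem (k : ℕ) {p q : ℕ} {x h : A} (hx : x ∈ 𝓐 p) (hh : h ∈ 𝓐 q) :
    interleave 𝓐 ψ (convPower ψ ε k) (x ⊗ₜ h) ∈ 𝓐 (p + q) := by
  rw [interleave_of_mem _ hx]
  refine tensorGrading_induction (P := fun z => LinearMap.mul' R A (TensorProduct.map (sign 𝓐 ^ p)
    (convPower ψ ε k ∘ₗ LinearMap.mulLeft R x) z) ∈ 𝓐 (p + q)) (by simp)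
    (fun x y hx hy => by simp only [map_add]; exact add_mem hx hy)
    (fun i j hij a ha b hb => ?_) (H.comul_mem q h hh)
  have := SetLike.mul_mem_graded (sign_pow_mem_grading p ha)
    (H.convPower_mem k _ _ (SetLike.mul_mem_graded hx hb))
  rwa [show i + (p + j) = p + q by omega] at this

/-- On grouplike elements: `a h (a h) ^ k = (a h) ^ (k + 1)`. -/
theorem mul_formPower (k : ℕ) (z : A ⊗[R] A) :
    LinearMap.mul' R _ (formPower 𝓐 ψ (convPower ψ ε k) z) =
      convPower ψ ε (k + 1) (LinearMap.mul' R _ z) := by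
  induction z with
  | zero => simp
  | add x y hx hy => simp only [map_add, hx, hy]
  | tmul a h =>
    have h₁ := H.interleave_one k (a * h)
    rw [H.interleave_mul_left, interleaveAux_left _ (SetLike.one_mem_graded 𝓐)] at h₁
    rw [LinearMap.mul'_apply, ← h₁, formPower_tmul]
    simp [Module.End.one_eq_id]

/-- On grouplike elements: `h (a h) ^ k a = (h a) ^ (k + 1)`. -/
theorem mul_koszulSwap_formPower (hcomm : ∀ x, koszulSwap 𝓐 𝓐 (ψ x) = ψ x) (k : ℕ)
    (z : A ⊗[R] A) :
    LinearMap.mul' R _ (koszulSwap 𝓐 𝓐 (formPower 𝓐 ψ (convPower ψ ε k) z)) =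
      convPower ψ ε (k + 1) (LinearMap.mul' R _ (koszulSwap 𝓐 𝓐 z)) := by
  have := tensor_hom_ext 𝓐 𝓐
    (f := LinearMap.mul' R _ ∘ₗ koszulSwap 𝓐 𝓐 ∘ₗ formPower 𝓐 ψ (convPower ψ ε k))
    (g := convPower ψ ε (k + 1) ∘ₗ LinearMap.mul' R _ ∘ₗ koszulSwap 𝓐 𝓐) fun p q a ha h hh => by
      have h₁ := H.interleave_one k (h * (sign 𝓐 ^ q) a)
      rw [H.interleave_mul_right k (SetLike.one_mem_graded 𝓐) hh, H.comul_sign_pow] at h₁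
      have h₂ := koszulSwap_map_comul hcomm (G := interleave 𝓐 ψ (convPower ψ ε k) ∘ₗ
        (TensorProduct.mk R _ _).flip h) (e := q) (fun n x hx => H.interleave_mem k hx hh) a
      simp only [LinearMap.comp_apply, koszulSwap_of_mem_right a hh, LinearMap.mul'_apply, ← h₁]
      rw [formPower_tmul, h₂]
      generalize ψ a = y
      induction y with
      | zero => simp
      | add x y hx hy => simp only [map_add, hx, hy]
      | tmul x y => simp [sign_pow_sign_pow]
  exact LinearMap.congr_fun this z

/-- The assignment `Da · h ↦ Da · h (a h) ^ k` is compatible with the cyclic Leibniz rule: on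
grouplike elements, `D (a b) · h (a b h) ^ k` is the sum of `Da · b h (a b h) ^ k` and
`Db · h (a b h) ^ k a = Db · h a (b h a) ^ k`. -/
theorem cyclicForm_formPower_mul (hcomm : ∀ x, koszulSwap 𝓐 𝓐 (ψ x) = ψ x)
    {E : Type w} [AddCommGroup E] [Module R E] {𝓔 : ℕ → Submodule R E}
    [DirectSum.Decomposition 𝓔] {κ : A →ₗ[R] A →ₗ[R] E} (K : IsCyclicForm 𝓐 𝓔 κ)
    (k : ℕ) {n m q : ℕ} {a b h : A} (ha : a ∈ 𝓐 n) (hb : b ∈ 𝓐 m) (hh : h ∈ 𝓐 q) :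
    TensorProduct.lift κ (formPower 𝓐 ψ (convPower ψ ε k) ((a * b) ⊗ₜ h)) =
      TensorProduct.lift κ (formPower 𝓐 ψ (convPower ψ ε k) (a ⊗ₜ (b * h))) +
      (sign 𝓔 ^ n)
        (TensorProduct.lift κ (formPower 𝓐 ψ (convPower ψ ε k) (b ⊗ₜ (h * a)))) := by
  set F := interleave 𝓐 ψ (convPower ψ ε k) with hF
  have hab : F ∘ₗ (TensorProduct.mk R _ _).flip (b * h) =
      interleaveAux 𝓐 (F ∘ₗ (TensorProduct.mk R _ _).flip h) ∘ₗ
        (TensorProduct.mk R _ _).flip (ψ b) :=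
    LinearMap.ext fun x => H.interleave_mul_left _ x b h
  rw [formPower_tmul, formPower_tmul, formPower_tmul, H.comul_mul, ← hF, hab]
  refine tensorGrading_induction (P := fun z =>
    TensorProduct.lift κ (TensorProduct.map LinearMap.id (F ∘ₗ (TensorProduct.mk R _ _).flip h)
      (gradedMul 𝓐 (ψ a) z)) =
    TensorProduct.lift κ (TensorProduct.map LinearMap.id
      (interleaveAux 𝓐 (F ∘ₗ (TensorProduct.mk R _ _).flip h) ∘ₗ
        (TensorProduct.mk R _ _).flip z) (ψ a)) +
      (sign 𝓔 ^ n) (TensorProduct.lift κ (TensorProduct.map LinearMap.id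
        (F ∘ₗ (TensorProduct.mk R _ _).flip (h * a)) z)))
    (by simp) (fun x y hx hy => ?_) (fun i j hij b₁ hb₁ b₂ hb₂ => ?_) (H.comul_mem m b hb)
  · simp only [map_add, LinearMap.comp_add, TensorProduct.map_add_right, LinearMap.add_apply, hx,
      hy]
    abel
  set G := F ∘ₗ (TensorProduct.mk R _ _).flip h ∘ₗ LinearMap.mulRight R b₂ with hG
  -- the Leibniz rule for the products `a₁ b₁`
  have key := tensor_hom_ext 𝓐 𝓐
    (f := TensorProduct.lift κ ∘ₗ TensorProduct.map LinearMap.id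
      (F ∘ₗ (TensorProduct.mk R _ _).flip h) ∘ₗ (gradedMul 𝓐).flip (b₁ ⊗ₜ b₂))
    (g := TensorProduct.lift κ ∘ₗ TensorProduct.map LinearMap.id
        (interleaveAux 𝓐 (F ∘ₗ (TensorProduct.mk R _ _).flip h) ∘ₗ
          (TensorProduct.mk R _ _).flip (b₁ ⊗ₜ b₂)) +
      κ b₁ ∘ₗ LinearMap.mul' R _ ∘ₗ koszulSwap 𝓐 𝓐 ∘ₗ
        TensorProduct.map LinearMap.id G ∘ₗ TensorProduct.map (sign 𝓐 ^ i) (sign 𝓐 ^ i))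
    fun l l' a₁ ha₁ a₂ ha₂ => by
      simp only [LinearMap.comp_apply, LinearMap.flip_apply, gradedMul_tmul_left hb₁,
        LinearMap.add_apply, TensorProduct.map_tmul, LinearMap.mulRight_apply,
        TensorProduct.lift.tmul, LinearMap.id_apply, TensorProduct.mk_apply,
        interleaveAux_right _ _ hb₁, hG, K.mul l _ ha₁, K.sign_pow_mul hb₁ ha₁]
  have key' := LinearMap.congr_fun key (ψ a)
  -- cocommutativity moves `a₁` behind the powers, and `interleave_mul_right` collects them
  have hsw := koszulSwap_map_comul hcomm (G := G) (e := j + q)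
    (fun n x hx => by
      have := H.interleave_mem k (SetLike.mul_mem_graded hx hb₂) hh
      rwa [add_assoc] at this) ((sign 𝓐 ^ i) a)
  have hr := H.interleave_mul_right k hb₂ hh ((sign 𝓐 ^ (j + q)) ((sign 𝓐 ^ i) a))
  have hz (z : A ⊗[R] A) : LinearMap.mul' R _ (TensorProduct.map G (sign 𝓐 ^ (j + q)) z) =
      LinearMap.mul' R _ (TensorProduct.map (F ∘ₗ (TensorProduct.mk R _ _).flip h ∘ₗ
        LinearMap.mulRight R b₂ ∘ₗ sign 𝓐 ^ (j + q)) LinearMap.id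
          (TensorProduct.map (sign 𝓐 ^ (j + q)) (sign 𝓐 ^ (j + q)) z)) := by
    induction z with
    | zero => simp
    | add x y hx hy => simp only [map_add, hx, hy]
    | tmul x y => simp [hG, sign_pow_sign_pow]
  rw [H.comul_sign_pow (j + q), ← hF, ← hz, ← hsw, H.comul_sign_pow i] at hr
  simp only [LinearMap.comp_apply, LinearMap.flip_apply, LinearMap.add_apply] at key'
  rw [key', ← hr]
  congr 1
  have hmem := H.interleave_mem k hb₂ (SetLike.mul_mem_graded hh ha)
  rw [← hF] at hmem
  simp only [TensorProduct.map_tmul, TensorProduct.lift.tmul, LinearMap.comp_apply,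
    LinearMap.flip_apply, TensorProduct.mk_apply, LinearMap.id_apply]
  rw [sign_pow_mem n (K.mem _ _ _ hb₁ _ hmem), ← sign_pow_add, sign_pow_mem _ ha, mul_smul_comm,
    TensorProduct.tmul_smul, map_smul, map_smul]
  refine neg_one_pow_smul_eq ?_ _
  simp only [Nat.even_add, Nat.even_mul, Nat.not_even_one]; tauto

end IsGradedBialgebra

end CyclicPower

/-! ### Cyclic one-forms on the cobar construction -/

section CyclicForm

variable {R : Type u} [CommRing R] {C : ChainCoalgebra.{u, v} R}

theorem eq_counit_smul_unit {x : C.carrier} (hx : x ∈ C.grading 0) :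
    x = Coalgebra.counit (R := R) x • C.unit := by
  rw [C.connected] at hx
  obtain ⟨r, rfl⟩ := Submodule.mem_span_singleton.1 hx
  rw [map_smul, C.unit_isGroupLike.counit_eq_one, smul_eq_mul, mul_one]

/-- Induction on the word length for homogeneous elements of the cobar construction. -/
theorem cobarGrading_induction {P : ℕ → Cobar C → Prop} (one : P 0 1)
    (mul : ∀ n, ∀ x ∈ C.grading (n + 1), ∀ m, ∀ b ∈ cobarGrading C m, P m b →
      P (n + m) (univTwist C x * b))
    (zero : ∀ n, P n 0) (add : ∀ n a b, P n a → P n b → P n (a + b))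
    (smul : ∀ n (r : R) a, P n a → P n (r • a)) {n : ℕ} {a : Cobar C} (ha : a ∈ cobarGrading C n) :
    P n a := by
  induction ha using Submodule.span_induction with
  | mem x h =>
    obtain ⟨l, rfl, rfl⟩ := h
    induction l with
    | nil => simpa using one
    | cons p l ih =>
      simp only [List.map_cons, List.prod_cons, List.sum_cons]
      exact mul p.1 p.2 p.2.2 _ _ (prod_mem_cobarGrading l) ih
  | zero => exact zero n
  | add x y _ _ hx hy => exact add n x y hx hy
  | smul r x _ hx => exact smul n r x hx

/-- Induction on the word length in the cobar construction, along homogeneous words. -/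
theorem cobar_induction {P : Cobar C → Prop} (one : P 1)
    (mul : ∀ n, ∀ x ∈ C.grading (n + 1), ∀ m, ∀ b ∈ cobarGrading C m, P b → P (univTwist C x * b))
    (add : ∀ a b, P a → P b → P (a + b)) (smul : ∀ (r : R) a, P a → P (r • a)) (a : Cobar C) :
    P a :=
  homogeneous_induction (cobarGrading C) (P := P) add (fun _ _ ha =>
    cobarGrading_induction (P := fun _ a => P a) one mul (fun _ => by simpa using smul 0 1 one)
      (fun _ => add) (fun _ => smul) ha) a

variable (C) in
/-- The operator `(b, φ) ↦ (t x · b, h ↦ x ⊗ b h ± φ (h · t x))` for `x` of degree `n + 1`; the sign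
is written with the sign involution of `C ⊗ Ω C`. -/
noncomputable def cyclicOpGen (n : ℕ) : C.grading (n + 1) →ₗ[R]
    Module.End R (Cobar C × (Cobar C →ₗ[R] C.carrier ⊗[R] Cobar C)) :=
  LinearMap.mk₂ R (fun x p => (univTwist C x * p.1,
      TensorProduct.mk R C.carrier (Cobar C) x ∘ₗ LinearMap.mulLeft R p.1 +
        (sign (tensorGrading C.grading (cobarGrading C)) ^ n) ∘ₗ p.2 ∘ₗ
          LinearMap.mulRight R (univTwist C x)))
    (fun x y p => Prod.ext (by simp [add_mul]) (LinearMap.ext fun h => by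
      simp [TensorProduct.add_tmul, mul_add]; abel))
    (fun r x p => Prod.ext (by simp) (LinearMap.ext fun h => by simp [TensorProduct.smul_tmul']))
    (fun x p q => Prod.ext (by simp [mul_add]) (LinearMap.ext fun h => by
      simp [TensorProduct.tmul_add, add_mul]; abel))
    (fun r x p => Prod.ext (by simp) (LinearMap.ext fun h => by simp))

variable (C) in
/-- The action of `Ω C` on `Ω C × Hom (Ω C, C ⊗ Ω C)` that extends `cyclicOpGen`. -/
noncomputable def cyclicOp : Cobar C →ₐ[R]
    Module.End R (Cobar C × (Cobar C →ₗ[R] C.carrier ⊗[R] Cobar C)) :=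
  TensorAlgebra.lift R (DirectSum.toModule R ℕ _ (cyclicOpGen C))

variable (C) in
/-- The cyclic one-form `Da · h`. The coHochschild complex is the cone of a commutator map from the
cyclic one-forms of the tensor algebra `Ω C` to `Ω C`; under this identification, `c ⊗ h` is the
form `D (t c) · h` when `c` has positive degree. The Leibniz rule is `cyclicForm_mul`. -/
noncomputable def cyclicForm : Cobar C →ₗ[R] Cobar C →ₗ[R] C.carrier ⊗[R] Cobar C :=
  LinearMap.snd R _ _ ∘ₗ LinearMap.applyₗ (1, 0) ∘ₗ (cyclicOp C).toLinearMap

theorem cyclicForm_apply (a : Cobar C) : cyclicForm C a = (cyclicOp C a (1, 0)).2 := rfl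

theorem cyclicOp_univTwist {n : ℕ} {x : C.carrier} (hx : x ∈ C.grading (n + 1)) (p) :
    cyclicOp C (univTwist C x) p = (univTwist C x * p.1,
      TensorProduct.mk R C.carrier (Cobar C) x ∘ₗ LinearMap.mulLeft R p.1 +
        (sign (tensorGrading C.grading (cobarGrading C)) ^ n) ∘ₗ p.2 ∘ₗ
          LinearMap.mulRight R (univTwist C x)) := by
  have h : cyclicOp C (univTwist C x) = cyclicOpGen C n ⟨x, hx⟩ := by
    refine (congrArg _ (univTwist_coe (⟨x, hx⟩ : C.grading (n + 1)))).trans ?_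
    rw [cyclicOp, TensorAlgebra.lift_ι_apply, DirectSum.toModule_lof]
  rw [h]; rfl

theorem cyclicOp_fst (a : Cobar C) (p) : (cyclicOp C a p).1 = a * p.1 := by
  refine cobar_induction (P := fun a => ∀ p, (cyclicOp C a p).1 = a * p.1) (by simp)
    (fun n x hx m b _ ih p => ?_) (fun a b ha hb p => by simp [ha, hb, add_mul])
    (fun r a ha p => by simp [ha]) a p
  rw [map_mul, Module.End.mul_apply, cyclicOp_univTwist hx, ih, mul_assoc]

theorem cyclicOp_univTwist_mul_snd {n : ℕ} {x : C.carrier} (hx : x ∈ C.grading (n + 1))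
    (b : Cobar C) (p) (h : Cobar C) : (cyclicOp C (univTwist C x * b) p).2 h =
      x ⊗ₜ (b * p.1 * h) + (sign (tensorGrading C.grading (cobarGrading C)) ^ n)
        ((cyclicOp C b p).2 (h * univTwist C x)) := by
  have h₁ := cyclicOp_univTwist hx (cyclicOp C b p)
  rw [← Module.End.mul_apply, ← map_mul] at h₁
  rw [h₁, cyclicOp_fst]
  rfl

theorem cyclicOp_snd {n : ℕ} {a : Cobar C} (ha : a ∈ cobarGrading C n) (p) (h : Cobar C) :
    (cyclicOp C a p).2 h = cyclicForm C a (p.1 * h) +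
      (sign (tensorGrading C.grading (cobarGrading C)) ^ n) (p.2 (h * a)) := by
  refine cobarGrading_induction (P := fun n a => ∀ h, (cyclicOp C a p).2 h =
    cyclicForm C a (p.1 * h) +
      (sign (tensorGrading C.grading (cobarGrading C)) ^ n) (p.2 (h * a)))
    (fun h => by simp [cyclicForm_apply]) (fun n x hx m b _ ih h => ?_) (fun n h => by simp)
    (fun n a b ha hb h => ?_) (fun n r a ha h => ?_) ha h
  · rw [cyclicForm_apply, cyclicOp_univTwist_mul_snd hx, cyclicOp_univTwist_mul_snd hx, ih,
      ← cyclicForm_apply, map_add, sign_pow_add, mul_one, ← add_assoc]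
    simp only [mul_assoc]
  · simp only [map_add, mul_add, LinearMap.add_apply, Prod.snd_add, ha, hb]; abel
  · simp only [map_smul, LinearMap.smul_apply, Prod.smul_snd, ha, mul_smul_comm, smul_add]

/-- The Leibniz rule `D (a b) · h = Da · b h ± Db · h a`. -/
theorem cyclicForm_mul {n : ℕ} {a : Cobar C} (ha : a ∈ cobarGrading C n) (b h : Cobar C) :
    cyclicForm C (a * b) h = cyclicForm C a (b * h) +
      (sign (tensorGrading C.grading (cobarGrading C)) ^ n) (cyclicForm C b (h * a)) := by
  rw [cyclicForm_apply, map_mul, Module.End.mul_apply, cyclicOp_snd ha, cyclicOp_fst, mul_one]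
  rfl

theorem cyclicForm_mul_lower {n : ℕ} {a : Cobar C} (ha : a ∈ lower (cobarGrading C) n)
    (b h : Cobar C) : cyclicForm C (a * b) h = cyclicForm C a (b * h) +
      (sign (tensorGrading C.grading (cobarGrading C)) ^ (n + 1)) (cyclicForm C b (h * a)) := by
  cases n with
  | zero => have h0 : a = 0 := ha
            simp [h0]
  | succ n =>
    have ha' : a ∈ cobarGrading C n := ha
    rw [cyclicForm_mul ha', sign_pow_congr (k := n + 1 + 1) (l := n)]
    simp [Nat.even_add_one]

theorem cyclicForm_one (h : Cobar C) : cyclicForm C 1 h = 0 := by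
  simp [cyclicForm_apply]

theorem cyclicForm_univTwist_of_pos {n : ℕ} {x : C.carrier} (hx : x ∈ C.grading (n + 1))
    (h : Cobar C) : cyclicForm C (univTwist C x) h = x ⊗ₜ h := by
  rw [cyclicForm_apply, cyclicOp_univTwist hx]
  simp

theorem cyclicForm_univTwist (c : C.carrier) (h : Cobar C) : cyclicForm C (univTwist C c) h =
    (c - Coalgebra.counit (R := R) c • C.unit) ⊗ₜ h := by
  refine homogeneous_induction C.grading (P := fun c => cyclicForm C (univTwist C c) h =
    (c - Coalgebra.counit (R := R) c • C.unit) ⊗ₜ h) (fun x y hx hy => ?_) (fun n x hx => ?_) c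
  · simp only [map_add, LinearMap.add_apply, hx, hy, ← TensorProduct.add_tmul]
    congr 1; rw [add_smul]; abel
  · cases n with
    | zero => rw [← eq_counit_smul_unit hx, univTwist_of_zero hx]; simp
    | succ n => simp [cyclicForm_univTwist_of_pos hx, C.counit_of_pos n x hx]

theorem cyclicForm_mem {p q : ℕ} {a h : Cobar C} (ha : a ∈ cobarGrading C p)
    (hh : h ∈ cobarGrading C q) :
    cyclicForm C a h ∈ tensorGrading C.grading (cobarGrading C) (p + q + 1) := by
  refine cobarGrading_induction (P := fun p a => ∀ q, ∀ h ∈ cobarGrading C q,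
    cyclicForm C a h ∈ tensorGrading C.grading (cobarGrading C) (p + q + 1))
    (fun q h _ => by simp [cyclicForm_one]) (fun n x hx m b hb ih q h hh => ?_)
    (fun n q h _ => by simp) (fun n a b ha hb q h hh => ?_) (fun n r a ha q h hh => ?_) ha q h hh
  · rw [cyclicForm_mul (univTwist_mem hx), cyclicForm_univTwist_of_pos hx]
    refine add_mem (tmul_mem_tensorGrading (p := n + 1) (q := m + q) (by omega) hx
      (SetLike.mul_mem_graded hb hh)) (sign_pow_mem_grading _ ?_)
    have := ih _ _ (SetLike.mul_mem_graded hh (univTwist_mem hx))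
    rwa [show m + (q + n) + 1 = n + m + q + 1 by omega] at this
  · rw [map_add]; exact add_mem (ha q h hh) (hb q h hh)
  · rw [map_smul]; exact Submodule.smul_mem _ r (ha q h hh)

variable (C) in
theorem isCyclicForm_cyclicForm : IsCyclicForm (cobarGrading C)
    (tensorGrading C.grading (cobarGrading C)) (cyclicForm C) where
  mem _ _ _ ha _ hh := cyclicForm_mem ha hh
  mul _ _ ha b h := cyclicForm_mul ha b h

theorem sign_pow_unit_tmul (k : ℕ) (w : Cobar C) :
    (sign (tensorGrading C.grading (cobarGrading C)) ^ k) (C.unit ⊗ₜ w) =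
      C.unit ⊗ₜ (sign (cobarGrading C) ^ k) w := by
  simp [sign_pow_tmul, sign_pow_mem k C.unit_mem]

/-- The twisting terms of the coHochschild differential: up to contributions of the two counits,
they form the derivative of the quadratic part of the cobar differential. -/
theorem leftTerm_sub_rightTerm {n : ℕ} {z : C.carrier ⊗[R] C.carrier}
    (hz : z ∈ tensorGrading C.grading C.grading (n + 1)) (h : Cobar C) :
    leftTerm C C.grading (z ⊗ₜ h) - rightTerm C C.grading (z ⊗ₜ h) =
      cyclicForm C (twistMul C z) h + C.unit ⊗ₜ
        (univTwist C (TensorProduct.lid R _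
            (LinearMap.rTensor _ (Coalgebra.counit (R := R)) z)) * h -
          (sign (cobarGrading C) ^ n) h *
            univTwist C (TensorProduct.rid R _
              (LinearMap.lTensor _ (Coalgebra.counit (R := R)) z))) := by
  refine tensorGrading_induction (P := fun z => leftTerm C C.grading (z ⊗ₜ h) -
    rightTerm C C.grading (z ⊗ₜ h) = cyclicForm C (twistMul C z) h + C.unit ⊗ₜ
        (univTwist C (TensorProduct.lid R _
            (LinearMap.rTensor _ (Coalgebra.counit (R := R)) z)) * h -
          (sign (cobarGrading C) ^ n) h *
            univTwist C (TensorProduct.rid R _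
              (LinearMap.lTensor _ (Coalgebra.counit (R := R)) z))))
    (by simp) (fun x y hx hy => ?_) (fun i j hij x hx y hy => ?_) hz
  · simp only [TensorProduct.add_tmul, map_add, LinearMap.add_apply, add_mul, mul_add]
    rw [add_sub_add_comm, hx, hy, add_sub_add_comm (univTwist C _ * h), TensorProduct.tmul_add]
    abel
  simp only [leftTerm_tmul, rightTerm_tmul hx, twistMul, LinearMap.comp_apply,
    TensorProduct.map_tmul, LinearMap.mul'_apply, LinearMap.rTensor_tmul, LinearMap.lTensor_tmul,
    TensorProduct.lid_tmul, TensorProduct.rid_tmul, map_smul]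
  cases i with
  | zero =>
    simp only [sign_of_mem hx, univTwist_of_zero hx]
    conv_lhs => rw [eq_counit_smul_unit hx]
    simp [TensorProduct.smul_tmul', univTwist_of_zero hx]
  | succ k =>
    rw [cyclicForm_mul (univTwist_mem (sign_mem hx)), cyclicForm_univTwist_of_pos (sign_mem hx),
      C.counit_of_pos k x hx, cyclicForm_univTwist, sign_pow_tmul, sign_of_mem hx,
      sign_pow_congr (𝓜 := C.grading) (k := k + 1 + 1) (l := k) (by simp [Nat.even_add_one]),
      sign_pow_congr (𝓜 := cobarGrading C) (k := k + 1 + 1) (l := k) (by simp [Nat.even_add_one])]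
    have hs : (-1 : R) ^ (k + 1) * (-1 : R) ^ (k * k) = -1 := by
      rw [← pow_add, show k + 1 + k * k = k * (k + 1) + 1 by ring,
        (Nat.even_mul_succ_self k).add_one.neg_one_pow]
    have hc : Coalgebra.counit (R := R) y • C.unit ⊗ₜ[R]
          ((sign (cobarGrading C) ^ k) h * univTwist C x) =
        Coalgebra.counit (R := R) y • C.unit ⊗ₜ[R]
          ((sign (cobarGrading C) ^ n) h * univTwist C x) := by
      cases j with
      | zero => rw [show k = n by omega]
      | succ j => simp [C.counit_of_pos j y hy]
    simp only [TensorProduct.map_tmul, map_sub, map_smul, sign_pow_mul, mul_smul_comm,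
      sign_pow_mem k (univTwist_mem hx), smul_smul, hs, sign_pow_mem k C.unit_mem, mul_zero,
      pow_zero, one_smul, zero_smul, zero_mul, TensorProduct.sub_tmul, TensorProduct.tmul_smul,
      ← TensorProduct.smul_tmul', ← smul_mul_assoc, zero_sub, TensorProduct.tmul_neg, neg_smul,
      smul_mul_assoc, smul_neg]
    linear_combination (norm := module) hs • (-((sign C.grading ^ k) y ⊗ₜ[R]
      ((sign (cobarGrading C) ^ k) h * univTwist C x)) + Coalgebra.counit (R := R) y • C.unit ⊗ₜ[R]
        ((sign (cobarGrading C) ^ k) h * univTwist C x)) - hc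

theorem coHochD_cyclicForm_univTwist {n : ℕ} {x : C.carrier} (hx : x ∈ C.grading (n + 1))
    (h : Cobar C) : coHochD C (cyclicForm C (univTwist C x) h) =
      -cyclicForm C (cobarD C (univTwist C x)) h -
        cyclicForm C (sign (cobarGrading C) (univTwist C x)) (cobarD C h) -
        C.unit ⊗ₜ (univTwist C x * h - (sign (cobarGrading C) ^ n) h * univTwist C x) := by
  have h₁ := leftTerm_sub_rightTerm (C.comul_mem _ x hx) h
  rw [Coalgebra.rTensor_counit_comul, Coalgebra.lTensor_counit_comul, TensorProduct.lid_tmul,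
    TensorProduct.rid_tmul, one_smul, ← twistSq_eq] at h₁
  rw [cyclicForm_univTwist_of_pos hx, coHochD_tmul, tensorD_tmul, cobarD_univTwist, sign_univTwist,
    map_neg, LinearMap.neg_apply, cyclicForm_univTwist_of_pos (sign_mem hx), map_sub,
    LinearMap.sub_apply, cyclicForm_univTwist (C.d x), C.counit_d, zero_smul, sub_zero]
  rw [sub_eq_iff_eq_add] at h₁
  rw [h₁]
  abel

set_option maxHeartbeats 1000000 in
/-- The boundary formula for the forms `Da · h` and `Db · h` implies the one for `D (a b) · h`. -/
theorem coHochD_cyclicForm_mul {n m : ℕ} {a b : Cobar C} (ha : a ∈ cobarGrading C n)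
    (hb : b ∈ cobarGrading C m)
    (iha : ∀ h, coHochD C (cyclicForm C a h) = -cyclicForm C (cobarD C a) h -
      cyclicForm C (sign (cobarGrading C) a) (cobarD C h) -
      C.unit ⊗ₜ (a * h - (sign (cobarGrading C) ^ n) h * a))
    (ihb : ∀ h, coHochD C (cyclicForm C b h) = -cyclicForm C (cobarD C b) h -
      cyclicForm C (sign (cobarGrading C) b) (cobarD C h) -
      C.unit ⊗ₜ (b * h - (sign (cobarGrading C) ^ m) h * b)) (h : Cobar C) :
    coHochD C (cyclicForm C (a * b) h) = -cyclicForm C (cobarD C (a * b)) h -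
      cyclicForm C (sign (cobarGrading C) (a * b)) (cobarD C h) -
      C.unit ⊗ₜ (a * b * h - (sign (cobarGrading C) ^ (n + m)) h * (a * b)) := by
  have hda := cobarD_mem n _ ha
  have hsign : (-1 : R) ^ n * (-1 : R) ^ n = 1 := by rw [← mul_pow]; simp
  have e : coHochD C ((sign (tensorGrading C.grading (cobarGrading C)) ^ n)
      (cyclicForm C b (h * a))) = (-1 : R) ^ n •
        (sign (tensorGrading C.grading (cobarGrading C)) ^ n)
          (coHochD C (cyclicForm C b (h * a))) := by
    rw [sign_pow_anti coHochD_mem n, smul_smul, hsign, one_smul]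
  have f₁ : cyclicForm C (cobarD C (a * b)) h = cyclicForm C (cobarD C a) (b * h) +
      (sign (tensorGrading C.grading (cobarGrading C)) ^ (n + 1))
        (cyclicForm C b (h * cobarD C a)) +
      cyclicForm C (sign (cobarGrading C) a) (cobarD C b * h) +
      (-1 : R) ^ n • (sign (tensorGrading C.grading (cobarGrading C)) ^ n)
        (cyclicForm C (cobarD C b) (h * a)) := by
    rw [cobarD_mul, map_add, LinearMap.add_apply, cyclicForm_mul_lower hda,
      cyclicForm_mul (sign_mem ha), sign_of_mem ha, mul_smul_comm]
    simp only [map_smul, ← add_assoc]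
  have f₂ : cyclicForm C (sign (cobarGrading C) (a * b)) (cobarD C h) =
      cyclicForm C (sign (cobarGrading C) a) (sign (cobarGrading C) b * cobarD C h) +
      (-1 : R) ^ n • (sign (tensorGrading C.grading (cobarGrading C)) ^ n)
        (cyclicForm C (sign (cobarGrading C) b) (cobarD C h * a)) := by
    rw [sign_mul, cyclicForm_mul (sign_mem ha), sign_of_mem ha, mul_smul_comm]
    simp only [map_smul]
  have f₃ : (-1 : R) ^ n • (sign (tensorGrading C.grading (cobarGrading C)) ^ n)
      (cyclicForm C (sign (cobarGrading C) b) (sign (cobarGrading C) h * cobarD C a)) =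
      (sign (tensorGrading C.grading (cobarGrading C)) ^ (n + 1))
        (cyclicForm C b (h * cobarD C a)) := by
    have := (isCyclicForm_cyclicForm C).sign_pow 1 b (h * cobarD C a)
    rw [pow_one, pow_one, pow_one, sign_mul, sign_cobarD, sign_of_mem ha, map_smul, mul_neg,
      mul_smul_comm,
      map_neg, map_smul, neg_one_smul, neg_neg] at this
    rw [sign_pow_add n 1, pow_one, this, map_smul]
  have f₄ : (-1 : R) ^ n • (sign (tensorGrading C.grading (cobarGrading C)) ^ n)
      (C.unit ⊗ₜ[R] (b * (h * a))) = C.unit ⊗ₜ[R] ((sign (cobarGrading C) ^ n) (b * h) * a) := by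
    rw [sign_pow_unit_tmul, ← mul_assoc, sign_pow_mul (cobarGrading C) n (b * h) a,
      sign_pow_mem n ha, mul_smul_comm, TensorProduct.tmul_smul, smul_smul, ← pow_add,
      Even.neg_one_pow (by simp only [Nat.even_add, Nat.even_mul]; tauto), one_smul]
  have f₅ : (-1 : R) ^ n • (sign (tensorGrading C.grading (cobarGrading C)) ^ n)
      (C.unit ⊗ₜ[R] ((sign (cobarGrading C) ^ m) (h * a) * b)) =
      C.unit ⊗ₜ[R] ((sign (cobarGrading C) ^ (n + m)) h * (a * b)) := by
    rw [sign_pow_unit_tmul, sign_pow_mul (cobarGrading C) n, ← sign_pow_add,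
      sign_pow_mul (cobarGrading C) (n + m), sign_pow_mem (n + m) ha, sign_pow_mem n hb,
      mul_smul_comm, mul_smul_comm, smul_mul_assoc, TensorProduct.tmul_smul,
      TensorProduct.tmul_smul, smul_smul, smul_smul, ← pow_add, ← pow_add, mul_assoc,
      Even.neg_one_pow (by simp only [Nat.even_add, Nat.even_mul]; tauto), one_smul]
  rw [cyclicForm_mul ha, map_add, iha, e, ihb, f₁, f₂, cobarD_mul b h, cobarD_mul h a]
  simp only [map_sub, map_neg, map_add, smul_sub, smul_neg, smul_add, TensorProduct.tmul_sub,
    f₃, f₄, f₅, ← mul_assoc a b h]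
  abel

/-- The boundary of `Da · h` is, up to sign, the sum of the internal differential and the graded
commutator `1 ⊗ [a, h]`. -/
theorem coHochD_cyclicForm (a h : Cobar C) : coHochD C (cyclicForm C a h) =
    -cyclicForm C (cobarD C a) h - cyclicForm C (sign (cobarGrading C) a) (cobarD C h) -
      C.unit ⊗ₜ (a * h - LinearMap.mul' R _
        (koszulSwap (cobarGrading C) (cobarGrading C) (a ⊗ₜ h))) := by
  refine cobar_induction (P := fun a => ∀ h, coHochD C (cyclicForm C a h) =
    -cyclicForm C (cobarD C a) h - cyclicForm C (sign (cobarGrading C) a) (cobarD C h) -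
      C.unit ⊗ₜ (a * h - LinearMap.mul' R _
        (koszulSwap (cobarGrading C) (cobarGrading C) (a ⊗ₜ h))))
    (fun h => ?_) (fun n x hx m b hb ih h => ?_) (fun a b ha hb h => ?_) (fun r a ha h => ?_) a h
  · have h₁ : cobarD C 1 = 0 := by simpa using cobarD_algebraMap (C := C) 1
    have h₂ := SetLike.one_mem_graded (cobarGrading C)
    rw [koszulSwap_of_mem h₂, sign_of_mem h₂, h₁]
    simp [cyclicForm_one]
  · have hv := univTwist_mem hx
    simp only [koszulSwap_of_mem hb, LinearMap.mul'_apply] at ih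
    rw [koszulSwap_of_mem (SetLike.mul_mem_graded hv hb), LinearMap.mul'_apply]
    exact coHochD_cyclicForm_mul hv hb (coHochD_cyclicForm_univTwist hx) ih h
  · simp only [map_add, LinearMap.add_apply, ha, hb, add_mul, TensorProduct.add_tmul,
      TensorProduct.tmul_add, TensorProduct.tmul_sub]
    abel
  · simp only [map_smul, LinearMap.smul_apply, ha, smul_mul_assoc, ← TensorProduct.smul_tmul',
      TensorProduct.tmul_smul, ← smul_sub, ← smul_neg]

end CyclicForm

/-! ### The power map of the coHochschild complex -/

section Power

variable {R : Type u} [CommRing R]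

variable (C : ChainCoalgebra.{u, v} R) in
/-- The multiplication of the cobar construction as a chain map. -/
noncomputable def cobarMulChain : ChainMap (tensorCx (cobar C) (cobar C)) (cobar C) where
  toLin := LinearMap.mul' R (Cobar C)
  map_mem n z hz := by
    refine tensorGrading_induction (P := fun z => LinearMap.mul' R (Cobar C) z ∈ cobarGrading C n)
      (by simp) (fun x y hx hy => by rw [map_add]; exact add_mem hx hy)
      (fun p q h x hx y hy => ?_) hz
    subst h
    exact SetLike.mul_mem_graded hx hy
  map_d z := by
    refine TensorProduct.induction_on z (by simp) (fun x y => ?_)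
      (fun x y hx hy => by simp only [map_add, hx, hy])
    have h : tensorD (cobar C) (cobar C) (x ⊗ₜ y) = cobarD C x ⊗ₜ y +
      sign (cobarGrading C) x ⊗ₜ cobarD C y := rfl
    simp [h, cobarD_mul]

theorem coHochD_lift_cyclicForm {C : ChainCoalgebra.{u, v} R} (z : Cobar C ⊗[R] Cobar C) :
    coHochD C (TensorProduct.lift (cyclicForm C) z) =
      -TensorProduct.lift (cyclicForm C) (tensorD (cobar C) (cobar C) z) -
        C.unit ⊗ₜ (LinearMap.mul' R _ z - LinearMap.mul' R _
          (koszulSwap (cobarGrading C) (cobarGrading C) z)) := by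
  induction z with
  | zero => simp
  | add x y hx hy =>
    simp only [map_add, hx, hy, TensorProduct.tmul_add, TensorProduct.tmul_sub]
    abel
  | tmul a h =>
    have h' : tensorD (cobar C) (cobar C) (a ⊗ₜ h) = cobarD C a ⊗ₜ h +
      sign (cobarGrading C) a ⊗ₜ cobarD C h := rfl
    rw [h', map_add]
    simp only [TensorProduct.lift.tmul, coHochD_cyclicForm, LinearMap.mul'_apply]
    abel

/-- The coHochschild complex is spanned by `1 ⊗ Ω C` and the cyclic forms `D (t c) · w`. -/
theorem tmul_eq_counit_smul_add_cyclicForm {C : ChainCoalgebra.{u, v} R} (c : C.carrier)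
    (w : Cobar C) : c ⊗ₜ[R] w = Coalgebra.counit (R := R) c • C.unit ⊗ₜ[R] w +
      cyclicForm C (univTwist C c) w := by
  rw [cyclicForm_univTwist, TensorProduct.sub_tmul, TensorProduct.smul_tmul']
  abel

theorem proj_cyclicForm {C : ChainCoalgebra.{u, v} R} (a h : Cobar C) :
    (coHochProj C).toLin (cyclicForm C a h) =
      cobarCounit C h • (coHochProj C).toLin (cyclicForm C a 1) := by
  have key (k : ℕ) (z) : (coHochProj C).toLin
      ((sign (tensorGrading C.grading (cobarGrading C)) ^ k) z) =
      (sign C.grading ^ k) ((coHochProj C).toLin z) := ((coHochProj C).sign_pow k z).symm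
  have ht (c : C.carrier) (w : Cobar C) : (coHochProj C).toLin (c ⊗ₜ w) = cobarCounit C w • c := by
    simp [coHochProj]
  refine cobar_induction (P := fun a => ∀ h, (coHochProj C).toLin (cyclicForm C a h) =
      cobarCounit C h • (coHochProj C).toLin (cyclicForm C a 1)) (fun h => ?_)
    (fun n x hx m b _ ih h => ?_) (fun a b ha hb h => ?_) (fun r a ha h => ?_) a h
  · simp [cyclicForm_one]
  · simp only [cyclicForm_mul (univTwist_mem hx), cyclicForm_univTwist_of_pos hx, map_add, key, ht,
      ih (_ * _), map_mul, cobarCounit_univTwist, mul_zero, zero_mul, zero_smul, map_zero, add_zero,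
      mul_one, smul_smul, mul_comm]
  · simp only [map_add, LinearMap.add_apply, ha h, hb h, smul_add]
  · simp only [map_smul, LinearMap.smul_apply, ha h, smul_comm r]

namespace HirschCoalgebra

variable (B : HirschCoalgebra.{u, v} R)

/-- The loop comultiplication as a chain map. -/
noncomputable def comulChain : ChainMap (cobar B.toChainCoalgebra)
    (tensorCx (cobar B.toChainCoalgebra) (cobar B.toChainCoalgebra)) where
  toLin := B.loopComul
  map_mem := B.psi_mem
  map_d := B.psi_d

theorem isGradedBialgebra : IsGradedBialgebra (cobarGrading B.toChainCoalgebra) B.loopComul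
    (cobarCounit B.toChainCoalgebra) where
  comul_mem := B.psi_mem
  comul_one := by
    simp only [loopComul, tensorSquareLin, LinearMap.comp_apply, AlgHom.toLinearMap_apply, map_one]
    rfl
  comul_mul x y := by
    simp [gradedMul_apply, loopComul, tensorSquareLin]
  coassoc := B.psi_coassoc
  counit_left := B.psi_counit_left
  counit_right := B.psi_counit_right
  counit_of_pos n hn x hx := cobarCounit_of_pos hn hx

theorem convPower_eq_powerMap (k : ℕ) :
    convPower B.loopComul (cobarCounit B.toChainCoalgebra) k = B.powerMap k := by
  induction k with
  | zero => rfl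
  | succ k ih => simp only [convPower, powerMap, ih]

theorem powerMap_cobarD (k : ℕ) (x : Cobar B.toChainCoalgebra) :
    B.powerMap k (cobarD B.toChainCoalgebra x) = cobarD B.toChainCoalgebra (B.powerMap k x) := by
  induction k generalizing x with
  | zero => simp [powerMap, cobarCounit_cobarD, cobarD_algebraMap]
  | succ k ih =>
    let l : ChainMap (cobar B.toChainCoalgebra) (cobar B.toChainCoalgebra) :=
      ⟨B.powerMap k, fun n x hx => by
        rw [← convPower_eq_powerMap]; exact B.isGradedBialgebra.convPower_mem k n x hx, ih⟩
    exact ((cobarMulChain _).comp ((l.tensor (ChainMap.id _)).comp B.comulChain)).map_d x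

/-- The power map `λ_k` as a chain map. -/
noncomputable def powerChain (k : ℕ) :
    ChainMap (cobar B.toChainCoalgebra) (cobar B.toChainCoalgebra) where
  toLin := B.powerMap k
  map_mem n x hx := by
    rw [← convPower_eq_powerMap]; exact B.isGradedBialgebra.convPower_mem k n x hx
  map_d := B.powerMap_cobarD k

/-- The map `formPower` of the bialgebra `Ω C` as a chain map. -/
noncomputable def formPowerChain (k : ℕ) :
    ChainMap (tensorCx (cobar B.toChainCoalgebra) (cobar B.toChainCoalgebra))
      (tensorCx (cobar B.toChainCoalgebra) (cobar B.toChainCoalgebra)) :=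
  ((ChainMap.id _).tensor ((cobarMulChain B.toChainCoalgebra).comp
    (((ChainMap.id _).tensor ((B.powerChain k).comp (cobarMulChain B.toChainCoalgebra))).comp
      ((ChainMap.assoc _ _ _).comp (((ChainMap.swap _ _).tensor (ChainMap.id _)).comp
        ((ChainMap.assocSymm _ _ _).comp ((ChainMap.id _).tensor B.comulChain))))))).comp
    ((ChainMap.assoc _ _ _).comp (B.comulChain.tensor (ChainMap.id _)))

theorem formPowerChain_toLin (k : ℕ) : (B.formPowerChain k).toLin =
    formPower (cobarGrading B.toChainCoalgebra) B.loopComul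
      (convPower B.loopComul (cobarCounit B.toChainCoalgebra) k) := by
  rw [convPower_eq_powerMap]
  rfl

/-- The map `Da · h ↦ Da · h (a h) ^ k` with values in the coHochschild complex. -/
noncomputable def powerForm (k : ℕ) : Cobar B.toChainCoalgebra ⊗[R] Cobar B.toChainCoalgebra →ₗ[R]
    B.carrier ⊗[R] Cobar B.toChainCoalgebra :=
  TensorProduct.lift (cyclicForm B.toChainCoalgebra) ∘ₗ (B.formPowerChain k).toLin

theorem powerForm_mem (k n : ℕ) (z) (hz : z ∈ tensorGrading (cobarGrading B.toChainCoalgebra)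
    (cobarGrading B.toChainCoalgebra) n) : B.powerForm k z ∈
      tensorGrading B.grading (cobarGrading B.toChainCoalgebra) (n + 1) := by
  refine tensorGrading_induction (P := fun z =>
    TensorProduct.lift (cyclicForm B.toChainCoalgebra) z ∈
      tensorGrading B.grading (cobarGrading B.toChainCoalgebra) (n + 1)) (by simp)
    (fun x y hx hy => by rw [map_add]; exact add_mem hx hy)
    (fun p q hpq a ha h hh => ?_) ((B.formPowerChain k).map_mem n z hz)
  subst hpq
  exact cyclicForm_mem ha hh

/-- The underlying linear map of the `(k + 1)`-st power map of the coHochschild complex: it is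
`λ_(k+1)` on `1 ⊗ Ω C` and `Da · h ↦ Da · h (a h) ^ k` on cyclic one-forms. -/
noncomputable def powerTildeLin (k : ℕ) : B.carrier ⊗[R] Cobar B.toChainCoalgebra →ₗ[R]
    B.carrier ⊗[R] Cobar B.toChainCoalgebra :=
  TensorProduct.mk R _ _ B.unit ∘ₗ B.powerMap (k + 1) ∘ₗ (TensorProduct.lid R _).toLinearMap ∘ₗ
      LinearMap.rTensor _ (Coalgebra.counit (R := R)) +
    B.powerForm k ∘ₗ LinearMap.rTensor _ (univTwist B.toChainCoalgebra)

theorem powerTildeLin_tmul (k : ℕ) (c : B.carrier) (w : Cobar B.toChainCoalgebra) :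
    B.powerTildeLin k (c ⊗ₜ w) = Coalgebra.counit (R := R) c • B.unit ⊗ₜ B.powerMap (k + 1) w +
      B.powerForm k (univTwist B.toChainCoalgebra c ⊗ₜ w) := by
  simp [powerTildeLin]

theorem powerTildeLin_unit_tmul (k : ℕ) (w : Cobar B.toChainCoalgebra) :
    B.powerTildeLin k (B.unit ⊗ₜ w) = B.unit ⊗ₜ B.powerMap (k + 1) w := by
  rw [powerTildeLin_tmul, univTwist_of_zero B.unit_mem, B.unit_isGroupLike.counit_eq_one]
  simp

theorem powerTildeLin_mem (k n : ℕ) (z) (hz : z ∈ tensorGrading B.grading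
    (cobarGrading B.toChainCoalgebra) n) : B.powerTildeLin k z ∈
      tensorGrading B.grading (cobarGrading B.toChainCoalgebra) n := by
  refine tensorGrading_induction (P := fun z => B.powerTildeLin k z ∈
      tensorGrading B.grading (cobarGrading B.toChainCoalgebra) n) (by simp)
    (fun x y hx hy => by rw [map_add]; exact add_mem hx hy)
    (fun p q hpq c hc w hw => ?_) hz
  rw [powerTildeLin_tmul]
  cases p with
  | zero =>
    rw [univTwist_of_zero hc, TensorProduct.zero_tmul, map_zero, add_zero]
    exact Submodule.smul_mem _ _ (tmul_mem_tensorGrading hpq B.unit_mem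
      ((B.powerChain (k + 1)).map_mem q w hw))
  | succ p =>
    rw [B.counit_of_pos p c hc, zero_smul, zero_add]
    have := B.powerForm_mem k (p + q) _ (tmul_mem_tensorGrading rfl (univTwist_mem hc) hw)
    rwa [show p + q + 1 = n by omega] at this

variable {B}

theorem powerTildeLin_cyclicForm (hB : B.IsBalanced) (k : ℕ) (a h : Cobar B.toChainCoalgebra) :
    B.powerTildeLin k (cyclicForm B.toChainCoalgebra a h) = B.powerForm k (a ⊗ₜ h) := by
  have H := B.isGradedBialgebra
  refine cobar_induction (P := fun a => ∀ h, B.powerTildeLin k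
    (cyclicForm B.toChainCoalgebra a h) = B.powerForm k (a ⊗ₜ h)) (fun h => ?_)
    (fun n x hx m b hb ih h => ?_) (fun a b ha hb h => ?_) (fun r a ha h => ?_) a h
  · rw [cyclicForm_one, map_zero, powerForm, formPowerChain_toLin, LinearMap.comp_apply,
      formPower_tmul, H.comul_one]
    simp [cyclicForm_one]
  · refine homogeneous_induction (cobarGrading B.toChainCoalgebra) (P := fun h =>
      B.powerTildeLin k (cyclicForm B.toChainCoalgebra (univTwist B.toChainCoalgebra x * b) h) =
        B.powerForm k ((univTwist B.toChainCoalgebra x * b) ⊗ₜ h))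
      (fun h h' hh hh' => by rw [map_add, map_add, hh, hh', TensorProduct.tmul_add, map_add])
      (fun q h hh => ?_) h
    have key := H.cyclicForm_formPower_mul hB (isCyclicForm_cyclicForm B.toChainCoalgebra) k
      (univTwist_mem hx) hb hh
    simp only [← formPowerChain_toLin] at key
    rw [cyclicForm_mul (univTwist_mem hx), map_add, ← sign_pow_map (B.powerTildeLin_mem k), ih,
      cyclicForm_univTwist_of_pos hx, powerTildeLin_tmul, B.counit_of_pos n x hx, zero_smul,
      zero_add]
    exact key.symm
  · rw [map_add, LinearMap.add_apply, map_add, ha, hb, TensorProduct.add_tmul, map_add]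
  · rw [map_smul, LinearMap.smul_apply, map_smul, ha, ← TensorProduct.smul_tmul', map_smul]

theorem powerTildeLin_coHochD (hB : B.IsBalanced) (k : ℕ)
    (z : B.carrier ⊗[R] Cobar B.toChainCoalgebra) :
    B.powerTildeLin k (coHochD B.toChainCoalgebra z) =
      coHochD B.toChainCoalgebra (B.powerTildeLin k z) := by
  have H := B.isGradedBialgebra
  have hι (w : Cobar B.toChainCoalgebra) : coHochD B.toChainCoalgebra (B.unit ⊗ₜ w) =
      B.unit ⊗ₜ cobarD B.toChainCoalgebra w :=
    ((coHochIncl B.toChainCoalgebra).map_d w).symm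
  have hκ (z : Cobar B.toChainCoalgebra ⊗[R] Cobar B.toChainCoalgebra) : B.powerTildeLin k
      (TensorProduct.lift (cyclicForm B.toChainCoalgebra) z) = B.powerForm k z := by
    refine LinearMap.congr_fun (TensorProduct.ext' (g := B.powerTildeLin k ∘ₗ
      TensorProduct.lift (cyclicForm B.toChainCoalgebra)) (h := B.powerForm k) fun a h => ?_) z
    simp [powerTildeLin_cyclicForm hB]
  have hd : ∀ z, (B.formPowerChain k).toLin (tensorD _ _ z) = tensorD _ _ _ :=
    (B.formPowerChain k).map_d
  have hm := H.mul_formPower k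
  have hs := H.mul_koszulSwap_formPower hB k
  rw [← formPowerChain_toLin, convPower_eq_powerMap] at hm hs
  induction z with
  | zero => simp
  | add x y hx hy => simp only [map_add, hx, hy]
  | tmul c w =>
    rw [tmul_eq_counit_smul_add_cyclicForm, map_add, map_add, map_add, map_add, map_smul, map_smul,
      map_smul, map_smul, hι, powerTildeLin_unit_tmul, powerTildeLin_unit_tmul, hι,
      powerMap_cobarD, ← TensorProduct.lift.tmul, coHochD_lift_cyclicForm, hκ, powerForm,
      LinearMap.comp_apply, coHochD_lift_cyclicForm, hm, hs, ← hd, map_sub, map_neg,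
      powerTildeLin_unit_tmul, hκ, map_sub]
    rfl

theorem proj_powerTildeLin (k : ℕ) (z : B.carrier ⊗[R] Cobar B.toChainCoalgebra) :
    (coHochProj B.toChainCoalgebra).toLin (B.powerTildeLin k z) =
      (coHochProj B.toChainCoalgebra).toLin z := by
  have H := B.isGradedBialgebra
  have ht (c : B.carrier) (w : Cobar B.toChainCoalgebra) :
      (coHochProj B.toChainCoalgebra).toLin (c ⊗ₜ w) =
        cobarCounit B.toChainCoalgebra w • c := by
    simp [coHochProj]
  have hF (a h : Cobar B.toChainCoalgebra) :
      (coHochProj B.toChainCoalgebra).toLin (B.powerForm k (a ⊗ₜ h)) =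
        (coHochProj B.toChainCoalgebra).toLin (cyclicForm B.toChainCoalgebra a h) := by
    rw [powerForm, LinearMap.comp_apply, formPowerChain_toLin, formPower_tmul,
      proj_cyclicForm a h]
    have h₁ := H.counit_right' (((coHochProj B.toChainCoalgebra).toLin ∘ₗ
      (cyclicForm B.toChainCoalgebra).flip 1)) a
    simp only [LinearMap.comp_apply, LinearMap.flip_apply] at h₁
    rw [← h₁]
    generalize B.loopComul a = y
    induction y with
    | zero => simp
    | add x y hx hy => simp only [map_add, smul_add, hx, hy]
    | tmul x y =>
      simp only [TensorProduct.map_tmul, TensorProduct.lift.tmul, LinearMap.id_apply,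
        LinearMap.comp_apply, LinearMap.flip_apply, TensorProduct.mk_apply]
      rw [proj_cyclicForm x, H.counit_interleave (H.counit_convPower k), mul_comm, mul_smul]
      rfl
  induction z with
  | zero => simp
  | add x y hx hy => simp only [map_add, hx, hy]
  | tmul c w =>
    rw [powerTildeLin_tmul]
    conv_rhs => rw [tmul_eq_counit_smul_add_cyclicForm]
    rw [map_add, map_add, hF, map_smul, map_smul, ht, ht, ← convPower_eq_powerMap,
      H.counit_convPower]

/-- The `(k + 1)`-st power map of the coHochschild complex. -/
noncomputable def powerTilde (hB : B.IsBalanced) (k : ℕ) :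
    ChainMap B.coHochschild B.coHochschild where
  toLin := B.powerTildeLin k
  map_mem := B.powerTildeLin_mem k
  map_d := powerTildeLin_coHochD hB k

end HirschCoalgebra

end Power

/-! ### Naturality -/

section Naturality

variable {R : Type u} [CommRing R]

section Bialgebra

variable {A : Type v} [Ring A] [Algebra R A] {𝓐 : ℕ → Submodule R A} [GradedAlgebra 𝓐]
  {ψ : A →ₗ[R] A ⊗[R] A} {A' : Type w} [Ring A'] [Algebra R A'] {𝓐' : ℕ → Submodule R A'}
  [GradedAlgebra 𝓐'] {ψ' : A' →ₗ[R] A' ⊗[R] A'} {g : A →ₐ[R] A'}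

theorem map_convPower {ε : A →ₐ[R] R} {ε' : A' →ₐ[R] R} (hε : ∀ x, ε' (g x) = ε x)
    (hψ : ∀ x, TensorProduct.map g.toLinearMap g.toLinearMap (ψ x) = ψ' (g x)) (k : ℕ) (x : A) :
    g (convPower ψ ε k x) = convPower ψ' ε' k (g x) := by
  induction k generalizing x with
  | zero => simp [convPower, hε]
  | succ k ih =>
    simp only [convPower, LinearMap.comp_apply, ← hψ]
    induction ψ x with
    | zero => simp
    | add x y hx hy => simp only [map_add, hx, hy]
    | tmul x y => simp [ih]

theorem map_interleave (hg : ∀ n, ∀ x ∈ 𝓐 n, g x ∈ 𝓐' n)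
    (hψ : ∀ x, TensorProduct.map g.toLinearMap g.toLinearMap (ψ x) = ψ' (g x))
    {l : A →ₗ[R] A} {l' : A' →ₗ[R] A'} (hl : ∀ x, g (l x) = l' (g x)) (x h : A) :
    g (interleave 𝓐 ψ l (x ⊗ₜ h)) = interleave 𝓐' ψ' l' (g x ⊗ₜ g h) := by
  refine homogeneous_induction 𝓐 (P := fun x => g (interleave 𝓐 ψ l (x ⊗ₜ h)) =
    interleave 𝓐' ψ' l' (g x ⊗ₜ g h))
    (fun x y hx hy => by simp only [TensorProduct.add_tmul, map_add, hx, hy]) (fun q x hx => ?_) x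
  rw [interleave_of_mem l hx, interleave_of_mem l' (hg q x hx), ← hψ]
  have hs (y : A) : g ((sign 𝓐 ^ q) y) = (sign 𝓐' ^ q) (g y) :=
    (sign_pow_map (f := g.toLinearMap) hg q y).symm
  induction ψ h with
  | zero => simp
  | add x y hx hy => simp only [map_add, hx, hy]
  | tmul x y => simp [hl, hs]

theorem map_formPower (hg : ∀ n, ∀ x ∈ 𝓐 n, g x ∈ 𝓐' n)
    (hψ : ∀ x, TensorProduct.map g.toLinearMap g.toLinearMap (ψ x) = ψ' (g x))
    {l : A →ₗ[R] A} {l' : A' →ₗ[R] A'} (hl : ∀ x, g (l x) = l' (g x)) (a h : A) :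
    TensorProduct.map g.toLinearMap g.toLinearMap (formPower 𝓐 ψ l (a ⊗ₜ h)) =
      formPower 𝓐' ψ' l' (g a ⊗ₜ g h) := by
  rw [formPower_tmul, formPower_tmul, ← hψ]
  induction ψ a with
  | zero => simp
  | add x y hx hy => simp only [map_add, hx, hy]
  | tmul x y => simp [map_interleave hg hψ hl]

end Bialgebra

variable {C : ChainCoalgebra.{u, v} R} {C' : ChainCoalgebra.{u, w} R} (f : CoalgebraMap C C')

theorem cobarCounit_cobarMap (w : Cobar C) : cobarCounit C' (cobarMap f w) = cobarCounit C w := by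
  refine cobar_induction (P := fun w => cobarCounit C' (cobarMap f w) = cobarCounit C w) (by simp)
    (fun n x _ m b _ _ => ?_) (fun a b ha hb => by simp only [map_add, ha, hb])
    (fun r a ha => by simp only [map_smul, ha]) w
  simp [cobarMap_univTwist, cobarCounit_univTwist]

theorem map_cyclicForm (a h : Cobar C) :
    TensorProduct.map f.toLin (cobarMap f).toLinearMap (cyclicForm C a h) =
      cyclicForm C' (cobarMap f a) (cobarMap f h) := by
  refine cobar_induction (P := fun a => ∀ h, TensorProduct.map f.toLin (cobarMap f).toLinearMap
      (cyclicForm C a h) = cyclicForm C' (cobarMap f a) (cobarMap f h))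
    (fun h => by simp [cyclicForm_one]) (fun n x hx m b hb ih h => ?_)
    (fun a b ha hb h => by simp only [map_add, LinearMap.add_apply, ha, hb])
    (fun r a ha h => by simp only [map_smul, LinearMap.smul_apply, ha]) a h
  have hs := sign_pow_map (coHochMap f).map_mem n (cyclicForm C b (h * univTwist C x))
  change _ = TensorProduct.map f.toLin (cobarMap f).toLinearMap _ at hs
  have hs' : (coHochMap f).toLin (cyclicForm C b (h * univTwist C x)) = _ := ih _
  have hfx := f.map_mem _ x hx
  have e₁ := map_mul (cobarMap f) (univTwist C x) b
  have e₂ := map_mul (cobarMap f) h (univTwist C x)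
  rw [cobarMap_univTwist] at e₁ e₂
  rw [cyclicForm_mul (univTwist_mem hx), map_add, ← hs, hs', e₁, e₂,
    cyclicForm_mul (univTwist_mem hfx), cyclicForm_univTwist_of_pos hx,
    cyclicForm_univTwist_of_pos hfx]
  simp

variable {B : HirschCoalgebra.{u, v} R} {B' : HirschCoalgebra.{u, w} R}

theorem HirschMap.map_powerTildeLin (f : HirschMap B B') (k : ℕ)
    (z : B.carrier ⊗[R] Cobar B.toChainCoalgebra) :
    TensorProduct.map f.toLin (cobarMap f.toCoalgebraMap).toLinearMap (B.powerTildeLin k z) =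
      B'.powerTildeLin k (TensorProduct.map f.toLin (cobarMap f.toCoalgebraMap).toLinearMap z) := by
  have hl := map_convPower (cobarCounit_cobarMap f.toCoalgebraMap) f.map_psi
  have hκ (y : Cobar B.toChainCoalgebra ⊗[R] Cobar B.toChainCoalgebra) :
      TensorProduct.map f.toLin (cobarMap f.toCoalgebraMap).toLinearMap
        (TensorProduct.lift (cyclicForm B.toChainCoalgebra) y) =
      TensorProduct.lift (cyclicForm B'.toChainCoalgebra) (TensorProduct.map
        (cobarMap f.toCoalgebraMap).toLinearMap (cobarMap f.toCoalgebraMap).toLinearMap y) := by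
    induction y with
    | zero => simp
    | add x y hx hy => simp only [map_add, hx, hy]
    | tmul a h => simp [map_cyclicForm]
  induction z with
  | zero => simp
  | add x y hx hy => simp only [map_add, hx, hy]
  | tmul c w =>
    rw [TensorProduct.map_tmul, HirschCoalgebra.powerTildeLin_tmul,
      HirschCoalgebra.powerTildeLin_tmul, map_add, map_smul, TensorProduct.map_tmul, f.map_unit,
      f.map_counit, ← HirschCoalgebra.convPower_eq_powerMap,
      ← HirschCoalgebra.convPower_eq_powerMap, HirschCoalgebra.powerForm,
      HirschCoalgebra.powerForm, LinearMap.comp_apply, LinearMap.comp_apply, hκ,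
      HirschCoalgebra.formPowerChain_toLin, HirschCoalgebra.formPowerChain_toLin,
      map_formPower (cobarMap_mem f.toCoalgebraMap) f.map_psi (hl k), AlgHom.toLinearMap_apply,
      hl, cobarMap_univTwist]
    rfl

end Naturality

end CoHochschild

theorem corollary3p2 (R : Type u) [CommRing R] [IsDomain R] [IsPrincipalIdealRing R]
    (r : ℕ) (hr : 0 < r) :
    ∃ powerTilde : ∀ B : CoHochschild.HirschCoalgebra.{u, v} R, B.IsBalanced →
        CoHochschild.ChainMap B.coHochschild B.coHochschild,
      (∀ (B : CoHochschild.HirschCoalgebra.{u, v} R) (hB : B.IsBalanced),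
        (powerTilde B hB).toLin ∘ₗ (CoHochschild.coHochIncl B.toChainCoalgebra).toLin =
            (CoHochschild.coHochIncl B.toChainCoalgebra).toLin ∘ₗ B.powerMap r ∧
          (CoHochschild.coHochProj B.toChainCoalgebra).comp (powerTilde B hB) =
            CoHochschild.coHochProj B.toChainCoalgebra) ∧
      (∀ (B B' : CoHochschild.HirschCoalgebra.{u, v} R) (hB : B.IsBalanced)
          (hB' : B'.IsBalanced) (f : CoHochschild.HirschMap B B'),
        (CoHochschild.coHochMap f.toCoalgebraMap).comp (powerTilde B hB) =
          (powerTilde B' hB').comp (CoHochschild.coHochMap f.toCoalgebraMap)) := by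
  obtain ⟨k, rfl⟩ : ∃ k, r = k + 1 := ⟨r - 1, by omega⟩
  refine ⟨fun B hB => CoHochschild.HirschCoalgebra.powerTilde hB k, fun B hB => ⟨?_, ?_⟩,
    fun B B' hB hB' f => ?_⟩
  · exact LinearMap.ext fun w => B.powerTildeLin_unit_tmul k w
  · exact CoHochschild.ChainMap.ext (LinearMap.ext fun z =>
      CoHochschild.HirschCoalgebra.proj_powerTildeLin k z)
  · exact CoHochschild.ChainMap.ext (LinearMap.ext fun z => f.map_powerTildeLin k z)
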